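/- Let $d\ge 3$ and let $\mathbb H^d=\{x\in\mathbb R^{d+1} : (x^0)^2-\sum_{j=1}^d (x^j)^2=1,\ x^0>0\}$ be hyperbolic space, with the Riemannian metric induced by the Minkowski metric, volume $\mu$, Laplace–Beltrami operator $\Delta_{\mathbb H^d}$, origin $\mathbf 0=(0,\dots,0,1)$, and radial variable $r(x)=\mathbf d_{\mathbb H^d}(x,\mathbf 0)$. Let $V:\mathbb H^d\to\mathbb R$ be a $C^1$ potential that is non-negative, $V\ge 0$, and repulsive, i.e. $-\partial_r V\ge 0$ on $\mathbb H^d\setminus\{\mathbf 0\}$, where $\partial_r$ is the radial derivative in geodesic polar coordinates $(r,\omega)\mapsto(\sinh r\cdot\omega,\cosh r)$. Let $-\Delta_{\mathbb H^d}+V$ denote the non-negative self-adjoint operator on $L^2(\mathbb H^d;\mathbb C)$ associated with the closure of the quadratic form $\int_{\mathbb H^d}(|\nabla u|_{\mathbf g}^2+V|u|^2)\,d\mu$ on $C_0^\infty(\mathbb H^d)$, let $D_V=\sqrt{-\Delta_{\mathbb H^d}+V}$, and let $e^{\pm itD_V}$ be defined by functional calculus. Then there is a constant $C$, depending only on $d$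 and $V$, such that for every $f\in L^2(\mathbb H^d)$ and each choice of sign, $$\Big\|\frac{1}{\cosh r}\,e^{\pm itD_V}f\Big\|_{L^2(\mathbb R;L^2(\mathbb H^d))}\le C\,\|f\|_{L^2(\mathbb H^d)}.$$ -/

import Mathlib

open MeasureTheory
open scoped ENNReal ContDiff ComplexConjugate

noncomputable section

namespace HypWave

/-! ### Hyperbolic space -/

/-- The bilinear form `[x, y] = x⁰ y⁰ - ∑ⱼ xʲ yʲ` on `ℝ^{d+1}`, where a vector of `ℝ^{d+1}` is
written as a pair `((x¹, …, xᵈ), x⁰)`. -/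
def lorentz {d : ℕ} (x y : EuclideanSpace ℝ (Fin d) × ℝ) : ℝ :=
  x.2 * y.2 - ∑ j, x.1 j * y.1 j

/-- Hyperbolic space `ℍᵈ = {x ∈ ℝ^{d+1} : [x, x] = 1, x⁰ > 0}`, as a subspace of `ℝ^{d+1}`. -/
abbrev Hyp (d : ℕ) : Type :=
  {x : EuclideanSpace ℝ (Fin d) × ℝ // lorentz x x = 1 ∧ 0 < x.2}

variable {d : ℕ}

theorem lorentz_self (x : EuclideanSpace ℝ (Fin d) × ℝ) :
    lorentz x x = x.2 ^ 2 - ‖x.1‖ ^ 2 := by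
  rw [EuclideanSpace.real_norm_sq_eq]
  simp [lorentz, sq]

/-- The origin `𝟎 = (0, …, 0, 1)` of `ℍᵈ`. -/
def origin (d : ℕ) : Hyp d := ⟨(0, 1), by simp [lorentz_self]⟩

/-- The radial variable `r(x) = d(x, 𝟎) = cosh⁻¹ [x, 𝟎]`. -/
def radius (x : Hyp d) : ℝ := Real.arcosh (lorentz x.1 (origin d).1)

/-- Geodesic polar coordinates `(r, θ) ↦ (sinh r · θ, cosh r)`. -/
def polar (r : ℝ) (θ : Metric.sphere (0 : EuclideanSpace ℝ (Fin d)) 1) : Hyp d :=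
  ⟨(Real.sinh r • (θ : EuclideanSpace ℝ (Fin d)), Real.cosh r), by
    have h : ‖(θ : EuclideanSpace ℝ (Fin d))‖ = 1 := by simp
    refine ⟨?_, Real.cosh_pos r⟩
    rw [lorentz_self]
    simp only [norm_smul, h, Real.norm_eq_abs, mul_one, sq_abs]
    exact Real.cosh_sq_sub_sinh_sq r⟩

/-- The hyperboloid is the graph of `y ↦ √(1 + |y|²)` over `ℝᵈ`. This is its graph
parametrization, whose inverse is a global chart. -/
def graph (y : EuclideanSpace ℝ (Fin d)) : Hyp d :=
  ⟨(y, √(1 + ‖y‖ ^ 2)), by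
    have h : 0 < 1 + ‖y‖ ^ 2 := by positivity
    refine ⟨?_, Real.sqrt_pos.2 h⟩
    rw [lorentz_self]
    simp only [Real.sq_sqrt h.le]
    ring⟩

theorem graph_fst (x : Hyp d) : graph x.1.1 = x := by
  have h := x.2.1
  rw [lorentz_self] at h
  apply Subtype.ext
  refine Prod.ext rfl ?_
  change √(1 + ‖x.1.1‖ ^ 2) = x.1.2
  rw [show 1 + ‖x.1.1‖ ^ 2 = x.1.2 ^ 2 by linarith]
  exact Real.sqrt_sq x.2.2.le

/-- The graph parametrization as a homeomorphism `ℝᵈ ≃ ℍᵈ`. -/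
def graphHomeo (d : ℕ) : EuclideanSpace ℝ (Fin d) ≃ₜ Hyp d where
  toFun := graph
  invFun x := x.1.1
  left_inv _ := rfl
  right_inv := graph_fst
  continuous_toFun := by
    refine Continuous.subtype_mk ?_ _
    fun_prop
  continuous_invFun := by fun_prop

/-- A function on `ℍᵈ` is of class `Cⁿ` if it is so in the global chart. -/
def HypContDiff {F : Type*} [NormedAddCommGroup F] [NormedSpace ℝ F] (n : WithTop ℕ∞)
    (f : Hyp d → F) : Prop :=
  ContDiff ℝ n (f ∘ graph)

/-- The matrix `g_{ij} = 𝐦(∂ᵢΦ, ∂ⱼΦ)` of the metric of `ℍᵈ` in the global chart: the pullback of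
the Minkowski metric `𝐦 = diag(1, …, 1, -1) = -[·, ·]` by the parametrization
`Φ(y) = (y, √(1 + |y|²))`. -/
def metric (y : EuclideanSpace ℝ (Fin d)) : Matrix (Fin d) (Fin d) ℝ :=
  Matrix.of fun i j =>
    -lorentz
      (fderiv ℝ (fun z : EuclideanSpace ℝ (Fin d) => (graph z).1) y (EuclideanSpace.single i 1))
      (fderiv ℝ (fun z : EuclideanSpace ℝ (Fin d) => (graph z).1) y (EuclideanSpace.single j 1))

/-- The Riemannian volume `μ` of `ℍᵈ`: in the global chart it is `√(det g) dy`. -/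
def vol (d : ℕ) : Measure (Hyp d) :=
  ((volume : Measure (EuclideanSpace ℝ (Fin d))).withDensity
    fun y => ENNReal.ofReal √(metric y).det).map graph

/-- The partial derivative `∂ᵢ u` in the global chart, at the point `x`. -/
def pd (i : Fin d) (u : Hyp d → ℂ) (x : Hyp d) : ℂ :=
  fderiv ℝ (u ∘ graph) x.1.1 (EuclideanSpace.single i 1)

/-- The Hermitian product `⟨∇u, ∇v⟩_g = ∑ g^{ij} conj(∂ᵢ u) ∂ⱼ v` of two gradients. -/
def gradInner (u v : Hyp d → ℂ) (x : Hyp d) : ℂ :=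
  ∑ i, ∑ j, (((metric x.1.1)⁻¹ i j : ℝ) : ℂ) * (conj (pd i u x) * pd j v x)

/-! Explicit formulas for the metric in the global chart. -/

theorem fderiv_graph (y v : EuclideanSpace ℝ (Fin d)) :
    fderiv ℝ (fun z : EuclideanSpace ℝ (Fin d) => (graph z).1) y v
      = (v, inner ℝ y v / √(1 + ‖y‖ ^ 2)) := by
  have h : (1 + ‖y‖ ^ 2) ≠ 0 := by positivity
  have h1 : HasFDerivAt (fun z : EuclideanSpace ℝ (Fin d) => 1 + ‖z‖ ^ 2)
      (2 • innerSL ℝ y) y := (hasStrictFDerivAt_norm_sq y).hasFDerivAt.const_add 1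
  have h2 := (hasFDerivAt_id y).prodMk (h1.sqrt h)
  have h3 := h2.fderiv
  change fderiv ℝ (fun z : EuclideanSpace ℝ (Fin d) => (z, √(1 + ‖z‖ ^ 2))) y v = _
  simp only [id] at h3
  rw [h3]
  simp
  field_simp

theorem metric_apply (y : EuclideanSpace ℝ (Fin d)) (i j : Fin d) :
    metric y i j = (1 : Matrix (Fin d) (Fin d) ℝ) i j - y i * y j / (1 + ‖y‖ ^ 2) := by
  have h : 0 < 1 + ‖y‖ ^ 2 := by positivity
  have hs := Real.mul_self_sqrt h.le
  simp only [metric, Matrix.of_apply, fderiv_graph, lorentz]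
  simp only [EuclideanSpace.inner_single_right, one_mul, conj_trivial, div_mul_div_comm, hs]
  simp [Matrix.one_apply, eq_comm]

theorem metric_mul (y : EuclideanSpace ℝ (Fin d)) :
    metric y * (1 + Matrix.vecMulVec y.ofLp y.ofLp) = 1 := by
  have h : (1 + ‖y‖ ^ 2) ≠ 0 := by positivity
  have hm : metric y = 1 - (1 + ‖y‖ ^ 2)⁻¹ • Matrix.vecMulVec y.ofLp y.ofLp := by
    ext i j
    rw [metric_apply]
    simp [Matrix.vecMulVec_apply]
    ring
  have hv : Matrix.vecMulVec y.ofLp y.ofLp * Matrix.vecMulVec y.ofLp y.ofLp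
      = ‖y‖ ^ 2 • Matrix.vecMulVec y.ofLp y.ofLp := by
    rw [Matrix.vecMulVec_mul_vecMulVec]
    have : y.ofLp ⬝ᵥ y.ofLp = ‖y‖ ^ 2 := by
      rw [EuclideanSpace.real_norm_sq_eq]
      simp [dotProduct, sq]
    rw [this]
    ext i j
    simp [Matrix.vecMulVec_apply]
    ring
  rw [hm, Matrix.mul_add, Matrix.mul_one, Matrix.sub_mul, Matrix.one_mul, Matrix.smul_mul, hv]
  ext i j
  simp only [Matrix.add_apply, Matrix.sub_apply, Matrix.smul_apply, smul_eq_mul]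
  field_simp
  ring

/-- `g^{ij} = δᵢⱼ + yᵢ yⱼ`. -/
theorem metric_inv (y : EuclideanSpace ℝ (Fin d)) :
    (metric y)⁻¹ = 1 + Matrix.vecMulVec y.ofLp y.ofLp :=
  Matrix.inv_eq_right_inv (metric_mul y)

/-- `√(det g) = 1 / √(1 + |y|²)`. -/
theorem sqrt_det_metric (y : EuclideanSpace ℝ (Fin d)) :
    √(metric y).det = (√(1 + ‖y‖ ^ 2))⁻¹ := by
  have h := congrArg Matrix.det (metric_mul y)
  rw [Matrix.det_mul, Matrix.det_one] at h
  have h2 : (1 + Matrix.vecMulVec y.ofLp y.ofLp).det = 1 + ‖y‖ ^ 2 := by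
    have := Matrix.det_one_add_replicateCol_mul_replicateRow (ι := Unit) y.ofLp y.ofLp
    rw [← Matrix.vecMulVec_eq] at this
    rw [this, EuclideanSpace.real_norm_sq_eq]
    simp [dotProduct, sq]
  rw [h2] at h
  rw [eq_inv_of_mul_eq_one_left h, Real.sqrt_inv]

/-! ### Test functions and the quadratic form of `-Δ + V + 1` -/

/-- The space `C₀^∞(ℍᵈ)` of complex-valued test functions. -/
def TestFn (d : ℕ) : Submodule ℂ (Hyp d → ℂ) where
  carrier := {φ | HypContDiff ∞ φ ∧ HasCompactSupport φ}
  zero_mem' := ⟨contDiff_const, HasCompactSupport.zero⟩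
  add_mem' := fun ha hb => ⟨ha.1.add hb.1, ha.2.add hb.2⟩
  smul_mem' := fun c _ ha => ⟨contDiff_const.smul ha.1, ha.2.smul_left (f := fun _ => c)⟩

theorem HypContDiff.continuous {F : Type*} [NormedAddCommGroup F] [NormedSpace ℝ F]
    {n : WithTop ℕ∞} {f : Hyp d → F} (hf : HypContDiff n f) : Continuous f := by
  have h : Continuous (f ∘ graphHomeo d) := ContDiff.continuous hf
  exact (graphHomeo d).comp_continuous_iff'.1 h

theorem measurableEmbedding_graph : MeasurableEmbedding (graph (d := d)) :=
  (graphHomeo d).measurableEmbedding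

instance vol_isFiniteMeasureOnCompacts : IsFiniteMeasureOnCompacts (vol d) where
  lt_top_of_isCompact := by
    intro K hK
    have hK' : IsCompact (graph (d := d) ⁻¹' K) := (graphHomeo d).isCompact_preimage.2 hK
    rw [vol, measurableEmbedding_graph.map_apply,
      withDensity_apply _ hK'.measurableSet]
    have hc : Continuous fun y : EuclideanSpace ℝ (Fin d) => √(metric y).det := by
      simp only [sqrt_det_metric]
      refine Continuous.inv₀ (by fun_prop) fun y => ?_
      positivity
    exact (hc.continuousOn.integrableOn_compact hK').lintegral_lt_top

theorem TestFn.continuous (φ : TestFn d) : Continuous (φ : Hyp d → ℂ) := φ.2.1.continuous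

theorem continuous_pd (φ : TestFn d) (i : Fin d) : Continuous (pd i φ) := by
  have h : Continuous (fderiv ℝ ((φ : Hyp d → ℂ) ∘ graph)) :=
    ContDiff.continuous_fderiv φ.2.1 (by simp)
  exact (h.comp (by fun_prop : Continuous fun x : Hyp d => x.1.1)).clm_apply continuous_const

theorem hasCompactSupport_pd (φ : TestFn d) (i : Fin d) : HasCompactSupport (pd i φ) := by
  have h1 : HasCompactSupport ((φ : Hyp d → ℂ) ∘ graph) :=
    φ.2.2.comp_homeomorph (graphHomeo d)
  have h2 := (h1.fderiv_apply ℝ (EuclideanSpace.single i 1)).comp_homeomorph (graphHomeo d).symm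
  exact h2

theorem pd_add (φ ψ : TestFn d) (i : Fin d) (x : Hyp d) :
    pd i (φ + ψ : TestFn d) x = pd i φ x + pd i ψ x := by
  have h1 := (ContDiff.differentiable φ.2.1 (by simp)).differentiableAt (x := x.1.1)
  have h2 := (ContDiff.differentiable ψ.2.1 (by simp)).differentiableAt (x := x.1.1)
  have := congrArg (fun L => L (EuclideanSpace.single i 1)) (fderiv_add h1 h2)
  exact this

theorem pd_smul (c : ℂ) (φ : TestFn d) (i : Fin d) (x : Hyp d) :
    pd i (c • φ : TestFn d) x = c * pd i φ x := by
  have h1 := (ContDiff.differentiable φ.2.1 (by simp)).differentiableAt (x := x.1.1)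
  have := congrArg (fun L => L (EuclideanSpace.single i 1)) (fderiv_const_smul h1 c)
  exact this

/-- The integrand `⟨∇u, ∇v⟩_g + (V + 1) conj(u) v`. -/
def formDensity (V : Hyp d → ℝ) (u v : Hyp d → ℂ) (x : Hyp d) : ℂ :=
  gradInner u v x + ((V x + 1 : ℝ) : ℂ) * (conj (u x) * v x)

/-- The Hermitian form `q(u, v) = ∫ (⟨∇u, ∇v⟩_g + (V + 1) conj(u) v) dμ` of `-Δ + V + 1`. -/
def form (V : Hyp d → ℝ) (u v : Hyp d → ℂ) : ℂ :=
  ∫ x, formDensity V u v x ∂vol d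

theorem integrable_formDensity {V : Hyp d → ℝ} (hV : Continuous V) (φ ψ : TestFn d) :
    Integrable (formDensity V φ ψ) (vol d) := by
  have hφ := TestFn.continuous φ
  have hψ := TestFn.continuous ψ
  refine Continuous.integrable_of_hasCompactSupport ?_ ?_
  · unfold formDensity gradInner
    refine Continuous.add ?_ (by fun_prop)
    refine continuous_finsetSum _ fun i _ => continuous_finsetSum _ fun j _ => ?_
    have h1 := continuous_pd φ i
    have h2 := continuous_pd ψ j
    refine Continuous.mul ?_ (by fun_prop)
    simp only [metric_inv, Matrix.add_apply, Matrix.vecMulVec_apply]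
    fun_prop
  · refine HasCompactSupport.intro (ψ.2.2.isCompact.union
      (isCompact_iUnion fun j => (hasCompactSupport_pd ψ j).isCompact)) fun x hx => ?_
    simp only [Set.mem_union, Set.mem_iUnion, not_or, not_exists] at hx
    simp [formDensity, gradInner, image_eq_zero_of_notMem_tsupport hx.1,
      fun j => image_eq_zero_of_notMem_tsupport (hx.2 j)]

theorem conj_formDensity (V : Hyp d → ℝ) (u v : Hyp d → ℂ) (x : Hyp d) :
    conj (formDensity V v u x) = formDensity V u v x := by
  simp only [formDensity, gradInner, map_add, map_sum, map_mul, Complex.conj_conj,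
    Complex.conj_ofReal, metric_inv]
  rw [Finset.sum_comm]
  congr 1
  · refine Finset.sum_congr rfl fun i _ => Finset.sum_congr rfl fun j _ => ?_
    simp only [Matrix.add_apply, Matrix.vecMulVec_apply, Matrix.one_apply, eq_comm (a := j)]
    rw [mul_comm (x.1.1 j)]
    ring
  · ring

theorem re_formDensity (V : Hyp d → ℝ) (u : Hyp d → ℂ) (x : Hyp d) :
    (formDensity V u u x).re = ∑ i, ‖pd i u x‖ ^ 2 + ‖∑ i, (x.1.1 i : ℂ) * pd i u x‖ ^ 2
      + (V x + 1) * ‖u x‖ ^ 2 := by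
  have h : formDensity V u u x = ((∑ i, ‖pd i u x‖ ^ 2 + ‖∑ i, (x.1.1 i : ℂ) * pd i u x‖ ^ 2
      + (V x + 1) * ‖u x‖ ^ 2 : ℝ) : ℂ) := by
    push_cast
    simp only [← Complex.conj_mul', formDensity, gradInner, metric_inv, map_sum, map_mul,
      Complex.conj_ofReal, Matrix.add_apply, Matrix.vecMulVec_apply, Complex.ofReal_add, add_mul,
      Finset.sum_add_distrib, Finset.sum_mul_sum]
    congr 2
    · simp [Matrix.one_apply, apply_ite (Complex.ofReal)]
    · refine Finset.sum_congr rfl fun i _ => Finset.sum_congr rfl fun j _ => ?_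
      push_cast
      ring
  rw [h, Complex.ofReal_re]

theorem norm_sq_le_re_formDensity {V : Hyp d → ℝ} (hV0 : ∀ x, 0 ≤ V x) (u : Hyp d → ℂ)
    (x : Hyp d) : ‖u x‖ ^ 2 ≤ (formDensity V u u x).re := by
  rw [re_formDensity]
  have h1 : 0 ≤ ∑ i, ‖pd i u x‖ ^ 2 := Finset.sum_nonneg fun i _ => by positivity
  have h2 : 0 ≤ V x * ‖u x‖ ^ 2 := mul_nonneg (hV0 x) (by positivity)
  nlinarith [sq_nonneg ‖∑ i, (x.1.1 i : ℂ) * pd i u x‖]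

/-- The test functions, to be equipped with the inner product `q`. -/
def FormCore (V : Hyp d → ℝ) (_ : Continuous V) (_ : ∀ x, 0 ≤ V x) : Type := TestFn d

section FormCore

variable (V : Hyp d → ℝ) (hV : Continuous V) (hV0 : ∀ x, 0 ≤ V x)

instance : AddCommGroup (FormCore V hV hV0) := inferInstanceAs (AddCommGroup (TestFn d))

instance : Module ℂ (FormCore V hV hV0) := inferInstanceAs (Module ℂ (TestFn d))

/-- A test function, as a function. -/
def FormCore.toFun {V : Hyp d → ℝ} {hV : Continuous V} {hV0 : ∀ x, 0 ≤ V x}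
    (φ : FormCore V hV hV0) : Hyp d → ℂ := (show TestFn d from φ).1

/-- The inner product `q` on the test functions. -/
@[reducible]
def formCore : PreInnerProductSpace.Core ℂ (FormCore V hV hV0) where
  inner φ ψ := form V φ.toFun ψ.toFun
  conj_inner_symm φ ψ := by
    simp only [form, ← integral_conj, conj_formDensity]
  re_inner_nonneg φ := by
    have h := integral_re (integrable_formDensity hV φ φ)
    refine le_of_le_of_eq (integral_nonneg fun x => ?_) h
    exact (sq_nonneg _).trans (norm_sq_le_re_formDensity hV0 _ x)
  add_left φ ψ χ := by
    have h := integral_add (integrable_formDensity hV φ χ) (integrable_formDensity hV ψ χ)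
    refine Eq.trans (integral_congr_ae (.of_forall fun x => ?_)) h
    have e : ∀ i, pd i (φ + ψ).toFun x = pd i φ.toFun x + pd i ψ.toFun x :=
      fun i => pd_add φ ψ i x
    have e' : (φ + ψ).toFun x = φ.toFun x + ψ.toFun x := rfl
    change formDensity V (φ + ψ).toFun χ.toFun x
      = formDensity V φ.toFun χ.toFun x + formDensity V ψ.toFun χ.toFun x
    simp only [formDensity, gradInner, e, e', map_add, add_mul, mul_add, Finset.sum_add_distrib]
    ring
  smul_left φ ψ c := by
    have h := integral_const_mul (μ := vol d) (conj c) (formDensity V φ.toFun ψ.toFun)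
    refine Eq.trans (integral_congr_ae (.of_forall fun x => ?_)) h
    have e : ∀ i, pd i (c • φ).toFun x = c * pd i φ.toFun x := fun i => pd_smul c φ i x
    have e' : (c • φ).toFun x = c * φ.toFun x := rfl
    change formDensity V (c • φ).toFun ψ.toFun x = conj c * formDensity V φ.toFun ψ.toFun x
    simp only [formDensity, gradInner, e, e', map_mul, mul_add, Finset.mul_sum]
    congr 1
    · refine Finset.sum_congr rfl fun i _ => Finset.sum_congr rfl fun j _ => ?_
      ring
    · ring

instance : SeminormedAddCommGroup (FormCore V hV hV0) :=
  @InnerProductSpace.Core.toSeminormedAddCommGroup ℂ _ _ _ _ (formCore V hV hV0)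

instance : InnerProductSpace ℂ (FormCore V hV hV0) :=
  InnerProductSpace.ofCore (formCore V hV hV0)

/-- The form domain: the completion of the test functions in the norm `q(u, u)^{1/2}`. -/
abbrev FormSpace : Type := UniformSpace.Completion (FormCore V hV hV0)

theorem FormCore.memLp (φ : FormCore V hV hV0) : MemLp φ.toFun 2 (vol d) :=
  (TestFn.continuous (show TestFn d from φ)).memLp_of_hasCompactSupport
    (show TestFn d from φ).2.2

/-- The inclusion of the test functions into `L²(ℍᵈ)`. -/
def inclCore : FormCore V hV hV0 →ₗ[ℂ] Lp ℂ 2 (vol d) where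
  toFun φ := (FormCore.memLp V hV hV0 φ).toLp φ.toFun
  map_add' _ _ := rfl
  map_smul' _ _ := rfl

theorem norm_inclCore_le (φ : FormCore V hV hV0) : ‖inclCore V hV hV0 φ‖ ≤ 1 * ‖φ‖ := by
  rw [one_mul, ← sq_le_sq₀ (norm_nonneg _) (norm_nonneg _), ← inner_self_eq_norm_sq (𝕜 := ℂ),
    ← inner_self_eq_norm_sq (𝕜 := ℂ) φ, L2.inner_def]
  have hint := integrable_formDensity hV φ φ
  have h := integral_re hint
  change RCLike.re _ ≤ RCLike.re (form V φ.toFun φ.toFun)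
  have h2 := integral_re (L2.integrable_inner (𝕜 := ℂ) (inclCore V hV hV0 φ)
    (inclCore V hV hV0 φ))
  rw [← h2]
  refine le_of_le_of_eq (integral_mono_ae (L2.integrable_inner (𝕜 := ℂ) _ _).re hint.re ?_) h
  filter_upwards [(FormCore.memLp V hV hV0 φ).coeFn_toLp] with x hx
  have hx' : (inclCore V hV hV0 φ) x = φ.toFun x := hx
  simp only [hx', inner_self_eq_norm_sq]
  exact norm_sq_le_re_formDensity hV0 _ x

/-- The continuous extension `ι` of the inclusion `C₀^∞ ⊆ L²` to the form domain. -/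
def incl : FormSpace V hV hV0 →L[ℂ] Lp ℂ 2 (vol d) :=
  ((inclCore V hV hV0).mkContinuous 1 (norm_inclCore_le V hV hV0)).extend
    (UniformSpace.Completion.toComplL (𝕜 := ℂ) (E := FormCore V hV hV0))

theorem incl_coe (φ : FormCore V hV hV0) :
    incl V hV hV0 (φ : FormSpace V hV hV0) = inclCore V hV hV0 φ :=
  ContinuousLinearMap.extend_eq _ (UniformSpace.Completion.denseRange_coe)
    (UniformSpace.Completion.isUniformInducing_coe _) φ

/-- A function of `L²` that is orthogonal to all test functions vanishes. -/
theorem eq_zero_of_orthogonal (f : Lp ℂ 2 (vol d))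
    (hf : ∀ φ : FormCore V hV hV0, inner ℂ (inclCore V hV hV0 φ) f = 0) : f = 0 := by
  have hgr : ∀ᵐ x ∂vol d, f x = 0 := by
    refine measurableEmbedding_graph.ae_map_iff.2 ?_
    refine ae_eq_zero_of_integral_contDiff_smul_eq_zero (f := fun y => f (graph y)) ?_ ?_
    · refine locallyIntegrable_iff.2 fun K hK => ?_
      have hK' : IsCompact (graph '' K) := hK.image (graphHomeo d).continuous
      have h1 : IntegrableOn f (graph '' K) (vol d) := by
        have : IsFiniteMeasure ((vol d).restrict (graph '' K)) :=
          ⟨by simpa using hK'.measure_lt_top⟩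
        exact ((Lp.memLp f).restrict _).integrable (by norm_num)
      have h2 := measurableEmbedding_graph.integrableOn_map_iff.1 h1
      rwa [Set.preimage_image_eq _ (show Function.Injective (graph (d := d)) from (graphHomeo d).injective)] at h2
    · intro g hg hgs
      have hmem : (fun x : Hyp d => (g x.1.1 : ℂ)) ∈ TestFn d := by
        refine ⟨Complex.ofRealCLM.contDiff.comp hg, ?_⟩
        have := hgs.comp_homeomorph (graphHomeo d).symm
        exact this.comp_left (g := fun r : ℝ => (r : ℂ)) Complex.ofReal_zero
      have h := hf (show FormCore V hV hV0 from (⟨_, hmem⟩ : TestFn d))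
      rw [L2.inner_def] at h
      have h2 : ∫ x, (g x.1.1 : ℂ) * f x ∂vol d = 0 := by
        rw [← h]
        refine integral_congr_ae ?_
        filter_upwards [(FormCore.memLp V hV hV0
          (show FormCore V hV hV0 from (⟨_, hmem⟩ : TestFn d))).coeFn_toLp] with x hx
        have hx' : (inclCore V hV hV0 (show FormCore V hV hV0 from (⟨_, hmem⟩ : TestFn d))) x
          = (g x.1.1 : ℂ) := hx
        rw [hx', RCLike.inner_apply, Complex.conj_ofReal, mul_comm]
      have h3 := (measurableEmbedding_graph.integral_map _).symm.trans h2
      simpa only [Complex.real_smul] using! h3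
  exact (Lp.eq_zero_iff_ae_eq_zero).2 hgr

/-- The resolvent `R = (1 - Δ + V)⁻¹` on `L²(ℍᵈ)` of the self-adjoint operator `-Δ + V` that is
associated with the form: `R f` is the element `u` of the form domain with `q(ψ, u) = ⟨ψ, f⟩` for
all `ψ`. In formulas, `R = ι ι*`, with the adjoint with respect to `q` and to `L²`. -/
def resolvent : Lp ℂ 2 (vol d) →L[ℂ] Lp ℂ 2 (vol d) :=
  incl V hV hV0 ∘L (incl V hV hV0).adjoint

theorem resolvent_isSelfAdjoint : IsSelfAdjoint (resolvent V hV hV0) := by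
  rw [ContinuousLinearMap.isSelfAdjoint_iff', resolvent, ContinuousLinearMap.adjoint_comp,
    ContinuousLinearMap.adjoint_adjoint]

/-- `R f` is the (image in `L²` of the) element `u` of the form domain with `q(ψ, u) = ⟨ψ, f⟩` for
all test functions `ψ`, that is, the weak solution of `-Δu + Vu + u = f`. -/
theorem resolvent_spec (f : Lp ℂ 2 (vol d)) :
    ∃ u : FormSpace V hV hV0, incl V hV hV0 u = resolvent V hV hV0 f ∧
      ∀ ψ : FormCore V hV hV0,
        inner ℂ (ψ : FormSpace V hV hV0) u = inner ℂ (inclCore V hV hV0 ψ) f := by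
  refine ⟨(incl V hV hV0).adjoint f, rfl, fun ψ => ?_⟩
  rw [ContinuousLinearMap.adjoint_inner_right, incl_coe]

theorem denseRange_resolvent : DenseRange (resolvent V hV hV0) := by
  have hker : LinearMap.ker (resolvent V hV hV0).toLinearMap = ⊥ := by
    rw [LinearMap.ker_eq_bot']
    intro f hf
    have h1 : (incl V hV hV0).adjoint f = 0 := by
      have h2 : inner ℂ (incl V hV hV0 ((incl V hV hV0).adjoint f)) f = 0 := by
        have : incl V hV hV0 ((incl V hV hV0).adjoint f) = 0 := hf
        rw [this, inner_zero_left]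
      rw [← ContinuousLinearMap.adjoint_inner_right] at h2
      exact inner_self_eq_zero.1 h2
    refine eq_zero_of_orthogonal V hV hV0 f fun φ => ?_
    rw [← incl_coe, ← ContinuousLinearMap.adjoint_inner_right, h1, inner_zero_right]
  have h := (resolvent V hV hV0).orthogonal_range
  rw [(ContinuousLinearMap.isSelfAdjoint_iff'.1 (resolvent_isSelfAdjoint V hV hV0)), hker] at h
  have h2 := (Submodule.topologicalClosure_eq_top_iff).2 h
  exact Submodule.dense_iff_topologicalClosure_eq_top.2 h2

end FormCore

/-! ### Functional calculus and the half-wave propagators -/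

/-- Functional calculus of a self-adjoint operator `A ≥ 0` that is given through its resolvent
`R = (1 + A)⁻¹`: for a bounded continuous `g`, the operator `g(A)` is the bounded operator with
`g(A) R = h(R)`, where `h(z) = g(1/z - 1) z` (so that `h(1/(1+a)) = g(a)/(1+a)`) and `h(R)` is the
continuous functional calculus of the bounded self-adjoint operator `R`. As the range of `R` is
dense, this determines `g(A)`. -/
def funCalc {E : Type*} [NormedAddCommGroup E] [InnerProductSpace ℂ E] [CompleteSpace E]
    (R : E →L[ℂ] E) (g : ℝ → ℂ) : E →L[ℂ] E :=
  (cfc (fun z : ℂ => g (1 / z.re - 1) * z) R).toLinearMap.extendOfNorm R.toLinearMap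

open scoped ComplexOrder in
/-- The defining property of `g(A)`. -/
theorem funCalc_apply {E : Type*} [NormedAddCommGroup E] [InnerProductSpace ℂ E] [CompleteSpace E]
    {R : E →L[ℂ] E} (hR : IsSelfAdjoint R) (hd : DenseRange R) {g : ℝ → ℂ} (hg : Continuous g)
    {M : ℝ} (hM : ∀ a, ‖g a‖ ≤ M) (x : E) :
    funCalc R g (R x) = cfc (fun z : ℂ => g (1 / z.re - 1) * z) R x := by
  set h : ℂ → ℂ := fun z => g (1 / z.re - 1) * z with hh
  have hn : IsStarNormal R := hR.isStarNormal
  have hle : ∀ z, ‖h z‖ ≤ M * ‖z‖ := fun z => by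
    rw [hh, norm_mul]
    exact mul_le_mul_of_nonneg_right (hM _) (norm_nonneg _)
  have hc : ContinuousOn h (spectrum ℂ R) := by
    intro z hz
    have hre : z = z.re := hR.mem_spectrum_eq_re hz
    refine ContinuousAt.continuousWithinAt ?_
    by_cases h0 : z = 0
    · subst h0
      have hz0 : h 0 = 0 := by simp [hh]
      rw [ContinuousAt, hz0]
      refine squeeze_zero_norm hle ?_
      have : Continuous fun z : ℂ => M * ‖z‖ := by fun_prop
      simpa using this.tendsto 0
    · have hre0 : z.re ≠ 0 := fun h' => h0 (by rw [hre, h', Complex.ofReal_zero])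
      refine ContinuousAt.mul (hg.continuousAt.comp ?_) continuousAt_id
      exact (continuousAt_const.div Complex.continuous_re.continuousAt hre0).sub continuousAt_const
  refine LinearMap.extendOfNorm_eq (f := (cfc h R).toLinearMap) (e := R.toLinearMap) hd
    ⟨M, fun y => ?_⟩ x
  have hM0 : 0 ≤ M := (norm_nonneg _).trans (hM 0)
  have hpos : 0 ≤ ((M : ℂ) • R).adjoint * ((M : ℂ) • R) - (cfc h R).adjoint * cfc h R := by
    have e1 : ((M : ℂ) • R).adjoint * ((M : ℂ) • R) = cfc (fun z : ℂ => star ((M : ℂ) * z) * ((M : ℂ) * z)) R := by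
      rw [cfc_mul .., cfc_star, cfc_const_mul_id ..]
      rfl
    have e2 : (cfc h R).adjoint * cfc h R = cfc (fun z => star (h z) * h z) R := by
      rw [cfc_mul (fun z => star (h z)) h R (hc.star) hc, cfc_star]
      rfl
    rw [e1, e2, ← cfc_sub (fun z : ℂ => star ((M : ℂ) * z) * ((M : ℂ) * z)) (fun z => star (h z) * h z) R
      (by fun_prop) (hc.star.mul hc)]
    refine cfc_nonneg fun z _ => ?_
    have e3 : ∀ w : ℂ, star w * w = ((‖w‖ ^ 2 : ℝ) : ℂ) := fun w => by
      push_cast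
      exact Complex.conj_mul' w
    rw [e3, e3, ← Complex.ofReal_sub]
    refine Complex.zero_le_real.2 (sub_nonneg.2 ?_)
    rw [norm_mul (M : ℂ), Complex.norm_real, Real.norm_of_nonneg hM0]
    exact pow_le_pow_left₀ (norm_nonneg _) (hle z) 2
  rw [ContinuousLinearMap.nonneg_iff_isPositive] at hpos
  have h1 := hpos.re_inner_nonneg_right y
  have key : ‖cfc h R y‖ ^ 2 ≤ (M * ‖R y‖) ^ 2 := by
    have e4 : ∀ B : E →L[ℂ] E, RCLike.re (inner ℂ y ((B.adjoint * B) y)) = ‖B y‖ ^ 2 := fun B => by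
      rw [mul_apply_eq_comp, ContinuousLinearMap.adjoint_inner_right,
        inner_self_eq_norm_sq]
    rw [sub_apply, inner_sub_right, map_sub, e4, e4, sub_nonneg] at h1
    rwa [smul_apply, norm_smul, Complex.norm_real,
      Real.norm_of_nonneg hM0] at h1
  exact (sq_le_sq₀ (norm_nonneg _) (by positivity)).1 key

/-- The half-wave propagator `e^{i t D_V}`, with `D_V = √(-Δ + V)`. -/
def halfWave (V : Hyp d → ℝ) (hV : Continuous V) (hV0 : ∀ x, 0 ≤ V x) (t : ℝ) :
    Lp ℂ 2 (vol d) →L[ℂ] Lp ℂ 2 (vol d) :=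
  funCalc (resolvent V hV hV0) fun a => Complex.exp (Complex.I * t * √a)

/-- The defining property of `e^{i t D_V}`. -/
theorem halfWave_apply (V : Hyp d → ℝ) (hV : Continuous V) (hV0 : ∀ x, 0 ≤ V x) (t : ℝ)
    (f : Lp ℂ 2 (vol d)) :
    halfWave V hV hV0 t (resolvent V hV hV0 f) =
      cfc (fun z : ℂ => Complex.exp (Complex.I * t * √(1 / z.re - 1)) * z)
        (resolvent V hV hV0) f :=
  funCalc_apply (resolvent_isSelfAdjoint V hV hV0) (denseRange_resolvent V hV hV0)
    (g := fun a => Complex.exp (Complex.I * t * √a)) (by fun_prop) (M := 1)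
    (fun a => le_of_eq (by
      rw [mul_assoc, mul_comm, ← Complex.ofReal_mul]
      exact Complex.norm_exp_ofReal_mul_I _)) f

/-- The norm of `L²(ℝ; L²(ℍᵈ))`. -/
def spacetimeNorm (u : ℝ → Hyp d → ℂ) : ℝ≥0∞ :=
  (∫⁻ t, eLpNorm (u t) 2 (vol d) ^ 2) ^ (1 / 2 : ℝ)

/-- A potential is repulsive if `-∂ᵣ V ≥ 0`, where `∂ᵣ` is the radial derivative in geodesic polar
coordinates. -/
def Repulsive (V : Hyp d → ℝ) : Prop :=
  ∀ (θ : Metric.sphere (0 : EuclideanSpace ℝ (Fin d)) 1) (r : ℝ), 0 < r →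
    0 ≤ -deriv (fun s => V (polar s θ)) r

end HypWave

end

open HypWave

/-! ### Kato smoothing from a positive commutator -/

section Abstract

namespace HypWave

open Filter Topology

/-- The phase `e^{i t √(1/z - 1)}` of the half-wave propagator in the resolvent variable. -/
noncomputable def phase (t : ℝ) (z : ℂ) : ℂ := Complex.exp (Complex.I * t * √(1 / z.re - 1))

theorem phase_eq (t : ℝ) (z : ℂ) :
    phase t z = Complex.exp ((t * √(1 / z.re - 1) : ℝ) * Complex.I) := by
  rw [phase]; congr 1; push_cast; ring

theorem norm_phase (t : ℝ) (z : ℂ) : ‖phase t z‖ = 1 := by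
  rw [phase_eq, Complex.norm_exp_ofReal_mul_I]

theorem continuousAt_phase (t : ℝ) {z : ℂ} (hz : z.re ≠ 0) : ContinuousAt (phase t) z := by
  unfold phase
  have : ContinuousAt (fun z : ℂ => 1 / z.re - 1) z :=
    (continuousAt_const.div Complex.continuous_re.continuousAt hz).sub continuousAt_const
  have h2 : ContinuousAt (fun a : ℝ => Complex.exp (Complex.I * t * √a)) (1 / z.re - 1) := by
    have : Continuous (fun a : ℝ => Complex.exp (Complex.I * t * √a)) := by fun_prop
    exact this.continuousAt
  exact ContinuousAt.comp (f := fun z : ℂ => 1 / z.re - 1) h2 this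

theorem continuousOn_phase_mul {s : Set ℂ} (hs : ∀ z ∈ s, z = z.re) (t : ℝ) {k : ℂ → ℂ}
    (hk : Continuous k) (h0 : k 0 = 0) : ContinuousOn (fun z => phase t z * k z) s := by
  intro z hz
  refine ContinuousAt.continuousWithinAt ?_
  by_cases h : z = 0
  · subst h
    rw [ContinuousAt, h0, mul_zero]
    refine squeeze_zero_norm (a := fun z => ‖k z‖) (fun z => by
      rw [norm_mul, norm_phase, one_mul]) ?_
    have : Continuous fun z => ‖k z‖ := hk.norm
    simpa [h0] using this.tendsto 0
  · have : z.re ≠ 0 := fun h' => h (by rw [hs z hz, h', Complex.ofReal_zero])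
    exact (continuousAt_phase t this).mul hk.continuousAt

/-- A second-order Taylor bound for the exponential on the imaginary axis. -/
theorem norm_exp_mul_I_sub_sub_le (x : ℝ) :
    ‖Complex.exp (x * Complex.I) - 1 - x * Complex.I‖ ≤ 2 * x ^ 2 := by
  rcases le_or_gt |x| 1 with h | h
  · have := Complex.norm_exp_sub_one_sub_id_le (x := x * Complex.I) (by simpa using h)
    rw [norm_mul, Complex.norm_I, mul_one, Complex.norm_real, Real.norm_eq_abs, sq_abs] at this
    nlinarith [sq_nonneg x]
  · have h1 : ‖Complex.exp (x * Complex.I) - 1‖ ≤ ‖x‖ := by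
      have := Real.norm_exp_I_mul_ofReal_sub_one_le (x := x)
      rwa [mul_comm] at this
    have h2 : ‖(x : ℂ) * Complex.I‖ = |x| := by simp
    refine (norm_sub_le _ _).trans ?_
    rw [h2]
    rw [Real.norm_eq_abs] at h1
    nlinarith [sq_abs x]

variable {E : Type*} [NormedAddCommGroup E] [InnerProductSpace ℂ E] [CompleteSpace E]

/-- `e^{i t D} R`. -/
noncomputable def waveRes (R : E →L[ℂ] E) (t : ℝ) : E →L[ℂ] E := cfc (fun z => phase t z * z) R

/-- `√(z (1 - z))`, the symbol of `D R`. -/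
noncomputable def sqrtSymbol (z : ℂ) : ℂ := (√(z.re * (1 - z.re)) : ℝ)

theorem continuous_sqrtSymbol : Continuous sqrtSymbol := by unfold sqrtSymbol; fun_prop

theorem sqrtSymbol_zero : sqrtSymbol 0 = 0 := by simp [sqrtSymbol]

/-- `e^{i t D} D R`. -/
noncomputable def waveSqrt (R : E →L[ℂ] E) (t : ℝ) : E →L[ℂ] E :=
  cfc (fun z => phase t z * sqrtSymbol z) R

variable {R : E →L[ℂ] E}

/-- The spectral hypothesis: `R` is self-adjoint with spectrum in `[0, 1/2]`. -/
structure SpecHalf (R : E →L[ℂ] E) : Prop where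
  normal : IsStarNormal R
  real : ∀ z ∈ spectrum ℂ R, z = z.re
  nonneg : ∀ z ∈ spectrum ℂ R, 0 ≤ z.re
  le_half : ∀ z ∈ spectrum ℂ R, z.re ≤ 1 / 2

theorem sqrtSymbol_mul_self {z : ℂ} (hr : z = z.re) (h0 : 0 ≤ z.re) (h1 : z.re ≤ 1 / 2) :
    sqrtSymbol z * sqrtSymbol z = z * (1 - z) := by
  unfold sqrtSymbol
  rw [← Complex.ofReal_mul, Real.mul_self_sqrt (mul_nonneg h0 (by linarith))]
  conv_rhs => rw [hr]
  push_cast; ring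

theorem SpecHalf.continuousOn (hR : SpecHalf R) (t : ℝ) :
    ContinuousOn (fun z => phase t z * z) (spectrum ℂ R) :=
  continuousOn_phase_mul hR.real t continuous_id rfl

theorem SpecHalf.continuousOn' (hR : SpecHalf R) (t : ℝ) :
    ContinuousOn (fun z => phase t z * sqrtSymbol z) (spectrum ℂ R) :=
  continuousOn_phase_mul hR.real t continuous_sqrtSymbol sqrtSymbol_zero

theorem SpecHalf.res_mul_waveSqrt (hR : SpecHalf R) (t : ℝ) :
    R * waveSqrt R t = waveSqrt R 0 * waveRes R t := by
  have := hR.normal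
  have e1 := cfc_mul (fun z : ℂ => z) _ R (by fun_prop) (hR.continuousOn' t)
  have e2 := cfc_mul _ _ R (hR.continuousOn' 0) (hR.continuousOn t)
  rw [cfc_id' ..] at e1
  rw [waveSqrt, ← e1, waveSqrt, waveRes, ← e2]
  congr 1; ext z; simp [phase]; ring

theorem SpecHalf.waveRes_mul_sqrt (hR : SpecHalf R) (t : ℝ) :
    waveRes R t * waveSqrt R 0 = waveSqrt R 0 * waveRes R t := by
  have := hR.normal
  exact (cfc_commute_cfc _ _ R)

theorem SpecHalf.sqrt_mul_waveSqrt (hR : SpecHalf R) (t : ℝ) :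
    waveSqrt R 0 * waveSqrt R t = (1 - R) * waveRes R t := by
  have := hR.normal
  have e1 := cfc_mul _ _ R (hR.continuousOn' 0) (hR.continuousOn' t)
  have e2 := cfc_mul (fun z : ℂ => 1 - z) _ R (by fun_prop) (hR.continuousOn t)
  have e3 : cfc (fun z : ℂ => 1 - z) R = 1 - R := by
    rw [cfc_sub (fun _ : ℂ => (1 : ℂ)) (fun z => z) R, cfc_const_one .., cfc_id' ..]
  rw [e3] at e2
  rw [waveSqrt, waveSqrt, ← e1, waveRes, ← e2]
  refine cfc_congr fun z hz => ?_
  have := sqrtSymbol_mul_self (hR.real z hz) (hR.nonneg z hz) (hR.le_half z hz)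
  simp only [phase, Complex.ofReal_zero, mul_zero, zero_mul, Complex.exp_zero, one_mul]
  linear_combination Complex.exp (Complex.I * t * √(1 / z.re - 1)) * this

theorem SpecHalf.sqrt_isSelfAdjoint (hR : SpecHalf R) : IsSelfAdjoint (waveSqrt R 0) := by
  have := hR.normal
  rw [IsSelfAdjoint, waveSqrt, ← cfc_star]
  congr 1; ext z; simp [phase, sqrtSymbol]

theorem SpecHalf.waveRes_zero (hR : SpecHalf R) : waveRes R 0 = R := by
  have := hR.normal
  have : (fun z : ℂ => phase 0 z * z) = fun z => z := by ext z; simp [phase]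
  rw [waveRes, this, cfc_id' ..]

theorem sqrt_mul_sqrt_inv {x : ℝ} (h0 : 0 ≤ x) (h1 : x ≤ 1 / 2) :
    √(1 / x - 1) * x = √(x * (1 - x)) := by
  rcases h0.eq_or_lt with rfl | h
  · simp
  · rw [← Real.sqrt_sq h0, ← Real.sqrt_mul, Real.sqrt_sq h0]
    · congr 1; field_simp
    · rw [Real.sqrt_sq h0, sub_nonneg, le_div_iff₀ h]; linarith

theorem SpecHalf.norm_waveRes_sub_le (hR : SpecHalf R) (t s : ℝ) :
    ‖waveRes R s - waveRes R t - (s - t) • (Complex.I • waveSqrt R t)‖ ≤ 2 * (s - t) ^ 2 := by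
  have := hR.normal
  have c1 := hR.continuousOn s
  have c2 := hR.continuousOn t
  have c3 := hR.continuousOn' t
  have key : waveRes R s - waveRes R t - (s - t) • (Complex.I • waveSqrt R t) =
      cfc (fun z => phase s z * z - phase t z * z
        - (((s - t : ℝ) : ℂ) * Complex.I) * (phase t z * sqrtSymbol z)) R := by
    have d1 := cfc_sub _ _ R (c1.sub c2)
      (continuousOn_const (c := ((s - t : ℝ) : ℂ) * Complex.I) |>.mul c3)
    have d2 := cfc_sub _ _ R c1 c2
    have d3 := cfc_const_mul (((s - t : ℝ) : ℂ) * Complex.I) _ R c3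
    refine Eq.trans ?_ d1.symm
    refine Eq.trans ?_ (congrArg₂ _ d2.symm d3.symm)
    rw [mul_smul, Complex.coe_smul]
    rfl
  rw [key]
  refine norm_cfc_le (by positivity) fun z hz => ?_
  set l := √(1 / z.re - 1) with hl
  have h0 := hR.nonneg z hz
  have h1 := hR.le_half z hz
  have e1 : phase s z = phase t z * Complex.exp (((s - t) * l : ℝ) * Complex.I) := by
    rw [phase_eq, phase_eq, ← Complex.exp_add, ← hl]; congr 1; push_cast; ring
  have e2 : sqrtSymbol z = l * z := by
    rw [sqrtSymbol, ← sqrt_mul_sqrt_inv h0 h1, ← hl]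
    conv_rhs => rw [hR.real z hz]
    push_cast; rfl
  have e3 : phase s z * z - phase t z * z
        - (((s - t : ℝ) : ℂ) * Complex.I) * (phase t z * sqrtSymbol z)
      = phase t z * z * (Complex.exp (((s - t) * l : ℝ) * Complex.I) - 1
          - ((s - t) * l : ℝ) * Complex.I) := by
    rw [e1, e2]; push_cast; ring
  rw [e3, norm_mul, norm_mul, norm_phase, one_mul]
  have e4 : ‖z‖ = z.re := by
    conv_lhs => rw [hR.real z hz]
    rw [Complex.norm_real, Real.norm_of_nonneg h0]
  have e5 : z.re * l ^ 2 ≤ 1 := by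
    rcases h0.eq_or_lt with h | h
    · rw [← h]; simp
    · rw [hl, Real.sq_sqrt (by rw [sub_nonneg, le_div_iff₀ h]; linarith)]
      field_simp; linarith
  calc ‖z‖ * _ ≤ z.re * (2 * ((s - t) * l) ^ 2) := by
        rw [e4]; exact mul_le_mul_of_nonneg_left (norm_exp_mul_I_sub_sub_le _) h0
    _ = (z.re * l ^ 2) * (2 * (s - t) ^ 2) := by ring
    _ ≤ 1 * (2 * (s - t) ^ 2) := by gcongr
    _ = _ := one_mul _

theorem SpecHalf.hasDerivAt_waveRes (hR : SpecHalf R) (t : ℝ) :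
    HasDerivAt (fun s => waveRes R s) (Complex.I • waveSqrt R t) t := by
  rw [hasDerivAt_iff_isLittleO]
  refine Asymptotics.IsBigO.trans_isLittleO (g := fun s => (s - t) ^ 2)
    (Asymptotics.IsBigO.of_bound 2 (.of_forall fun s => ?_)) ?_
  · rw [Real.norm_of_nonneg (sq_nonneg _)]
    exact hR.norm_waveRes_sub_le t s
  · have h := (Asymptotics.isLittleO_pow_id (𝕜 := ℝ) (n := 2) (by norm_num)).comp_tendsto
      (k := fun s : ℝ => s - t) (l' := 𝓝 t) (by
        have : Continuous fun s : ℝ => s - t := by fun_prop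
        simpa using this.tendsto t)
    exact h

theorem SpecHalf.norm_waveRes_apply (hR : SpecHalf R) (hs : IsSelfAdjoint R) (t : ℝ) (x : E) :
    ‖waveRes R t x‖ = ‖R x‖ := by
  have := hR.normal
  have c := hR.continuousOn t
  have h : (waveRes R t).adjoint * waveRes R t = R.adjoint * R := by
    rw [hs.adjoint_eq]
    change star (waveRes R t) * waveRes R t = R * R
    rw [waveRes, ← cfc_star, ← cfc_mul _ _ R c.star c]
    conv_rhs => rw [← cfc_id' ℂ R, ← cfc_mul (fun z : ℂ => z) (fun z => z) R]
    refine cfc_congr fun z hz => ?_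
    have h1 : star (phase t z) * phase t z = 1 := by
      have := Complex.conj_mul' (phase t z)
      rw [norm_phase] at this
      simpa using this
    have h2 : star z = z := by rw [hR.real z hz]; exact Complex.conj_ofReal _
    rw [star_mul, h2]
    linear_combination z * z * h1
  have e : ∀ A : E →L[ℂ] E, RCLike.re (inner ℂ x ((A.adjoint * A) x)) = ‖A x‖ ^ 2 := fun A => by
    rw [mul_apply_eq_comp, ContinuousLinearMap.adjoint_inner_right,
      inner_self_eq_norm_sq]
  have h3 := e (waveRes R t)
  rw [h, e] at h3
  exact ((sq_eq_sq₀ (norm_nonneg _) (norm_nonneg _)).1 h3).symm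

variable {H : Type*} [NormedAddCommGroup H] [InnerProductSpace ℂ H] [CompleteSpace H]

theorem norm_sq_adjoint_le {ι : H →L[ℂ] E} (hι : ∀ v, 2 * ‖ι v‖ ^ 2 ≤ ‖v‖ ^ 2)
    (hs : IsSelfAdjoint (ι ∘L ι.adjoint)) (hR : SpecHalf (ι ∘L ι.adjoint)) (x : E) :
    ‖ι.adjoint x‖ ^ 2 ≤ 2 * ‖waveSqrt (ι ∘L ι.adjoint) 0 x‖ ^ 2 := by
  set R := ι ∘L ι.adjoint with hRdef
  have := hR.normal
  have h1 := hR.sqrt_mul_waveSqrt 0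
  rw [hR.waveRes_zero] at h1
  have h2 : ‖waveSqrt R 0 x‖ ^ 2 = ‖ι.adjoint x‖ ^ 2 - ‖R x‖ ^ 2 := by
    have hK := hR.sqrt_isSelfAdjoint
    have e1 : RCLike.re (inner ℂ x ((waveSqrt R 0 * waveSqrt R 0) x)) = ‖waveSqrt R 0 x‖ ^ 2 := by
      rw [mul_apply_eq_comp]
      nth_rw 1 [← hK.adjoint_eq]
      rw [ContinuousLinearMap.adjoint_inner_right, inner_self_eq_norm_sq]
    rw [← e1, h1, sub_mul, one_mul, sub_apply, inner_sub_right, map_sub,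
      mul_apply_eq_comp]
    congr 1
    · rw [hRdef, ContinuousLinearMap.comp_apply, ← ContinuousLinearMap.adjoint_inner_left,
        inner_self_eq_norm_sq]
    · nth_rw 1 [← hs.adjoint_eq]
      rw [ContinuousLinearMap.adjoint_inner_right, inner_self_eq_norm_sq]
  have h3 := hι (ι.adjoint x)
  have h4 : R x = ι (ι.adjoint x) := rfl
  rw [h2, h4]
  linarith

theorem integral_norm_sq_le_of_commutator {ι B : H →L[ℂ] E} {W : E →L[ℂ] E} {ε : ℝ}
    (hι : ∀ v, 2 * ‖ι v‖ ^ 2 ≤ ‖v‖ ^ 2)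
    (hs : IsSelfAdjoint (ι ∘L ι.adjoint)) (hR : SpecHalf (ι ∘L ι.adjoint))
    (h1 : ∀ v, (inner ℂ (ι v) (B v)).re ≤ -ε * ‖W (ι v)‖ ^ 2)
    (h2 : ∀ x, 0 ≤ (inner ℂ (x - ι (ι.adjoint x)) (B (ι.adjoint x))).re)
    (y : E) {a b : ℝ} (hab : a ≤ b) :
    ε * ∫ t in a..b, ‖W (waveSqrt (ι ∘L ι.adjoint) 0 (waveRes (ι ∘L ι.adjoint) t y))‖ ^ 2 ≤
      4 * ‖B‖ * ‖waveSqrt (ι ∘L ι.adjoint) 0 ((ι ∘L ι.adjoint) y)‖ ^ 2 := by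
  set R := ι ∘L ι.adjoint with hRdef
  set K := waveSqrt R 0 with hK
  have hx : ∀ t, HasDerivAt (fun s => waveRes R s y) (Complex.I • waveSqrt R t y) t := fun t => by
    have := (ContinuousLinearMap.apply ℂ E y |>.restrictScalars ℝ).hasFDerivAt.comp_hasDerivAt t
      (hR.hasDerivAt_waveRes t)
    exact this
  have hu : ∀ t, HasDerivAt (fun s => K (waveRes R s y)) (K (Complex.I • waveSqrt R t y)) t :=
    fun t => (K.restrictScalars ℝ).hasFDerivAt.comp_hasDerivAt t (hx t)
  have hw : ∀ t, HasDerivAt (fun s => B (ι.adjoint (waveRes R s y)))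
      (B (ι.adjoint (Complex.I • waveSqrt R t y))) t :=
    fun t => ((B ∘L ι.adjoint).restrictScalars ℝ).hasFDerivAt.comp_hasDerivAt t (hx t)
  have hM : ∀ t, HasDerivAt
      (fun s => inner ℂ (Complex.I • K (waveRes R s y)) (B (ι.adjoint (waveRes R s y))))
      (inner ℂ (Complex.I • K (waveRes R t y)) (B (ι.adjoint (Complex.I • waveSqrt R t y)))
        + inner ℂ (Complex.I • K (Complex.I • waveSqrt R t y)) (B (ι.adjoint (waveRes R t y)))) t :=
    fun t => ((hu t).const_smul Complex.I).inner ℂ (hw t)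
  have hM' := fun t => (Complex.reCLM.hasFDerivAt.comp_hasDerivAt t (hM t)).neg
  have hval : ∀ t, ε * ‖W (K (waveRes R t y))‖ ^ 2 ≤
      -(inner ℂ (Complex.I • K (waveRes R t y)) (B (ι.adjoint (Complex.I • waveSqrt R t y)))
        + inner ℂ (Complex.I • K (Complex.I • waveSqrt R t y))
          (B (ι.adjoint (waveRes R t y)))).re := fun t => by
    have e1 : K (waveRes R t y) = ι (ι.adjoint (waveSqrt R t y)) :=
      (congrArg (fun A : E →L[ℂ] E => A y) (hR.res_mul_waveSqrt t)).symm
    have e2 : K (waveSqrt R t y) = waveRes R t y - ι (ι.adjoint (waveRes R t y)) := by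
      have := congrArg (fun A : E →L[ℂ] E => A y) (hR.sqrt_mul_waveSqrt t)
      rw [sub_mul, one_mul] at this
      exact this
    have e3 : inner ℂ (Complex.I • K (waveRes R t y)) (B (ι.adjoint (Complex.I • waveSqrt R t y)))
        = inner ℂ (ι (ι.adjoint (waveSqrt R t y))) (B (ι.adjoint (waveSqrt R t y))) := by
      rw [map_smul, map_smul, inner_smul_left, inner_smul_right, e1, ← mul_assoc]
      simp
    have e4 : inner ℂ (Complex.I • K (Complex.I • waveSqrt R t y)) (B (ι.adjoint (waveRes R t y)))
        = - inner ℂ (waveRes R t y - ι (ι.adjoint (waveRes R t y)))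
          (B (ι.adjoint (waveRes R t y))) := by
      rw [map_smul, smul_smul, Complex.I_mul_I, neg_one_smul, inner_neg_left, e2]
    rw [e3, e4, Complex.add_re, Complex.neg_re]
    have i1 := h1 (ι.adjoint (waveSqrt R t y))
    have i2 := h2 (waveRes R t y)
    rw [e1]
    linarith
  have hcont : Continuous fun t => K (waveRes R t y) :=
    continuous_iff_continuousAt.2 fun t => (hu t).continuousAt
  have hint := intervalIntegral.integral_le_sub_of_hasDeriv_right_of_le hab
    (fun t _ => (hM' t).continuousAt.continuousWithinAt) (fun t _ => (hM' t).hasDerivWithinAt)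
    (φ := fun t => ε * ‖W (K (waveRes R t y))‖ ^ 2)
    (Continuous.integrableOn_Icc (((W.continuous.comp hcont).norm.pow 2).const_mul ε)) (fun t _ => hval t)
  rw [intervalIntegral.integral_const_mul] at hint
  refine hint.trans ?_
  have hbd : ∀ t, |(inner ℂ (Complex.I • K (waveRes R t y)) (B (ι.adjoint (waveRes R t y)))).re|
      ≤ 2 * ‖B‖ * ‖K (R y)‖ ^ 2 := fun t => by
    have n1 : ‖K (waveRes R t y)‖ = ‖K (R y)‖ := by
      have e1 : K (waveRes R t y) = waveRes R t (K y) :=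
        (congrArg (fun A : E →L[ℂ] E => A y) (hR.waveRes_mul_sqrt t)).symm
      have e2 : K (R y) = R (K y) := by
        have := (congrArg (fun A : E →L[ℂ] E => A y) (hR.waveRes_mul_sqrt 0)).symm
        rwa [hR.waveRes_zero] at this
      rw [e1, e2, hR.norm_waveRes_apply hs]
    have n2 := norm_sq_adjoint_le hι hs hR (waveRes R t y)
    rw [← hRdef, ← hK, n1] at n2
    have n3 : ‖ι.adjoint (waveRes R t y)‖ ≤ 2 * ‖K (R y)‖ := by
      refine abs_le_of_sq_le_sq' ?_ (by positivity) |>.2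
      nlinarith [sq_nonneg ‖K (R y)‖]
    calc _ ≤ ‖inner ℂ (Complex.I • K (waveRes R t y)) (B (ι.adjoint (waveRes R t y)))‖ :=
          Complex.abs_re_le_norm _
      _ ≤ ‖Complex.I • K (waveRes R t y)‖ * ‖B (ι.adjoint (waveRes R t y))‖ := norm_inner_le_norm _ _
      _ ≤ ‖K (R y)‖ * (‖B‖ * (2 * ‖K (R y)‖)) := by
        rw [norm_smul, Complex.norm_I, one_mul, n1]
        gcongr
        exact (B.le_opNorm _).trans (by gcongr)
      _ = _ := by ring
  have ba := (abs_le.1 (hbd a))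
  have bb := (abs_le.1 (hbd b))
  simp only [Pi.neg_apply, Function.comp_apply, Complex.reCLM_apply]
  linarith [ba.2, bb.1]

theorem lintegral_norm_sq_le_of_commutator {ι B : H →L[ℂ] E} {W : E →L[ℂ] E} {ε : ℝ} (hε : 0 < ε)
    (hι : ∀ v, 2 * ‖ι v‖ ^ 2 ≤ ‖v‖ ^ 2)
    (hs : IsSelfAdjoint (ι ∘L ι.adjoint)) (hR : SpecHalf (ι ∘L ι.adjoint))
    (h1 : ∀ v, (inner ℂ (ι v) (B v)).re ≤ -ε * ‖W (ι v)‖ ^ 2)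
    (h2 : ∀ x, 0 ≤ (inner ℂ (x - ι (ι.adjoint x)) (B (ι.adjoint x))).re) (y : E) :
    ∫⁻ t : ℝ, ‖W (waveSqrt (ι ∘L ι.adjoint) 0 (waveRes (ι ∘L ι.adjoint) t y))‖ₑ ^ 2 ≤
      ENNReal.ofReal (4 * ‖B‖ / ε * ‖waveSqrt (ι ∘L ι.adjoint) 0 ((ι ∘L ι.adjoint) y)‖ ^ 2) := by
  have hcont : Continuous fun t => W (waveSqrt (ι ∘L ι.adjoint) 0 (waveRes (ι ∘L ι.adjoint) t y)) := by
    have hc : Continuous fun t => waveRes (ι ∘L ι.adjoint) t :=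
      continuous_iff_continuousAt.2 fun t => (hR.hasDerivAt_waveRes t).continuousAt
    fun_prop
  have hcov := aecover_Ioc (μ := (volume : Measure ℝ)) (tendsto_neg_atTop_atBot (G := ℝ)) tendsto_id
  refine le_of_tendsto (hcov.lintegral_tendsto_of_countably_generated
    (f := fun t : ℝ => ‖W (waveSqrt (ι ∘L ι.adjoint) 0 (waveRes (ι ∘L ι.adjoint) t y))‖ₑ ^ 2)
    (hcont.enorm.measurable.pow_const 2).aemeasurable) ?_
  filter_upwards [eventually_ge_atTop 0] with T hT
  have h := integral_norm_sq_le_of_commutator hι hs hR h1 h2 y (a := -T) (b := T) (by linarith)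
  have hnn : (fun t : ℝ => ‖W (waveSqrt (ι ∘L ι.adjoint) 0 (waveRes (ι ∘L ι.adjoint) t y))‖ₑ ^ 2)
      = fun t => ENNReal.ofReal
        (‖W (waveSqrt (ι ∘L ι.adjoint) 0 (waveRes (ι ∘L ι.adjoint) t y))‖ ^ 2) := by
    ext t
    rw [ENNReal.ofReal_pow (norm_nonneg _), ofReal_norm]
  rw [hnn, ← ofReal_integral_eq_lintegral_ofReal]
  · refine ENNReal.ofReal_le_ofReal ?_
    rw [intervalIntegral.integral_of_le (by linarith)] at h
    rw [div_mul_eq_mul_div, le_div_iff₀ hε]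
    simp only [id]
    linarith
  · exact (Continuous.integrableOn_Icc (hcont.norm.pow 2)).mono_set Set.Ioc_subset_Icc_self
  · exact .of_forall fun t => sq_nonneg _

open scoped ComplexOrder in
theorem specHalf_of_two_mul_le {ι : H →L[ℂ] E} (hι : ∀ v, 2 * ‖ι v‖ ^ 2 ≤ ‖v‖ ^ 2) :
    ‖ι ∘L ι.adjoint‖ ≤ 1 / 2 ∧ SpecHalf (ι ∘L ι.adjoint) := by
  set R := ι ∘L ι.adjoint with hRdef
  have hpos : R.IsPositive := by
    have := (ContinuousLinearMap.isPositive_one (𝕜 := ℂ) (E := H)).conj_adjoint ι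
    exact this
  have hn : 0 ≤ R := (ContinuousLinearMap.nonneg_iff_isPositive R).2 hpos
  have hnorm : ‖R‖ ≤ 1 / 2 := by
    have h1 : ‖R‖ = ‖ι.adjoint‖ * ‖ι.adjoint‖ := by
      have := ContinuousLinearMap.norm_adjoint_comp_self ι.adjoint
      rwa [ContinuousLinearMap.adjoint_adjoint] at this
    have h2 : ‖ι‖ ≤ √(1 / 2) := by
      refine ι.opNorm_le_bound (by positivity) fun v => ?_
      refine abs_le_of_sq_le_sq' ?_ (by positivity) |>.2
      rw [mul_pow, Real.sq_sqrt (by norm_num)]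
      linarith [hι v]
    rw [h1, LinearIsometryEquiv.norm_map]
    calc ‖ι‖ * ‖ι‖ ≤ √(1 / 2) * √(1 / 2) := by gcongr
      _ = 1 / 2 := Real.mul_self_sqrt (by norm_num)
  have h0 : ∀ z ∈ spectrum ℂ R, 0 ≤ z := fun z hz => spectrum_nonneg_of_nonneg hn hz
  refine ⟨hnorm, hpos.isSelfAdjoint.isStarNormal, fun z hz => ?_, fun z hz => ?_, fun z hz => ?_⟩
  · exact (Complex.eq_re_of_ofReal_le (r := 0) (by simpa using h0 z hz))
  · exact (Complex.le_def.1 (h0 z hz)).1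
  · have h1 : ‖z‖ ≤ ‖R‖ := by
      rcases subsingleton_or_nontrivial E with hE | hE
      · have : R = 0 := Subsingleton.elim _ _
        have hz' := hz
        rw [spectrum.of_subsingleton] at hz'
        exact absurd hz' (Set.notMem_empty _)
      · exact spectrum.norm_le_norm_of_mem hz
    exact (Complex.re_le_norm z).trans (h1.trans hnorm)

theorem denseRange_sqrt_mul_res (hnorm : ‖R‖ ≤ 1 / 2) (hR : SpecHalf R) (hd : DenseRange R) :
    DenseRange fun y => waveSqrt R 0 (R y) := by
  have hunit : IsUnit (1 - R) := isUnit_one_sub_of_norm_lt_one (by linarith)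
  have hsurj : Function.Surjective (1 - R : E →L[ℂ] E) := by
    obtain ⟨u, hu⟩ := hunit
    intro y
    refine ⟨(↑u⁻¹ : E →L[ℂ] E) y, ?_⟩
    rw [← hu, ← mul_apply_eq_comp, Units.mul_inv, one_apply_eq_self]
  have h1 : DenseRange fun y => (1 - R : E →L[ℂ] E) (R y) :=
    hsurj.denseRange.comp hd (1 - R : E →L[ℂ] E).continuous
  have h2 : DenseRange (waveSqrt R 0) := by
    refine Dense.mono ?_ h1
    rintro _ ⟨y, rfl⟩
    refine ⟨waveSqrt R 0 y, ?_⟩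
    have := congrArg (fun A : E →L[ℂ] E => A y) (hR.sqrt_mul_waveSqrt 0)
    rwa [hR.waveRes_zero] at this
  exact h2.comp hd (waveSqrt R 0).continuous

/-- Kato smoothing for the half-wave group, from a positive commutator. -/
theorem lintegral_funCalc_le_of_commutator {ι B : H →L[ℂ] E} {W : E →L[ℂ] E} {ε : ℝ} (hε : 0 < ε)
    (hι : ∀ v, 2 * ‖ι v‖ ^ 2 ≤ ‖v‖ ^ 2)
    (hs : IsSelfAdjoint (ι ∘L ι.adjoint)) (hd : DenseRange (ι ∘L ι.adjoint))
    (h1 : ∀ v, (inner ℂ (ι v) (B v)).re ≤ -ε * ‖W (ι v)‖ ^ 2)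
    (h2 : ∀ x, 0 ≤ (inner ℂ (x - ι (ι.adjoint x)) (B (ι.adjoint x))).re) (f : E) :
    ∫⁻ t : ℝ, ‖W (funCalc (ι ∘L ι.adjoint) (fun a => Complex.exp (Complex.I * t * √a)) f)‖ₑ ^ 2 ≤
      ENNReal.ofReal (4 * ‖B‖ / ε * ‖f‖ ^ 2) := by
  obtain ⟨hnorm, hR⟩ := specHalf_of_two_mul_le hι
  set R := ι ∘L ι.adjoint with hRdef
  have hU : ∀ (t : ℝ) (y : E), funCalc R (fun a => Complex.exp (Complex.I * t * √a))
      (waveSqrt R 0 (R y)) = waveSqrt R 0 (waveRes R t y) := fun t y => by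
    have e2 : waveSqrt R 0 (R y) = R (waveSqrt R 0 y) := by
      have := (congrArg (fun A : E →L[ℂ] E => A y) (hR.waveRes_mul_sqrt 0)).symm
      rwa [hR.waveRes_zero] at this
    have e3 := congrArg (fun A : E →L[ℂ] E => A y) (hR.waveRes_mul_sqrt t)
    rw [e2, funCalc_apply hs hd (g := fun a => Complex.exp (Complex.I * t * √a)) (by fun_prop)
      (M := 1) (fun a => le_of_eq (by
        rw [mul_assoc, mul_comm, ← Complex.ofReal_mul]
        exact Complex.norm_exp_ofReal_mul_I _))]
    exact e3
  obtain ⟨s, hs1, hs2⟩ := mem_closure_iff_seq_limit.1 (denseRange_sqrt_mul_res hnorm hR hd f)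
  choose y hy using hs1
  have hcont : ∀ n, Continuous fun t => W (waveSqrt R 0 (waveRes R t (y n))) := fun n => by
    have hc : Continuous fun t => waveRes R t :=
      continuous_iff_continuousAt.2 fun t => (hR.hasDerivAt_waveRes t).continuousAt
    fun_prop
  have hlim : ∀ t : ℝ, Tendsto (fun n => ‖W (waveSqrt R 0 (waveRes R t (y n)))‖ₑ ^ 2) atTop
      (𝓝 (‖W (funCalc R (fun a => Complex.exp (Complex.I * t * √a)) f)‖ₑ ^ 2)) := fun t => by
    have hc : Continuous fun g => ‖W (funCalc R (fun a => Complex.exp (Complex.I * t * √a)) g)‖ₑ := by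
      fun_prop
    have hc2 : Tendsto (fun n => ‖W (waveSqrt R 0 (waveRes R t (y n)))‖ₑ) atTop
      (𝓝 (‖W (funCalc R (fun a => Complex.exp (Complex.I * t * √a)) f)‖ₑ)) := by
      refine ((hc.tendsto f).comp hs2).congr fun n => ?_
      rw [Function.comp_apply, ← hy n, hU]
    exact (ENNReal.continuous_pow 2).continuousAt.tendsto.comp hc2
  have hlim2 : Tendsto (fun n => ENNReal.ofReal (4 * ‖B‖ / ε * ‖s n‖ ^ 2)) atTop
      (𝓝 (ENNReal.ofReal (4 * ‖B‖ / ε * ‖f‖ ^ 2))) :=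
    ENNReal.tendsto_ofReal ((hs2.norm.pow 2).const_mul _)
  calc _ = ∫⁻ t : ℝ, liminf (fun n => ‖W (waveSqrt R 0 (waveRes R t (y n)))‖ₑ ^ 2) atTop :=
        lintegral_congr fun t => (hlim t).liminf_eq.symm
    _ ≤ liminf (fun n => ∫⁻ t : ℝ, ‖W (waveSqrt R 0 (waveRes R t (y n)))‖ₑ ^ 2) atTop :=
        lintegral_liminf_le fun n => (hcont n).enorm.measurable.pow_const 2
    _ ≤ liminf (fun n => ENNReal.ofReal (4 * ‖B‖ / ε * ‖s n‖ ^ 2)) atTop := by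
        refine liminf_le_liminf (.of_forall fun n => ?_)
        rw [← hy n]
        exact lintegral_norm_sq_le_of_commutator hε hι hs hR h1 h2 (y n)
    _ = _ := hlim2.liminf_eq

end HypWave
end Abstract

/-! ### Calculus in the graph chart -/

noncomputable section

namespace HypWave

open Filter Topology

section Chart

variable {d : ℕ}

/-- The height `cosh r = √(1 + |y|²)` in the graph chart. -/
def height (y : EuclideanSpace ℝ (Fin d)) : ℝ := √(1 + ‖y‖ ^ 2)

theorem one_add_norm_sq_pos (y : EuclideanSpace ℝ (Fin d)) : 0 < 1 + ‖y‖ ^ 2 := by positivity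

theorem height_pos (y : EuclideanSpace ℝ (Fin d)) : 0 < height y :=
  Real.sqrt_pos.2 (one_add_norm_sq_pos y)

theorem height_sq (y : EuclideanSpace ℝ (Fin d)) : height y ^ 2 = 1 + ‖y‖ ^ 2 :=
  Real.sq_sqrt (one_add_norm_sq_pos y).le

theorem one_le_height (y : EuclideanSpace ℝ (Fin d)) : 1 ≤ height y := by
  have h1 := height_pos y
  have h2 := height_sq y
  nlinarith [sq_nonneg ‖y‖]

theorem contDiff_height {n : WithTop ℕ∞} :
    ContDiff ℝ n (height : EuclideanSpace ℝ (Fin d) → ℝ) := by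
  unfold height
  exact (contDiff_const.add (contDiff_norm_sq ℝ)).sqrt fun y => (one_add_norm_sq_pos y).ne'

@[fun_prop]
theorem continuous_height : Continuous (height : EuclideanSpace ℝ (Fin d) → ℝ) :=
  (contDiff_height (n := 0)).continuous

/-- The density `1 / cosh r` of the volume in the graph chart. -/
def dens (y : EuclideanSpace ℝ (Fin d)) : ℝ := (height y)⁻¹

theorem dens_pos (y : EuclideanSpace ℝ (Fin d)) : 0 < dens y := inv_pos.2 (height_pos y)

@[fun_prop]
theorem continuous_dens : Continuous (dens : EuclideanSpace ℝ (Fin d) → ℝ) :=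
  continuous_height.inv₀ fun y => (height_pos y).ne'

@[fun_prop]
theorem continuous_graph : Continuous (graph : EuclideanSpace ℝ (Fin d) → Hyp d) :=
  (graphHomeo d).continuous

/-- The Euler derivative `y · ∇ f`. -/
def eul {F : Type*} [NormedAddCommGroup F] [NormedSpace ℝ F] (f : EuclideanSpace ℝ (Fin d) → F)
    (y : EuclideanSpace ℝ (Fin d)) : F := fderiv ℝ f y y

/-- The flat gradient. -/
def grd (f : EuclideanSpace ℝ (Fin d) → ℂ) (y : EuclideanSpace ℝ (Fin d)) :
    EuclideanSpace ℂ (Fin d) := WithLp.toLp 2 fun i => fderiv ℝ f y (EuclideanSpace.single i 1)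

theorem fderiv_eq_sum {F : Type*} [NormedAddCommGroup F] [NormedSpace ℝ F]
    (L : EuclideanSpace ℝ (Fin d) →L[ℝ] F) (v : EuclideanSpace ℝ (Fin d)) :
    L v = ∑ i, v i • L (EuclideanSpace.single i 1) := by
  have h := (EuclideanSpace.basisFun (Fin d) ℝ).sum_repr v
  conv_lhs => rw [← h]
  simp [map_sum]

theorem eul_eq_sum {F : Type*} [NormedAddCommGroup F] [NormedSpace ℝ F]
    (f : EuclideanSpace ℝ (Fin d) → F) (y : EuclideanSpace ℝ (Fin d)) :
    eul f y = ∑ i, y i • fderiv ℝ f y (EuclideanSpace.single i 1) := fderiv_eq_sum _ _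

theorem hasDerivAt_height_eul (y : EuclideanSpace ℝ (Fin d)) :
    fderiv ℝ height y = (height y)⁻¹ • innerSL ℝ y := by
  have h1 : HasFDerivAt (fun z : EuclideanSpace ℝ (Fin d) => 1 + ‖z‖ ^ 2)
      (2 • innerSL ℝ y) y := (hasStrictFDerivAt_norm_sq y).hasFDerivAt.const_add 1
  have h2 := (h1.sqrt (one_add_norm_sq_pos y).ne').fderiv
  refine h2.trans ?_
  ext v
  simp [height]
  field_simp

/-- The derivative of a radial function. -/
theorem fderiv_comp_height {F : ℝ → ℝ} {F' : ℝ} (y v : EuclideanSpace ℝ (Fin d))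
    (hF : HasDerivAt F F' (height y)) :
    fderiv ℝ (fun z => F (height z)) y v = F' / height y * inner ℝ y v := by
  have h1 : HasFDerivAt height ((height y)⁻¹ • innerSL ℝ y) y := by
    rw [← hasDerivAt_height_eul]
    exact ((contDiff_height (n := 1)).differentiable (by simp)).differentiableAt.hasFDerivAt
  have h2 := (hF.comp_hasFDerivAt y h1).fderiv
  have h3 := congrArg (fun L => L v) h2
  refine h3.trans ?_
  simp
  ring

theorem eul_comp_height {F : ℝ → ℝ} {F' : ℝ} (y : EuclideanSpace ℝ (Fin d))
    (hF : HasDerivAt F F' (height y)) :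
    eul (fun z => F (height z)) y = F' * (height y ^ 2 - 1) / height y := by
  rw [eul, fderiv_comp_height y y hF, real_inner_self_eq_norm_sq, height_sq]
  ring

section Support

variable {F : Type*} [NormedAddCommGroup F] [NormedSpace ℝ F] {f : EuclideanSpace ℝ (Fin d) → F}

theorem fderiv_eq_zero_off {y : EuclideanSpace ℝ (Fin d)} (hy : y ∉ tsupport f) :
    fderiv ℝ f y = 0 := by
  by_contra h
  exact hy (support_fderiv_subset ℝ h)

theorem eul_eq_zero_off {y : EuclideanSpace ℝ (Fin d)} (hy : y ∉ tsupport f) : eul f y = 0 := by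
  rw [eul, fderiv_eq_zero_off hy]; rfl

theorem grd_eq_zero_off {f : EuclideanSpace ℝ (Fin d) → ℂ} {y : EuclideanSpace ℝ (Fin d)}
    (hy : y ∉ tsupport f) : grd f y = 0 := by
  rw [grd, fderiv_eq_zero_off hy]; rfl

theorem continuous_eul (hf : ContDiff ℝ 1 f) : Continuous (eul f) :=
  (hf.continuous_fderiv (by simp)).clm_apply continuous_id

theorem continuous_grd {f : EuclideanSpace ℝ (Fin d) → ℂ} (hf : ContDiff ℝ 1 f) :
    Continuous (grd f) := by
  refine (PiLp.continuous_toLp 2 _).comp (continuous_pi fun i => ?_)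
  exact (hf.continuous_fderiv (by simp)).clm_apply continuous_const

end Support

/-- A continuous function that vanishes off the support of a compactly supported function is
integrable. -/
theorem integrable_of_off {F : Type*} [NormedAddCommGroup F] {f : EuclideanSpace ℝ (Fin d) → F}
    {G : Type*} [NormedAddCommGroup G] {g : EuclideanSpace ℝ (Fin d) → G}
    (hf : HasCompactSupport f) (hg : Continuous g) (h : ∀ y ∉ tsupport f, g y = 0) :
    Integrable g :=
  hg.integrable_of_hasCompactSupport (HasCompactSupport.intro hf.isCompact h)

theorem eul_mul {k g : EuclideanSpace ℝ (Fin d) → ℝ} {y : EuclideanSpace ℝ (Fin d)}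
    (hk : DifferentiableAt ℝ k y) (hg : DifferentiableAt ℝ g y) :
    eul (fun z => k z * g z) y = k y * eul g y + g y * eul k y := by
  rw [eul, fderiv_fun_mul hk hg]; rfl

theorem eul_norm_sq {f : EuclideanSpace ℝ (Fin d) → ℂ} {y : EuclideanSpace ℝ (Fin d)}
    (hf : DifferentiableAt ℝ f y) :
    eul (fun z => ‖f z‖ ^ 2) y = 2 * (conj (f y) * eul f y).re := by
  rw [eul, hf.hasFDerivAt.norm_sq.fderiv]
  simp [eul, Complex.inner]
  ring

theorem integral_eul_add {g : EuclideanSpace ℝ (Fin d) → ℝ} (hg : ContDiff ℝ 1 g)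
    (hs : HasCompactSupport g) : ∫ y, (eul g y + d * g y) = 0 := by
  have hcd : ∀ i : Fin d, Continuous fun y => fderiv ℝ g y (EuclideanSpace.single i 1) :=
    fun i => (hg.continuous_fderiv (by simp)).clm_apply continuous_const
  have hco : ∀ i : Fin d, ∀ y : EuclideanSpace ℝ (Fin d), HasFDerivAt
      (fun y : EuclideanSpace ℝ (Fin d) => y i) (EuclideanSpace.proj (𝕜 := ℝ) i) y :=
    fun i y => (EuclideanSpace.proj (𝕜 := ℝ) i : EuclideanSpace ℝ (Fin d) →L[ℝ] ℝ).hasFDerivAt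
  have hi1 : ∀ i : Fin d, Integrable fun y => y i * fderiv ℝ g y (EuclideanSpace.single i 1) :=
    fun i => integrable_of_off hs (by have := hcd i; fun_prop) fun y hy => by
      simp [fderiv_eq_zero_off hy]
  have hi2 : Integrable g := hg.continuous.integrable_of_hasCompactSupport hs
  have key : ∀ i : Fin d, ∫ y, y i * fderiv ℝ g y (EuclideanSpace.single i 1) = - ∫ y, g y := by
    intro i
    have h := integral_mul_fderiv_eq_neg_fderiv_mul_of_integrable
      (μ := (volume : Measure (EuclideanSpace ℝ (Fin d))))
      (f := fun y : EuclideanSpace ℝ (Fin d) => y i) (g := g) (v := EuclideanSpace.single i 1)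
      (by
        simp only [(hco i _).fderiv]
        simpa using hi2)
      (hi1 i) (integrable_of_off hs (by have := hg.continuous; fun_prop) fun y hy => by
        simp [image_eq_zero_of_notMem_tsupport hy])
      (fun y _ => (hco i y).differentiableAt)
      (fun y _ => (hg.differentiable (by simp)).differentiableAt)
    rw [h]
    simp [(hco i _).fderiv]
  have h1 : (fun y => eul g y + d * g y)
      = fun y => (∑ i, y i * fderiv ℝ g y (EuclideanSpace.single i 1)) + d * g y := by
    ext y; rw [eul_eq_sum]; rfl
  rw [h1, integral_add (integrable_finsetSum _ fun i _ => hi1 i) (hi2.const_mul _),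
    integral_finsetSum _ fun i _ => hi1 i, integral_const_mul]
  simp [key]

/-- Integration by parts along the Euler field. -/
theorem integral_mul_eul_norm_sq {k : EuclideanSpace ℝ (Fin d) → ℝ} (hk : ContDiff ℝ 1 k)
    {f : EuclideanSpace ℝ (Fin d) → ℂ} (hf : ContDiff ℝ 1 f) (hs : HasCompactSupport f) :
    ∫ y, k y * (2 * (conj (f y) * eul f y).re) = - ∫ y, (eul k y + d * k y) * ‖f y‖ ^ 2 := by
  have hf2 : ContDiff ℝ 1 fun y => ‖f y‖ ^ 2 := hf.norm_sq ℝ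
  have h := integral_eul_add (hk.mul hf2) (HasCompactSupport.intro hs.isCompact fun y hy => by
    simp [image_eq_zero_of_notMem_tsupport hy])
  have hcf := hf.continuous
  have hck := hk.continuous
  have hef := continuous_eul hf
  have hek := continuous_eul hk
  have i1 : Integrable fun y => k y * (2 * (conj (f y) * eul f y).re) :=
    integrable_of_off hs (by fun_prop) fun y hy => by simp [image_eq_zero_of_notMem_tsupport hy]
  have i2 : Integrable fun y => (eul k y + d * k y) * ‖f y‖ ^ 2 :=
    integrable_of_off hs (by fun_prop) fun y hy => by simp [image_eq_zero_of_notMem_tsupport hy]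
  rw [eq_neg_iff_add_eq_zero, ← integral_add i1 i2, ← h]
  refine integral_congr_ae (.of_forall fun y => ?_)
  have e := eul_mul (hk.differentiable (by simp)).differentiableAt
    (hf2.differentiable (by simp)).differentiableAt (y := y)
  rw [eul_norm_sq (hf.differentiable (by simp)).differentiableAt] at e
  simp only [e]
  ring

/-- Cauchy-Schwarz: `|E f| ≤ |y| |∇ f|`. -/
theorem norm_eul_sq_le (f : EuclideanSpace ℝ (Fin d) → ℂ) (y : EuclideanSpace ℝ (Fin d)) :
    ‖eul f y‖ ^ 2 ≤ (height y ^ 2 - 1) * ‖grd f y‖ ^ 2 := by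
  have h1 : ‖eul f y‖ ≤ ‖y‖ * ‖grd f y‖ := by
    rw [eul_eq_sum]
    refine (norm_sum_le _ _).trans ?_
    rw [EuclideanSpace.norm_eq y, EuclideanSpace.norm_eq (grd f y)]
    simp only [norm_smul]
    exact Real.sum_mul_le_sqrt_mul_sqrt _ _ _
  have h2 := pow_le_pow_left₀ (norm_nonneg _) h1 2
  rw [height_sq]
  linarith [mul_pow ‖y‖ ‖grd f y‖ 2]

theorem integral_vol {G : Type*} [NormedAddCommGroup G] [NormedSpace ℝ G] (g : Hyp d → G) :
    ∫ x, g x ∂vol d = ∫ y, dens y • g (graph y) := by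
  rw [vol, measurableEmbedding_graph.integral_map]
  have hm : Measurable fun y : EuclideanSpace ℝ (Fin d) => √(metric y).det := by
    simp only [sqrt_det_metric]; fun_prop
  rw [integral_withDensity_eq_integral_toReal_smul (by fun_prop)
    (.of_forall fun _ => ENNReal.ofReal_lt_top)]
  refine integral_congr_ae (.of_forall fun y => ?_)
  simp only [sqrt_det_metric, dens, height]
  rw [ENNReal.toReal_ofReal (inv_nonneg.2 (Real.sqrt_nonneg _))]

end Chart

end HypWave
end

/-! ### Test functions in the graph chart -/

noncomputable section

namespace HypWave

open Filter Topology

section Chart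

variable {d : ℕ}

/-- A test function, read in the graph chart. -/
def chart (φ : TestFn d) : EuclideanSpace ℝ (Fin d) → ℂ := (φ : Hyp d → ℂ) ∘ graph

theorem contDiff_chart (φ : TestFn d) : ContDiff ℝ ∞ (chart φ) := φ.2.1

theorem contDiff_one_chart (φ : TestFn d) : ContDiff ℝ 1 (chart φ) :=
  (contDiff_chart φ).of_le (by norm_cast)

theorem hasCompactSupport_chart (φ : TestFn d) : HasCompactSupport (chart φ) :=
  φ.2.2.comp_homeomorph (graphHomeo d)

theorem differentiableAt_chart (φ : TestFn d) (y : EuclideanSpace ℝ (Fin d)) :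
    DifferentiableAt ℝ (chart φ) y := ((contDiff_one_chart φ).differentiable (by simp)).differentiableAt

/-- The test function with a given expression in the chart. -/
def ofChart (f : EuclideanSpace ℝ (Fin d) → ℂ) (hf : ContDiff ℝ ∞ f)
    (hs : HasCompactSupport f) : TestFn d :=
  ⟨fun x => f x.1.1, hf, hs.comp_homeomorph (graphHomeo d).symm⟩

theorem ext_chart {φ ψ : TestFn d} (h : ∀ y, (chart φ) y = (chart ψ) y) : φ = ψ := by
  apply Subtype.ext
  ext x
  have := h x.1.1
  simp only [chart, Function.comp_apply, graph_fst] at this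
  exact this

theorem contDiff_eul {f : EuclideanSpace ℝ (Fin d) → ℂ} (hf : ContDiff ℝ ∞ f) :
    ContDiff ℝ ∞ (eul f) :=
  (hf.fderiv_right (m := ∞) (by simp)).clm_apply contDiff_id

/-- The Euler derivative of a test function. -/
def eulT : TestFn d →ₗ[ℂ] TestFn d where
  toFun φ := ofChart (eul (chart φ)) (contDiff_eul (contDiff_chart φ))
    (HasCompactSupport.intro (hasCompactSupport_chart φ).isCompact fun _ hy => eul_eq_zero_off hy)
  map_add' φ ψ := ext_chart fun y => by
    change fderiv ℝ ((chart φ) + (chart ψ)) y y = fderiv ℝ (chart φ) y y + fderiv ℝ (chart ψ) y y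
    rw [fderiv_add ((differentiableAt_chart φ) y) ((differentiableAt_chart ψ) y)]; rfl
  map_smul' c φ := ext_chart fun y => by
    change fderiv ℝ (c • (chart φ)) y y = c * fderiv ℝ (chart φ) y y
    rw [fderiv_const_smul ((differentiableAt_chart φ) y)]; rfl

theorem eulT_chart (φ : TestFn d) (y : EuclideanSpace ℝ (Fin d)) :
    (chart (eulT φ)) y = eul (chart φ) y := rfl

/-- Multiplication of a test function by a smooth real function. -/
def mulT (m : EuclideanSpace ℝ (Fin d) → ℝ) (hm : ContDiff ℝ ∞ m) : TestFn d →ₗ[ℂ] TestFn d where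
  toFun φ := ofChart (fun y => (m y : ℂ) * (chart φ) y)
    ((Complex.ofRealCLM.contDiff.comp hm).mul (contDiff_chart φ))
    (HasCompactSupport.intro (hasCompactSupport_chart φ).isCompact fun y hy => by
      rw [image_eq_zero_of_notMem_tsupport hy, mul_zero])
  map_add' φ ψ := ext_chart fun y => mul_add _ _ _
  map_smul' c φ := ext_chart fun y => mul_left_comm _ _ _

theorem mulT_chart (m : EuclideanSpace ℝ (Fin d) → ℝ) (hm : ContDiff ℝ ∞ m) (φ : TestFn d)
    (y : EuclideanSpace ℝ (Fin d)) : (chart (mulT m hm φ)) y = (m y : ℂ) * (chart φ) y := rfl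

/-- The dilation `f(y) ↦ f(eˢ y)` of a test function. -/
def dilT (s : ℝ) : TestFn d →ₗ[ℂ] TestFn d where
  toFun φ := ofChart (fun y => (chart φ) (Real.exp s • y))
    ((contDiff_chart φ).comp (contDiff_const_smul _))
    ((hasCompactSupport_chart φ).comp_homeomorph (Homeomorph.smulOfNeZero _ (Real.exp_pos s).ne'))
  map_add' _ _ := rfl
  map_smul' _ _ := rfl

theorem dilT_chart (s : ℝ) (φ : TestFn d) (y : EuclideanSpace ℝ (Fin d)) :
    (chart (dilT s φ)) y = (chart φ) (Real.exp s • y) := rfl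

section Derivatives

theorem fderiv_mulT (m : EuclideanSpace ℝ (Fin d) → ℝ) (hm : ContDiff ℝ ∞ m) (φ : TestFn d)
    (y v : EuclideanSpace ℝ (Fin d)) :
    fderiv ℝ (chart (mulT m hm φ)) y v
      = (m y : ℂ) * fderiv ℝ (chart φ) y v + (fderiv ℝ m y v : ℂ) * (chart φ) y := by
  have h1 : HasFDerivAt (fun y => (m y : ℂ)) (Complex.ofRealCLM ∘L fderiv ℝ m y) y :=
    Complex.ofRealCLM.hasFDerivAt.comp y (hm.differentiable (by simp)).differentiableAt.hasFDerivAt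
  have h2 := (h1.mul ((differentiableAt_chart φ) y).hasFDerivAt).fderiv
  have h3 := congrArg (fun L => L v) h2
  refine Eq.trans h3 ?_
  simp
  ring

theorem eul_mulT (m : EuclideanSpace ℝ (Fin d) → ℝ) (hm : ContDiff ℝ ∞ m) (φ : TestFn d)
    (y : EuclideanSpace ℝ (Fin d)) :
    eul (chart (mulT m hm φ)) y = (m y : ℂ) * eul (chart φ) y + ((eul m y : ℝ) : ℂ) * (chart φ) y :=
  fderiv_mulT m hm φ y y

theorem fderiv_dilT (s : ℝ) (φ : TestFn d) (y v : EuclideanSpace ℝ (Fin d)) :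
    fderiv ℝ (chart (dilT s φ)) y v = fderiv ℝ (chart φ) (Real.exp s • y) (Real.exp s • v) := by
  have h1 : HasFDerivAt (fun y : EuclideanSpace ℝ (Fin d) => Real.exp s • y)
      (Real.exp s • ContinuousLinearMap.id ℝ _) y := (hasFDerivAt_id (𝕜 := ℝ) y).const_smul (Real.exp s)
  have h2 := (((differentiableAt_chart φ) (Real.exp s • y)).hasFDerivAt.comp y h1).fderiv
  exact congrArg (fun L => L v) h2

theorem eul_dilT (s : ℝ) (φ : TestFn d) (y : EuclideanSpace ℝ (Fin d)) :
    eul (chart (dilT s φ)) y = eul (chart φ) (Real.exp s • y) := fderiv_dilT s φ y y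

theorem grd_dilT (s : ℝ) (φ : TestFn d) (y : EuclideanSpace ℝ (Fin d)) :
    grd (chart (dilT s φ)) y = (Real.exp s : ℂ) • grd (chart φ) (Real.exp s • y) := by
  ext i
  change fderiv ℝ (chart (dilT s φ)) y _ = (Real.exp s : ℂ) * fderiv ℝ (chart φ) (Real.exp s • y) _
  rw [fderiv_dilT, map_smul, Complex.real_smul]

theorem inner_grd (f g : EuclideanSpace ℝ (Fin d) → ℂ) (y : EuclideanSpace ℝ (Fin d)) :
    inner ℂ (grd f y) (grd g y) = ∑ i, conj (fderiv ℝ f y (EuclideanSpace.single i 1)) *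
      fderiv ℝ g y (EuclideanSpace.single i 1) := by
  rw [PiLp.inner_apply]
  exact Finset.sum_congr rfl fun i _ => by rw [RCLike.inner_apply, mul_comm]; rfl

/-- The gradient of a product with a radial function. -/
theorem inner_grd_mulT {F : ℝ → ℝ} (hm : ContDiff ℝ ∞ fun z : EuclideanSpace ℝ (Fin d) =>
    F (height z)) {F' : ℝ} {y : EuclideanSpace ℝ (Fin d)} (hF : HasDerivAt F F' (height y))
    (f : EuclideanSpace ℝ (Fin d) → ℂ) (φ : TestFn d) :
    inner ℂ (grd f y) (grd (chart (mulT _ hm φ)) y) =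
      (F (height y) : ℂ) * inner ℂ (grd f y) (grd (chart φ) y)
        + ((F' / height y : ℝ) : ℂ) * (conj (eul f y) * (chart φ) y) := by
  simp only [inner_grd, fderiv_mulT, fderiv_comp_height y _ hF, mul_add, Finset.sum_add_distrib,
    Finset.mul_sum]
  congr 1
  · exact Finset.sum_congr rfl fun i _ => by ring
  · rw [eul_eq_sum, map_sum, Finset.sum_mul, Finset.mul_sum]
    refine Finset.sum_congr rfl fun i _ => ?_
    have : inner ℝ y (EuclideanSpace.single i (1 : ℝ)) = y i := by
      simp [EuclideanSpace.inner_single_right]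
    rw [this]
    simp only [Complex.real_smul, map_mul, Complex.conj_ofReal]
    push_cast
    ring

end Derivatives

/-! The inner products in the chart. -/

/-- The density of the Dirichlet form in the chart. -/
def dirD (f g : EuclideanSpace ℝ (Fin d) → ℂ) (y : EuclideanSpace ℝ (Fin d)) : ℂ :=
  inner ℂ (grd f y) (grd g y) + conj (eul f y) * eul g y

theorem formDensity_graph (V : Hyp d → ℝ) (u v : Hyp d → ℂ) (y : EuclideanSpace ℝ (Fin d)) :
    formDensity V u v (graph y) = dirD (u ∘ graph) (v ∘ graph) y
      + ((V (graph y) + 1 : ℝ) : ℂ) * (conj (u (graph y)) * v (graph y)) := by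
  rw [formDensity]
  congr 1
  simp only [gradInner, metric_inv, dirD, inner_grd, eul_eq_sum, map_sum, Finset.sum_mul_sum,
    Matrix.add_apply, Matrix.vecMulVec_apply, Complex.ofReal_add, add_mul, Finset.sum_add_distrib]
  congr 1
  · simp only [Matrix.one_apply, apply_ite (Complex.ofReal), Complex.ofReal_one,
      Complex.ofReal_zero, ite_mul, one_mul, zero_mul, Finset.sum_ite_eq, Finset.mem_univ, if_true]
    rfl
  · refine Finset.sum_congr rfl fun i _ => Finset.sum_congr rfl fun j _ => ?_
    simp only [Complex.real_smul, map_mul, Complex.conj_ofReal, Complex.ofReal_mul]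
    change ((y i : ℂ) * (y j : ℂ)) * (conj (fderiv ℝ (u ∘ graph) y _) * fderiv ℝ (v ∘ graph) y _) = _
    ring

variable {V : Hyp d → ℝ} {hV : Continuous V} {hV0 : ∀ x, 0 ≤ V x}

/-- A test function as an element of the form core. -/
def toCore (V : Hyp d → ℝ) (hV : Continuous V) (hV0 : ∀ x, 0 ≤ V x) :
    TestFn d ≃ₗ[ℂ] FormCore V hV hV0 := LinearEquiv.refl ℂ (TestFn d)

theorem inner_core (φ ψ : TestFn d) :
    inner ℂ ((toCore V hV hV0 φ)) ((toCore V hV hV0 ψ)) = ∫ y, dens y •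
      (dirD (chart φ) (chart ψ) y
        + ((V (graph y) + 1 : ℝ) : ℂ) * (conj ((chart φ) y) * (chart ψ) y)) := by
  change form V φ ψ = _
  rw [form, integral_vol]
  simp only [formDensity_graph]
  rfl

theorem inner_inclCore (φ ψ : TestFn d) :
    inner ℂ (inclCore V hV hV0 ((toCore V hV hV0 φ))) (inclCore V hV hV0 ((toCore V hV hV0 ψ)))
      = ∫ y, dens y • (conj ((chart φ) y) * (chart ψ) y) := by
  rw [L2.inner_def]
  refine Eq.trans (integral_congr_ae ?_)
    (integral_vol (g := fun x => conj ((φ : Hyp d → ℂ) x) * (ψ : Hyp d → ℂ) x))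
  filter_upwards [(FormCore.memLp V hV hV0 ((toCore V hV hV0 φ))).coeFn_toLp,
    (FormCore.memLp V hV hV0 ((toCore V hV hV0 ψ))).coeFn_toLp] with x h1 h2
  have h1' : inclCore V hV hV0 ((toCore V hV hV0 φ)) x = (φ : Hyp d → ℂ) x := h1
  have h2' : inclCore V hV hV0 ((toCore V hV hV0 ψ)) x = (ψ : Hyp d → ℂ) x := h2
  rw [h1', h2', RCLike.inner_apply, mul_comm]

theorem continuous_dirD (φ ψ : TestFn d) : Continuous (dirD (chart φ) (chart ψ)) := by
  have h1 := continuous_grd (contDiff_one_chart φ)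
  have h2 := continuous_grd (contDiff_one_chart ψ)
  have h3 := continuous_eul (contDiff_one_chart φ)
  have h4 := continuous_eul (contDiff_one_chart ψ)
  unfold dirD
  fun_prop

theorem continuous_chart (φ : TestFn d) : Continuous (chart φ) := (contDiff_chart φ).continuous

theorem re_inner_core (φ ψ : TestFn d) :
    (inner ℂ ((toCore V hV hV0 φ)) ((toCore V hV hV0 ψ))).re = ∫ y, dens y *
      ((dirD (chart φ) (chart ψ) y).re
        + (V (graph y) + 1) * (conj ((chart φ) y) * (chart ψ) y).re) := by
  have hint : Integrable fun y => dens y • (dirD (chart φ) (chart ψ) y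
        + ((V (graph y) + 1 : ℝ) : ℂ) * (conj ((chart φ) y) * (chart ψ) y)) := by
    refine integrable_of_off (hasCompactSupport_chart φ) ?_ fun y hy => ?_
    · have h1 := continuous_dirD φ ψ
      have h2 := (continuous_chart φ)
      have h3 := (continuous_chart ψ)
      fun_prop
    · simp [dirD, image_eq_zero_of_notMem_tsupport hy, eul_eq_zero_off hy, grd_eq_zero_off hy]
  rw [inner_core]
  have h := integral_re hint
  refine h.symm.trans (integral_congr_ae (.of_forall fun y => ?_))
  simp only [RCLike.re_to_complex, Complex.smul_re, Complex.add_re, Complex.re_ofReal_mul,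
    smul_eq_mul]

theorem re_inner_inclCore (φ ψ : TestFn d) :
    (inner ℂ (inclCore V hV hV0 ((toCore V hV hV0 φ)))
      (inclCore V hV hV0 ((toCore V hV hV0 ψ)))).re
      = ∫ y, dens y * (conj ((chart φ) y) * (chart ψ) y).re := by
  have hint : Integrable fun y => dens y • (conj ((chart φ) y) * (chart ψ) y) := by
    refine integrable_of_off (hasCompactSupport_chart φ) ?_ fun y hy => ?_
    · have h2 := (continuous_chart φ)
      have h3 := (continuous_chart ψ)
      fun_prop
    · simp [image_eq_zero_of_notMem_tsupport hy]
  rw [inner_inclCore]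
  have h := integral_re hint
  refine h.symm.trans (integral_congr_ae (.of_forall fun y => ?_))
  simp only [RCLike.re_to_complex, Complex.smul_re, smul_eq_mul]

theorem re_dirD_self (f : EuclideanSpace ℝ (Fin d) → ℂ) (y : EuclideanSpace ℝ (Fin d)) :
    (dirD f f y).re = ‖grd f y‖ ^ 2 + ‖eul f y‖ ^ 2 := by
  have h1 := inner_self_eq_norm_sq (𝕜 := ℂ) (grd f y)
  have h2 := congrArg Complex.re (Complex.conj_mul' (eul f y))
  rw [RCLike.re_to_complex] at h1
  rw [dirD, Complex.add_re, h1, h2]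
  norm_cast

theorem re_conj_mul_self (z : ℂ) : (conj z * z).re = ‖z‖ ^ 2 := by
  rw [Complex.conj_mul']; norm_cast

theorem norm_sq_core (φ : TestFn d) :
    ‖(toCore V hV hV0 φ)‖ ^ 2 = ∫ y, dens y *
      ((‖grd (chart φ) y‖ ^ 2 + ‖eul (chart φ) y‖ ^ 2) + (V (graph y) + 1) * ‖(chart φ) y‖ ^ 2) := by
  have h := re_inner_core (hV := hV) (hV0 := hV0) φ φ
  have h1 := inner_self_eq_norm_sq (𝕜 := ℂ) ((toCore V hV hV0 φ))
  rw [RCLike.re_to_complex] at h1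
  rw [← h1, h]
  simp only [re_dirD_self, re_conj_mul_self]

theorem norm_sq_inclCore (φ : TestFn d) :
    ‖inclCore V hV hV0 ((toCore V hV hV0 φ))‖ ^ 2 = ∫ y, dens y * ‖(chart φ) y‖ ^ 2 := by
  have h := re_inner_inclCore (hV := hV) (hV0 := hV0) φ φ
  have h1 := inner_self_eq_norm_sq (𝕜 := ℂ) (inclCore V hV hV0 ((toCore V hV hV0 φ)))
  rw [RCLike.re_to_complex] at h1
  rw [← h1, h]
  simp only [re_conj_mul_self]

end Chart

end HypWave
end

/-! ### The multiplier and its positivity on test functions -/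

noncomputable section

namespace HypWave

open Filter Topology

section Chart

variable {d : ℕ}

theorem integral_radial_mul_eul {F F' : ℝ → ℝ} (hF : ∀ c, 0 < c → HasDerivAt F (F' c) c)
    (hF2 : ContDiff ℝ 1 fun z : EuclideanSpace ℝ (Fin d) => F (height z)) (φ : TestFn d) :
    ∫ y, F (height y) * (2 * (conj (chart φ y) * eul (chart φ) y).re)
      = - ∫ y, (F' (height y) * (height y ^ 2 - 1) / height y + d * F (height y))
        * ‖chart φ y‖ ^ 2 := by
  rw [integral_mul_eul_norm_sq hF2 (contDiff_one_chart φ) (hasCompactSupport_chart φ)]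
  congr 1
  refine integral_congr_ae (.of_forall fun y => ?_)
  simp only [eul_comp_height y (hF _ (height_pos y))]

theorem abs_re_conj_mul_le (z w : ℂ) : |(conj z * w).re| ≤ ‖z‖ * ‖w‖ := by
  refine (Complex.abs_re_le_norm _).trans ?_
  rw [norm_mul, Complex.norm_conj]

theorem continuous_eul_chart (φ : TestFn d) : Continuous (eul (chart φ)) :=
  continuous_eul (contDiff_one_chart φ)

theorem continuous_grd_chart (φ : TestFn d) : Continuous (grd (chart φ)) :=
  continuous_grd (contDiff_one_chart φ)

theorem chart_zero_off {φ : TestFn d} {y : EuclideanSpace ℝ (Fin d)} (hy : y ∉ tsupport (chart φ)) :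
    chart φ y = 0 := image_eq_zero_of_notMem_tsupport hy

/-- The spectral gap. -/
theorem integral_norm_sq_le_integral_eul (hd : 3 ≤ d) (φ : TestFn d) :
    ∫ y, dens y * ‖chart φ y‖ ^ 2 ≤ ∫ y, dens y * ‖eul (chart φ) y‖ ^ 2 := by
  have hd' : (3 : ℝ) ≤ d := by exact_mod_cast hd
  have c0 := continuous_chart φ
  have c1 := continuous_eul_chart φ
  have hs := hasCompactSupport_chart φ
  have h := integral_radial_mul_eul (d := d) (F := fun c => c⁻¹) (F' := fun c => -(c ^ 2)⁻¹)
    (fun c hc => hasDerivAt_inv hc.ne')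
    (contDiff_height.inv fun y => (height_pos y).ne') φ
  have i1 : Integrable fun y => dens y * ‖chart φ y‖ ^ 2 :=
    integrable_of_off hs (by fun_prop) fun y hy => by simp [chart_zero_off hy]
  have i2 : Integrable fun y => dens y * ‖eul (chart φ) y‖ ^ 2 :=
    integrable_of_off hs (by fun_prop) fun y hy => by simp [eul_eq_zero_off hy]
  have e : (∫ y, dens y * (2 * (conj (chart φ y) * eul (chart φ) y).re))
      = - ∫ y, dens y * ((d - 1 + dens y ^ 2) * ‖chart φ y‖ ^ 2) := by
    refine h.trans (congrArg _ (integral_congr_ae (.of_forall fun y => ?_)))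
    have := (height_pos y).ne'
    simp only [dens]
    field_simp
    ring
  have i3 : Integrable fun y => dens y * ((d - 1 + dens y ^ 2) * ‖chart φ y‖ ^ 2) :=
    integrable_of_off hs (by fun_prop) fun y hy => by simp [chart_zero_off hy]
  have h1 : 2 * ∫ y, dens y * ‖chart φ y‖ ^ 2
      ≤ ∫ y, dens y * ((d - 1 + dens y ^ 2) * ‖chart φ y‖ ^ 2) := by
    rw [← integral_const_mul]
    refine integral_mono (i1.const_mul 2) i3 fun y => ?_
    have := dens_pos y
    have h2 : 2 * ‖chart φ y‖ ^ 2 ≤ (d - 1 + dens y ^ 2) * ‖chart φ y‖ ^ 2 := by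
      gcongr; nlinarith
    calc 2 * (dens y * ‖chart φ y‖ ^ 2) = dens y * (2 * ‖chart φ y‖ ^ 2) := by ring
      _ ≤ _ := by gcongr
  have h2 : - ∫ y, dens y * (2 * (conj (chart φ y) * eul (chart φ) y).re)
      ≤ ∫ y, (dens y * ‖chart φ y‖ ^ 2 + dens y * ‖eul (chart φ) y‖ ^ 2) := by
    rw [← integral_neg]
    refine integral_mono ?_ (i1.add i2) fun y => ?_
    · exact (integrable_of_off hs (by fun_prop) fun y hy => by simp [chart_zero_off hy])
    · have := dens_pos y
      have h3 := abs_le.1 (abs_re_conj_mul_le (chart φ y) (eul (chart φ) y))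
      simp only [← mul_add]
      rw [← mul_neg]
      gcongr
      nlinarith [sq_nonneg (‖chart φ y‖ - ‖eul (chart φ) y‖)]
  rw [integral_add i1 i2, e, neg_neg] at h2
  linarith

/-! The coefficients of the multiplier, as functions of `c = cosh r`. -/

/-- `tanh (r/2) coth r`, the coefficient of the Euler field. -/
def mulA (c : ℝ) : ℝ := c / (1 + c)

/-- The zeroth order coefficient: half the divergence of `tanh (r/2) ∂ᵣ`, minus a small weight. -/
def mulB (d : ℕ) (ε c : ℝ) : ℝ := ((d - 1) - (d - 2) * (1 + c)⁻¹) / 2 - ε * (1 + c)⁻¹ ^ 2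

/-- The derivative of `mulB`. -/
def mulB' (d : ℕ) (ε c : ℝ) : ℝ := (d - 2) / (2 * (1 + c) ^ 2) + 2 * ε / (1 + c) ^ 3

theorem hasDerivAt_inv_one_add {c : ℝ} (hc : 0 < c) :
    HasDerivAt (fun c : ℝ => (1 + c)⁻¹) (-1 / (1 + c) ^ 2) c := by
  have h := ((hasDerivAt_id c).const_add 1).inv (by simp only [id]; positivity)
  simpa using! h

theorem hasDerivAt_mulA {c : ℝ} (hc : 0 < c) : HasDerivAt mulA (1 / (1 + c) ^ 2) c := by
  have h := (hasDerivAt_id c).mul (hasDerivAt_inv_one_add hc)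
  refine (h.congr_deriv ?_)
  simp only [id]
  field_simp
  ring

theorem hasDerivAt_mulB (ε : ℝ) {c : ℝ} (hc : 0 < c) :
    HasDerivAt (mulB d ε) (mulB' d ε c) c := by
  have h1 := hasDerivAt_inv_one_add hc
  have h := (((h1.const_mul ((d : ℝ) - 2)).const_sub ((d : ℝ) - 1)).div_const 2).sub
    ((h1.pow 2).const_mul ε)
  refine h.congr_deriv ?_
  simp only [mulB']
  norm_num
  field_simp
  ring

theorem one_add_height_pos (y : EuclideanSpace ℝ (Fin d)) : 0 < 1 + height y := by
  have := height_pos y; positivity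

theorem contDiff_inv_one_add_height {n : WithTop ℕ∞} :
    ContDiff ℝ n fun z : EuclideanSpace ℝ (Fin d) => (1 + height z)⁻¹ :=
  (contDiff_const.add contDiff_height).inv fun y => (one_add_height_pos y).ne'

theorem contDiff_mulA : ContDiff ℝ ∞ fun z : EuclideanSpace ℝ (Fin d) => mulA (height z) :=
  contDiff_height.mul contDiff_inv_one_add_height

theorem contDiff_mulB (ε : ℝ) :
    ContDiff ℝ ∞ fun z : EuclideanSpace ℝ (Fin d) => mulB d ε (height z) := by
  exact ((contDiff_const.sub (contDiff_const.mul contDiff_inv_one_add_height)).div_const 2).sub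
    (contDiff_const.mul (contDiff_inv_one_add_height.pow 2))

@[fun_prop]
theorem continuous_mulA_height :
    Continuous fun z : EuclideanSpace ℝ (Fin d) => mulA (height z) := contDiff_mulA.continuous

@[fun_prop]
theorem continuous_mulB_height (ε : ℝ) :
    Continuous fun z : EuclideanSpace ℝ (Fin d) => mulB d ε (height z) :=
  (contDiff_mulB ε).continuous

theorem continuous_inv_one_add_height :
    Continuous fun z : EuclideanSpace ℝ (Fin d) => (1 + height z)⁻¹ :=
  (contDiff_inv_one_add_height (n := 0)).continuous

/-- The multiplier `tanh (r/2) ∂ᵣ + mulB` on test functions. -/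
def multT (d : ℕ) (ε : ℝ) : TestFn d →ₗ[ℂ] TestFn d :=
  mulT _ contDiff_mulA ∘ₗ eulT + mulT _ (contDiff_mulB ε)

theorem multT_chart (ε : ℝ) (φ : TestFn d) (y : EuclideanSpace ℝ (Fin d)) :
    chart (multT d ε φ) y
      = (mulA (height y) : ℂ) * eul (chart φ) y + (mulB d ε (height y) : ℂ) * chart φ y := rfl

theorem re_conj_mul_multT (ε : ℝ) (φ : TestFn d) (y : EuclideanSpace ℝ (Fin d)) :
    (conj (chart φ y) * chart (multT d ε φ) y).re
      = mulA (height y) * (conj (chart φ y) * eul (chart φ) y).re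
        + mulB d ε (height y) * ‖chart φ y‖ ^ 2 := by
  rw [multT_chart, mul_add, Complex.add_re, mul_left_comm, mul_left_comm (conj (chart φ y)),
    Complex.re_ofReal_mul, Complex.re_ofReal_mul, re_conj_mul_self]

/-- The multiplier is antisymmetric up to the weight. -/
theorem integral_conj_mul_multT (ε : ℝ) (φ : TestFn d) :
    ∫ y, dens y * (conj (chart φ y) * chart (multT d ε φ) y).re
      = -ε * ∫ y, dens y * ((1 + height y)⁻¹ ^ 2 * ‖chart φ y‖ ^ 2) := by
  have c0 := continuous_chart φ
  have c1 := continuous_eul_chart φ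
  have c2 := continuous_inv_one_add_height (d := d)
  have hs := hasCompactSupport_chart φ
  have h := integral_radial_mul_eul (d := d) (F := fun c => (1 + c)⁻¹)
    (F' := fun c => -1 / (1 + c) ^ 2) (fun c hc => hasDerivAt_inv_one_add hc)
    contDiff_inv_one_add_height φ
  have i1 : Integrable fun y => (1 + height y)⁻¹ * (2 * (conj (chart φ y) * eul (chart φ) y).re) :=
    integrable_of_off hs (c2.mul (by fun_prop)) fun y hy => by simp [chart_zero_off hy]
  have i2 : Integrable fun y => dens y * (mulB d ε (height y) * ‖chart φ y‖ ^ 2) :=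
    integrable_of_off hs (by fun_prop) fun y hy => by simp [chart_zero_off hy]
  have e1 : ∀ y : EuclideanSpace ℝ (Fin d),
      dens y * (conj (chart φ y) * chart (multT d ε φ) y).re =
      (1 / 2) * ((1 + height y)⁻¹ * (2 * (conj (chart φ y) * eul (chart φ) y).re))
        + dens y * (mulB d ε (height y) * ‖chart φ y‖ ^ 2) := fun y => by
    have := (height_pos y).ne'
    have := (one_add_height_pos y).ne'
    rw [re_conj_mul_multT, dens, mulA]
    field_simp
  simp only [e1]
  rw [integral_add (i1.const_mul _) i2, integral_const_mul, h, ← integral_const_mul, ← integral_neg,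
    ← integral_const_mul]
  rw [← integral_add ?_ i2]
  · refine integral_congr_ae (.of_forall fun y => ?_)
    have := (height_pos y).ne'
    have := (one_add_height_pos y).ne'
    simp only [dens, mulB]
    field_simp
    ring
  · refine integrable_of_off hs ?_ fun y hy => by simp [chart_zero_off hy]
    fun_prop (disch := exact fun y => by have := height_pos y; positivity)

/-- The density of the commutator form `Re ⟨(-Δ + V) φ, B φ⟩`, where `B` is the multiplier. -/
def commD (V : Hyp d → ℝ) (ε : ℝ) (φ : TestFn d) (y : EuclideanSpace ℝ (Fin d)) : ℝ :=
  dens y * (mulA (height y) * ‖grd (chart φ) y‖ ^ 2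
    + mulA (height y) * (1 + height y)⁻¹ * ‖eul (chart φ) y‖ ^ 2
    - ε * (1 + height y)⁻¹ ^ 2 * (‖grd (chart φ) y‖ ^ 2 + ‖eul (chart φ) y‖ ^ 2)
    + height y * mulB' d ε (height y) * (conj (chart φ y) * eul (chart φ) y).re
    + V (graph y) * (conj (chart φ y) * chart (multT d ε φ) y).re)

/-- The Hardy inequality behind the positivity, pointwise: `G = |∇f|²`, `e = |Ef|²`,
`R = Re (conj f Ef)`, `p = |f|`. -/
theorem hardy_pointwise {c κ G e R p : ℝ} (hc : 1 ≤ c) (hG : 0 ≤ G) (he : 0 ≤ e)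
    (h1 : e ≤ (c ^ 2 - 1) * G) (h2 : R ^ 2 ≤ e * p ^ 2) :
    0 ≤ G + e + 2 * (κ * c / (1 + c) * R) + κ ^ 2 * ((c - 1) / (1 + c)) * p ^ 2 := by
  set X := κ * c / (1 + c) * R
  set b := κ ^ 2 * ((c - 1) / (1 + c)) * p ^ 2 with hb
  have hb0 : 0 ≤ b := by
    have : 0 ≤ (c - 1) / (1 + c) := div_nonneg (by linarith) (by linarith)
    positivity
  have hX : X ^ 2 ≤ (G + e) * b := by
    have h3 : c ^ 2 * e ≤ (c ^ 2 - 1) * (G + e) := by nlinarith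
    have hk : X ^ 2 = (κ / (1 + c)) ^ 2 * (c ^ 2 * R ^ 2) := by
      simp only [X]; field_simp
    have hk2 : (G + e) * b = (κ / (1 + c)) ^ 2 * ((c ^ 2 - 1) * (G + e) * p ^ 2) := by
      have : (1 + c) ≠ 0 := by linarith
      rw [hb]; field_simp; ring
    rw [hk, hk2]
    refine mul_le_mul_of_nonneg_left ?_ (sq_nonneg _)
    calc c ^ 2 * R ^ 2 ≤ c ^ 2 * (e * p ^ 2) := by gcongr
      _ = c ^ 2 * e * p ^ 2 := by ring
      _ ≤ _ := by gcongr
  have h4 : (2 * X) ^ 2 ≤ (G + e + b) ^ 2 := by nlinarith [sq_nonneg (G + e - b)]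
  have := abs_le_of_sq_le_sq' h4 (by positivity)
  linarith [this.1]

/-- The coefficient of `2 Re (conj f Ef)` after completing the square. -/
def hardyM (κ ε c : ℝ) : ℝ := -(κ / 2) * (1 + c)⁻¹ ^ 2 + ε * (1 + κ) * (1 + c)⁻¹ ^ 3

theorem commD_ge {V : Hyp d → ℝ} {ε : ℝ} (hε1 : ε ≤ 1) (φ : TestFn d)
    (y : EuclideanSpace ℝ (Fin d)) {κ : ℝ} (hκ : (d : ℝ) = 2 * κ + 2) :
    (hardyM κ ε (height y) + (1 + height y)⁻¹ * V (graph y) / 2)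
        * (2 * (conj (chart φ y) * eul (chart φ) y).re)
      + dens y * (V (graph y) * mulB d ε (height y)
        - ((1 + height y)⁻¹ - ε * (1 + height y)⁻¹ ^ 2) * κ ^ 2
          * ((height y - 1) * (1 + height y)⁻¹)) * ‖chart φ y‖ ^ 2 ≤ commD V ε φ y := by
  rw [commD, re_conj_mul_multT]
  have h0 := one_le_height y
  have hA := norm_eul_sq_le (chart φ) y
  have hR : (conj (chart φ y) * eul (chart φ) y).re ^ 2
      ≤ ‖eul (chart φ) y‖ ^ 2 * ‖chart φ y‖ ^ 2 := by
    have := sq_le_sq' (abs_le.1 (abs_re_conj_mul_le (chart φ y) (eul (chart φ) y))).1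
      (abs_le.1 (abs_re_conj_mul_le (chart φ y) (eul (chart φ) y))).2
    linarith [mul_pow ‖chart φ y‖ ‖eul (chart φ) y‖ 2]
  have hH := hardy_pointwise (κ := κ) h0 (sq_nonneg _) (sq_nonneg _) hA hR
  set c := height y
  set G := ‖grd (chart φ) y‖ ^ 2
  set e := ‖eul (chart φ) y‖ ^ 2
  set R := (conj (chart φ y) * eul (chart φ) y).re
  set p := ‖chart φ y‖
  set v := V (graph y)
  have hc0 : 0 < c := by linarith
  have hpos : 0 < 1 + c := by linarith
  have hw : 0 ≤ (1 + c)⁻¹ - ε * (1 + c)⁻¹ ^ 2 := by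
    have h3 : (1 + c)⁻¹ ≤ 1 := inv_le_one_of_one_le₀ (by linarith)
    have h4 : 0 < (1 + c)⁻¹ := inv_pos.2 hpos
    have : ε * (1 + c)⁻¹ ≤ 1 := by nlinarith
    nlinarith
  have key : 0 ≤ dens y * (((1 + c)⁻¹ ^ 2 * ((c ^ 2 - 1) * G - e))
      + ((1 + c)⁻¹ - ε * (1 + c)⁻¹ ^ 2)
        * (G + e + 2 * (κ * c / (1 + c) * R) + κ ^ 2 * ((c - 1) / (1 + c)) * p ^ 2)) := by
    have h5 := dens_pos y
    have h6 : 0 ≤ (c ^ 2 - 1) * G - e := by linarith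
    positivity
  have hd : dens y = c⁻¹ := rfl
  rw [hd] at key ⊢
  rw [← sub_nonneg]
  refine le_of_le_of_eq key ?_
  simp only [mulA, mulB, mulB', hardyM, hκ]
  field_simp
  ring

/-- Positivity of the commutator on test functions. -/
theorem integral_commD_nonneg (hd : 3 ≤ d) {V : Hyp d → ℝ} (hV : HypContDiff 1 V) {M ε : ℝ}
    (hV0 : ∀ x, 0 ≤ V x) (hVM : ∀ x, V x ≤ M)
    (hrep : ∀ y : EuclideanSpace ℝ (Fin d), eul (V ∘ graph) y ≤ 0) (hε0 : 0 ≤ ε) (hε1 : ε ≤ 1)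
    (hε : ε * (d / 2 * d + M) ≤ d * (d - 2) / 4) (φ : TestFn d) :
    0 ≤ ∫ y, commD V ε φ y := by
  have hd' : (3 : ℝ) ≤ d := by exact_mod_cast hd
  set κ : ℝ := (d - 2) / 2 with hκdef
  have hκ : (d : ℝ) = 2 * κ + 2 := by rw [hκdef]; ring
  have hVc : Continuous V := hV.continuous
  have c0 := continuous_chart φ
  have c1 := continuous_eul_chart φ
  have c3 := continuous_grd_chart φ
  have c4 := continuous_chart (multT d ε φ)
  have c2 := continuous_inv_one_add_height (d := d)
  have hs := hasCompactSupport_chart φ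
  have hF : ∀ c, 0 < c → HasDerivAt (hardyM κ ε)
      (κ * (1 + c)⁻¹ ^ 3 - 3 * ε * (1 + κ) * (1 + c)⁻¹ ^ 4) c := fun c hc => by
    have h1 := hasDerivAt_inv_one_add hc
    have h := ((h1.pow 2).const_mul (-(κ / 2))).add ((h1.pow 3).const_mul (ε * (1 + κ)))
    refine h.congr_deriv ?_
    norm_num
    field_simp
    ring
  have hk1 : ContDiff ℝ 1 fun z : EuclideanSpace ℝ (Fin d) => hardyM κ ε (height z) :=
    (contDiff_const.mul (contDiff_inv_one_add_height.pow 2)).add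
      (contDiff_const.mul (contDiff_inv_one_add_height.pow 3))
  have hk2 : ContDiff ℝ 1 fun z : EuclideanSpace ℝ (Fin d) => (1 + height z)⁻¹ * V (graph z) :=
    contDiff_inv_one_add_height.mul hV
  have hk : ContDiff ℝ 1 fun z : EuclideanSpace ℝ (Fin d) =>
      hardyM κ ε (height z) + (1 + height z)⁻¹ * V (graph z) / 2 := hk1.add (hk2.div_const 2)
  have hkc := hk.continuous
  have hibp := integral_mul_eul_norm_sq hk (contDiff_one_chart φ) hs
  have hek := continuous_eul hk
  have i1 : Integrable fun y => (hardyM κ ε (height y) + (1 + height y)⁻¹ * V (graph y) / 2)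
        * (2 * (conj (chart φ y) * eul (chart φ) y).re) :=
    integrable_of_off hs (hkc.mul (by fun_prop)) fun y hy => by simp [chart_zero_off hy]
  have i2 : Integrable fun y => dens y * (V (graph y) * mulB d ε (height y)
        - ((1 + height y)⁻¹ - ε * (1 + height y)⁻¹ ^ 2) * κ ^ 2
          * ((height y - 1) * (1 + height y)⁻¹)) * ‖chart φ y‖ ^ 2 := by
    refine integrable_of_off hs ?_ fun y hy => by simp [chart_zero_off hy]
    fun_prop (disch := exact fun y => (one_add_height_pos y).ne')
  have i3 : Integrable (commD V ε φ) := by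
    refine integrable_of_off hs ?_ fun y hy => by
      simp [commD, chart_zero_off hy, grd_eq_zero_off hy, eul_eq_zero_off hy]
    unfold commD mulB'
    fun_prop (disch := exact fun y => by have := one_add_height_pos y; positivity)
  have i4 : Integrable fun y => (eul (fun z : EuclideanSpace ℝ (Fin d) =>
      hardyM κ ε (height z) + (1 + height z)⁻¹ * V (graph z) / 2) y
      + d * (hardyM κ ε (height y) + (1 + height y)⁻¹ * V (graph y) / 2)) * ‖chart φ y‖ ^ 2 :=
    integrable_of_off hs ((hek.add (hkc.const_mul _)).mul (by fun_prop)) fun y hy => by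
      simp [chart_zero_off hy]
  refine le_trans ?_ (integral_mono (i1.add i2) i3 fun y => commD_ge hε1 φ y hκ)
  simp only [Pi.add_apply]
  rw [integral_add i1 i2, hibp, neg_add_eq_sub, ← integral_sub i2 i4]
  refine integral_nonneg fun y => ?_
  simp only [Pi.zero_apply]
  rw [← sub_mul]
  refine mul_nonneg ?_ (sq_nonneg _)
  have hVd : DifferentiableAt ℝ (V ∘ graph) y := (ContDiff.differentiable hV (by simp)).differentiableAt
  have hr1 : DifferentiableAt ℝ (fun z : EuclideanSpace ℝ (Fin d) => (1 + height z)⁻¹) y :=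
    ((contDiff_inv_one_add_height (n := 1)).differentiable (by simp)).differentiableAt
  have e1 : eul (fun z : EuclideanSpace ℝ (Fin d) =>
      hardyM κ ε (height z) + (1 + height z)⁻¹ * V (graph z) / 2) y
      = eul (fun z : EuclideanSpace ℝ (Fin d) => hardyM κ ε (height z)) y
        + ((1 + height y)⁻¹ * eul (V ∘ graph) y
          + V (graph y) * eul (fun z : EuclideanSpace ℝ (Fin d) => (1 + height z)⁻¹) y) / 2 := by
    have e2 := eul_mul hr1 hVd
    simp only [Function.comp_apply] at e2
    rw [← e2]
    have hm1 : DifferentiableAt ℝ (fun z : EuclideanSpace ℝ (Fin d) => hardyM κ ε (height z)) y :=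
      (hk1.differentiable (by simp)).differentiableAt
    have hm2 : DifferentiableAt ℝ (fun z : EuclideanSpace ℝ (Fin d) =>
      (1 + height z)⁻¹ * V (graph z)) y := (hk2.differentiable (by simp)).differentiableAt
    simp only [div_eq_mul_inv]
    rw [eul, fderiv_fun_add hm1 (hm2.mul_const (2 : ℝ)⁻¹), fderiv_mul_const hm2]
    simp [eul]
    ring
  rw [e1, eul_comp_height y (hF _ (height_pos y)),
    eul_comp_height (F := fun c => (1 + c)⁻¹) y (hasDerivAt_inv_one_add (height_pos y))]
  have h0 := one_le_height y
  have hv0 := hV0 (graph y)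
  have hvM := hVM (graph y)
  have hev := hrep y
  have hdd : dens y = (height y)⁻¹ := rfl
  rw [hdd]
  set c := height y
  set v := V (graph y)
  set u := eul (V ∘ graph) y
  have hc0 : 0 < c := by linarith
  have hpos : 0 < 1 + c := by linarith
  have hκ0 : 0 < κ := by rw [hκdef]; linarith
  have main : 0 ≤ c⁻¹ * (1 + c)⁻¹ ^ 2 * (κ * (κ + 1)
      - ε * v + ε * (1 + κ) * ((3 * (c - 1) - d * c) * (1 + c)⁻¹)
      + ε * κ ^ 2 * ((c - 1) * (1 + c)⁻¹)) + (1 + c)⁻¹ * (-u) / 2 := by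
    have g1 : -(d : ℝ) ≤ (3 * (c - 1) - d * c) * (1 + c)⁻¹ := by
      rw [← div_eq_mul_inv, le_div_iff₀ hpos]; nlinarith
    have g2 : 0 ≤ (c - 1) * (1 + c)⁻¹ := mul_nonneg (by linarith) (inv_pos.2 hpos).le
    have g3 : 0 ≤ (1 + c)⁻¹ * (-u) / 2 := by
      have : 0 ≤ -u := by linarith
      positivity
    have g4 : ε * v ≤ ε * M := by gcongr
    have g5 : ε * (1 + κ) * (-(d : ℝ)) ≤ ε * (1 + κ) * ((3 * (c - 1) - d * c) * (1 + c)⁻¹) := by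
      gcongr
    have g6 : 0 ≤ ε * κ ^ 2 * ((c - 1) * (1 + c)⁻¹) := by positivity
    have g7 : κ * (κ + 1) = d * (d - 2) / 4 := by rw [hκdef]; ring
    have g8 : ε * (1 + κ) * d + ε * M = ε * (d / 2 * d + M) := by rw [hκdef]; ring
    refine add_nonneg (mul_nonneg (by positivity) ?_) g3
    linarith
  refine le_of_le_of_eq main ?_
  simp only [mulB, hardyM, hκ]
  field_simp
  ring

end Chart

end HypWave
end

/-! ### Dilations -/

noncomputable section

namespace HypWave

open Filter Topology

section Dilation

variable {d : ℕ}

theorem norm_exp_smul (s : ℝ) (y : EuclideanSpace ℝ (Fin d)) :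
    ‖Real.exp s • y‖ = Real.exp s * ‖y‖ := by
  rw [norm_smul, Real.norm_of_nonneg (Real.exp_pos s).le]

theorem height_le_height_smul {s : ℝ} (hs : 0 ≤ s) (y : EuclideanSpace ℝ (Fin d)) :
    height y ≤ height (Real.exp s • y) := by
  refine Real.sqrt_le_sqrt ?_
  rw [norm_exp_smul]
  have h1 : 1 ≤ Real.exp s := Real.one_le_exp hs
  have : ‖y‖ ≤ Real.exp s * ‖y‖ := le_mul_of_one_le_left (norm_nonneg _) h1
  gcongr

theorem height_smul_le {s : ℝ} (hs : 0 ≤ s) (y : EuclideanSpace ℝ (Fin d)) :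
    height (Real.exp s • y) ≤ Real.exp s * height y := by
  refine Real.sqrt_le_iff.2 ⟨by have := height_pos y; positivity, ?_⟩
  rw [norm_exp_smul, mul_pow, mul_pow, height_sq]
  have h1 : 1 ≤ Real.exp s ^ 2 := one_le_pow₀ (Real.one_le_exp hs)
  nlinarith

theorem height_le_exp_abs_mul (s : ℝ) (y : EuclideanSpace ℝ (Fin d)) :
    height y ≤ Real.exp |s| * height (Real.exp s • y) := by
  rcases le_total 0 s with hs | hs
  · rw [abs_of_nonneg hs]
    have h1 := height_le_height_smul hs y
    have h2 := Real.one_le_exp hs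
    have h3 := height_pos (Real.exp s • y)
    nlinarith
  · rw [abs_of_nonpos hs]
    have := height_smul_le (s := -s) (by linarith) (Real.exp s • y)
    rwa [smul_smul, ← Real.exp_add, neg_add_cancel, Real.exp_zero, one_smul] at this

theorem dens_smul_le (s : ℝ) (y : EuclideanSpace ℝ (Fin d)) :
    dens (Real.exp s • y) ≤ Real.exp |s| * dens y := by
  have h := height_le_exp_abs_mul s y
  have h1 := height_pos y
  have h2 := height_pos (Real.exp s • y)
  unfold dens
  rw [inv_eq_one_div, inv_eq_one_div, mul_one_div, div_le_div_iff₀ h2 h1]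
  linarith

theorem integral_comp_exp_smul {G : Type*} [NormedAddCommGroup G] [NormedSpace ℝ G]
    (s : ℝ) (F : EuclideanSpace ℝ (Fin d) → G) :
    ∫ y, F (Real.exp s • y) = Real.exp (-(d * s)) • ∫ y, F y := by
  have h := Measure.integral_comp_smul (volume : Measure (EuclideanSpace ℝ (Fin d))) F (Real.exp s)
  rw [h, finrank_euclideanSpace_fin, abs_of_nonneg (by positivity), ← Real.exp_nat_mul,
    ← Real.exp_neg]

theorem hasCompactSupport_comp_exp_smul {G : Type*} [Zero G] [TopologicalSpace G]
    {f : EuclideanSpace ℝ (Fin d) → G} (hf : HasCompactSupport f) (s : ℝ) :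
    HasCompactSupport fun y => f (Real.exp s • y) :=
  hf.comp_homeomorph (Homeomorph.smulOfNeZero _ (Real.exp_pos s).ne')

section Pair

variable {H : Type*} [NormedAddCommGroup H] {ψ : EuclideanSpace ℝ (Fin d) → H}

theorem integral_dens_norm_sq_comp_le (hψ : Continuous ψ) (hs : HasCompactSupport ψ) (s : ℝ) :
    ∫ y, dens y * ‖ψ (Real.exp s • y)‖ ^ 2
      ≤ Real.exp ((d + 1) * |s|) * ∫ y, dens y * ‖ψ y‖ ^ 2 := by
  have h := integral_comp_exp_smul s fun y => dens (Real.exp (-s) • y) * ‖ψ y‖ ^ 2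
  simp only [smul_smul, ← Real.exp_add, neg_add_cancel, Real.exp_zero, one_smul] at h
  rw [h, smul_eq_mul]
  have i1 : Integrable fun y => dens y * ‖ψ y‖ ^ 2 :=
    integrable_of_off hs (by fun_prop) fun y hy => by simp [image_eq_zero_of_notMem_tsupport hy]
  have i2 : Integrable fun y => dens (Real.exp (-s) • y) * ‖ψ y‖ ^ 2 :=
    integrable_of_off hs (by fun_prop) fun y hy => by simp [image_eq_zero_of_notMem_tsupport hy]
  have h1 : ∫ y, dens (Real.exp (-s) • y) * ‖ψ y‖ ^ 2
      ≤ Real.exp |s| * ∫ y, dens y * ‖ψ y‖ ^ 2 := by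
    rw [← integral_const_mul]
    refine integral_mono i2 (i1.const_mul _) fun y => ?_
    have := dens_smul_le (-s) y
    rw [abs_neg] at this
    simp only [← mul_assoc]
    gcongr
  have h2 : Real.exp (-(d * s)) ≤ Real.exp (d * |s|) := by
    refine Real.exp_le_exp.2 ?_
    have := neg_abs_le s
    have hd : (0 : ℝ) ≤ d := Nat.cast_nonneg d
    nlinarith
  have h3 : 0 ≤ ∫ y, dens y * ‖ψ y‖ ^ 2 :=
    integral_nonneg fun y => by have := dens_pos y; positivity
  calc _ ≤ Real.exp (d * |s|) * (Real.exp |s| * ∫ y, dens y * ‖ψ y‖ ^ 2) :=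
        mul_le_mul h2 h1 (integral_nonneg fun y => mul_nonneg (dens_pos _).le (sq_nonneg _))
          (Real.exp_pos _).le
    _ = _ := by rw [← mul_assoc, ← Real.exp_add]; congr 2; ring

variable [InnerProductSpace ℂ H]

/-- The weight `tanh (r/2) / sinh r` of the multiplier in the chart. -/
def wt (y : EuclideanSpace ℝ (Fin d)) : ℝ := (1 + height y)⁻¹

theorem wt_pos (y : EuclideanSpace ℝ (Fin d)) : 0 < wt y := inv_pos.2 (one_add_height_pos y)

@[fun_prop]
theorem continuous_wt : Continuous (wt : EuclideanSpace ℝ (Fin d) → ℝ) :=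
  continuous_inv_one_add_height

theorem wt_le_dens (y : EuclideanSpace ℝ (Fin d)) : wt y ≤ dens y :=
  inv_anti₀ (height_pos y) (by linarith)

theorem wt_smul_le {s : ℝ} (hs : 0 ≤ s) (y : EuclideanSpace ℝ (Fin d)) :
    wt (Real.exp s • y) ≤ wt y :=
  inv_anti₀ (one_add_height_pos y) (by linarith [height_le_height_smul hs y])

theorem le_wt_smul {s : ℝ} (hs : 0 ≤ s) (y : EuclideanSpace ℝ (Fin d)) :
    Real.exp (-s) * wt y ≤ wt (Real.exp s • y) := by
  unfold wt
  rw [Real.exp_neg, ← mul_inv]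
  refine inv_anti₀ (one_add_height_pos _) ?_
  have := height_smul_le hs y
  have := Real.one_le_exp hs
  linarith

/-- The kernel that remains of a symmetric difference of dilations. -/
def dilKer (d : ℕ) (l s : ℝ) (y : EuclideanSpace ℝ (Fin d)) : ℝ :=
  Real.exp (l * s) * wt y - Real.exp ((d - l) * s) * wt (Real.exp s • y)

@[fun_prop]
theorem continuous_dilKer (l s : ℝ) : Continuous (dilKer d l s) := by unfold dilKer; fun_prop

theorem exp_sub_one_le {x : ℝ} : Real.exp x - 1 ≤ x * Real.exp x := by
  have h := Real.add_one_le_exp (-x)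
  have h2 : Real.exp (-x) * Real.exp x = 1 := by rw [← Real.exp_add]; simp
  nlinarith [Real.exp_pos x]

theorem abs_dilKer_le {l s : ℝ} (hl : 0 ≤ l) (hl2 : l + 1 ≤ d) (hs : 0 ≤ s) (hs1 : s ≤ 1)
    (y : EuclideanSpace ℝ (Fin d)) : |dilKer d l s y| ≤ d * Real.exp d * s * wt y := by
  have hw := wt_pos y
  have h1 := wt_smul_le hs y
  have h2 := le_wt_smul hs y
  have hd0 : (0 : ℝ) ≤ d := Nat.cast_nonneg d
  have e1 : Real.exp (d * s) - 1 ≤ d * Real.exp d * s := by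
    have h3 := exp_sub_one_le (x := d * s)
    have h4 : Real.exp (d * s) ≤ Real.exp d := Real.exp_le_exp.2 (by nlinarith)
    have : (d * s) * Real.exp (d * s) ≤ (d * s) * Real.exp d := by gcongr
    linarith
  have e2 : Real.exp (l * s) ≤ Real.exp (d * s) := Real.exp_le_exp.2 (by nlinarith)
  have e3 : 1 ≤ Real.exp (l * s) := Real.one_le_exp (by positivity)
  have e4 : Real.exp ((d - l) * s) ≤ Real.exp (d * s) := Real.exp_le_exp.2 (by nlinarith)
  have e5 : wt y ≤ Real.exp ((d - l) * s) * wt (Real.exp s • y) := by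
    have e6 : 1 ≤ Real.exp ((d - l) * s) * Real.exp (-s) := by
      rw [← Real.exp_add]; exact Real.one_le_exp (by nlinarith)
    calc wt y ≤ (Real.exp ((d - l) * s) * Real.exp (-s)) * wt y := le_mul_of_one_le_left hw.le e6
      _ = Real.exp ((d - l) * s) * (Real.exp (-s) * wt y) := by ring
      _ ≤ _ := by gcongr
  have e7 : Real.exp ((d - l) * s) * wt (Real.exp s • y) ≤ Real.exp (d * s) * wt y :=
    mul_le_mul e4 h1 (wt_pos _).le (Real.exp_pos _).le
  have e8 : (Real.exp (d * s) - 1) * wt y ≤ d * Real.exp d * s * wt y := by gcongr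
  have e9 : Real.exp (l * s) * wt y ≤ Real.exp (d * s) * wt y := by gcongr
  have e10 : wt y ≤ Real.exp (l * s) * wt y := le_mul_of_one_le_left hw.le e3
  rw [dilKer, abs_le]
  constructor <;> linarith

theorem abs_re_inner_le (a b : H) : |(inner ℂ a b).re| ≤ ‖a‖ * ‖b‖ :=
  (Complex.abs_re_le_norm _).trans (norm_inner_le_norm _ _)

theorem integral_pair_sub (hψ : Continuous ψ) (hs : HasCompactSupport ψ) (l s : ℝ) :
    (∫ y, wt y * (Real.exp (l * s) * (inner ℂ (ψ y) (ψ (Real.exp s • y))).re))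
      - ∫ y, wt y * (Real.exp (l * -s) * (inner ℂ (ψ y) (ψ (Real.exp (-s) • y))).re)
    = ∫ y, dilKer d l s y * (inner ℂ (ψ y) (ψ (Real.exp s • y))).re := by
  have h := integral_comp_exp_smul s fun y =>
    wt y * (Real.exp (l * -s) * (inner ℂ (ψ y) (ψ (Real.exp (-s) • y))).re)
  simp only [smul_smul, ← Real.exp_add, neg_add_cancel, Real.exp_zero, one_smul] at h
  have h2 : ∫ y, wt y * (Real.exp (l * -s) * (inner ℂ (ψ y) (ψ (Real.exp (-s) • y))).re)
      = ∫ y, Real.exp ((d - l) * s) * wt (Real.exp s • y)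
        * (inner ℂ (ψ y) (ψ (Real.exp s • y))).re := by
    have h3 : ∫ y, wt y * (Real.exp (l * -s) * (inner ℂ (ψ y) (ψ (Real.exp (-s) • y))).re)
        = Real.exp (d * s) * ∫ y, wt (Real.exp s • y) *
          (Real.exp (l * -s) * (inner ℂ (ψ (Real.exp s • y)) (ψ y)).re) := by
      rw [h, smul_eq_mul, ← mul_assoc, ← Real.exp_add]
      simp
    rw [h3, ← integral_const_mul]
    refine integral_congr_ae (.of_forall fun y => ?_)
    have h4 : (inner ℂ (ψ (Real.exp s • y)) (ψ y)).re = (inner ℂ (ψ y) (ψ (Real.exp s • y))).re := by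
      rw [← inner_conj_symm, Complex.conj_re]
    have h5 : Real.exp ((d - l) * s) = Real.exp (d * s) * Real.exp (l * -s) := by
      rw [← Real.exp_add]; congr 1; ring
    simp only [h4, h5]
    ring
  have i1 : Integrable fun y =>
      wt y * (Real.exp (l * s) * (inner ℂ (ψ y) (ψ (Real.exp s • y))).re) :=
    integrable_of_off hs (by fun_prop) fun y hy => by simp [image_eq_zero_of_notMem_tsupport hy]
  have i2 : Integrable fun y => Real.exp ((d - l) * s) * wt (Real.exp s • y)
        * (inner ℂ (ψ y) (ψ (Real.exp s • y))).re :=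
    integrable_of_off hs (by fun_prop) fun y hy => by simp [image_eq_zero_of_notMem_tsupport hy]
  rw [h2, ← integral_sub i1 i2]
  refine integral_congr_ae (.of_forall fun y => ?_)
  simp only [dilKer]
  ring

theorem abs_integral_dilKer_le (hψ : Continuous ψ) (hs : HasCompactSupport ψ) {l s : ℝ}
    (hl : 0 ≤ l) (hl2 : l + 1 ≤ d) (hs0 : 0 ≤ s) (hs1 : s ≤ 1) :
    |∫ y, dilKer d l s y * (inner ℂ (ψ y) (ψ (Real.exp s • y))).re|
      ≤ d * Real.exp d * (1 + Real.exp (d + 1)) * s * ∫ y, dens y * ‖ψ y‖ ^ 2 := by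
  have i1 : Integrable fun y => dens y * ‖ψ y‖ ^ 2 :=
    integrable_of_off hs (by fun_prop) fun y hy => by simp [image_eq_zero_of_notMem_tsupport hy]
  have i2 : Integrable fun y => dens y * ‖ψ (Real.exp s • y)‖ ^ 2 :=
    integrable_of_off (hasCompactSupport_comp_exp_smul hs s) (by fun_prop)
      fun y hy => by simp [image_eq_zero_of_notMem_tsupport hy]
  have h0 := integral_dens_norm_sq_comp_le hψ hs s
  have h3 : 0 ≤ ∫ y, dens y * ‖ψ y‖ ^ 2 :=
    integral_nonneg fun y => by have := dens_pos y; positivity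
  have h1 : ∫ y, dens y * ‖ψ (Real.exp s • y)‖ ^ 2
      ≤ Real.exp (d + 1) * ∫ y, dens y * ‖ψ y‖ ^ 2 := by
    refine h0.trans ?_
    gcongr
    rw [abs_of_nonneg hs0]
    have : (0 : ℝ) ≤ d + 1 := by positivity
    nlinarith
  have h2 : |∫ y, dilKer d l s y * (inner ℂ (ψ y) (ψ (Real.exp s • y))).re|
      ≤ ∫ y, d * Real.exp d * s * (dens y * ‖ψ y‖ ^ 2 + dens y * ‖ψ (Real.exp s • y)‖ ^ 2) := by
    rw [← Real.norm_eq_abs]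
    refine norm_integral_le_of_norm_le ((i1.add i2).const_mul _) (.of_forall fun y => ?_)
    rw [Real.norm_eq_abs, abs_mul]
    have k1 := abs_dilKer_le hl hl2 hs0 hs1 y
    have k2 := abs_re_inner_le (ψ y) (ψ (Real.exp s • y))
    have k3 := wt_le_dens y
    have k4 := wt_pos y
    calc _ ≤ (d * Real.exp d * s * dens y) * (‖ψ y‖ * ‖ψ (Real.exp s • y)‖) := by
          refine mul_le_mul (k1.trans (by gcongr)) k2 (abs_nonneg _) ?_
          have := dens_pos y
          positivity
      _ ≤ (d * Real.exp d * s * dens y) * (‖ψ y‖ ^ 2 + ‖ψ (Real.exp s • y)‖ ^ 2) := by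
          have := dens_pos y
          refine mul_le_mul_of_nonneg_left ?_ (by positivity)
          nlinarith [sq_nonneg (‖ψ y‖ - ‖ψ (Real.exp s • y)‖), sq_nonneg ‖ψ y‖,
            sq_nonneg ‖ψ (Real.exp s • y)‖]
      _ = _ := by ring
  refine h2.trans ?_
  rw [integral_const_mul, integral_add i1 i2]
  calc _ ≤ d * Real.exp d * s * ((∫ y, dens y * ‖ψ y‖ ^ 2)
        + Real.exp (d + 1) * ∫ y, dens y * ‖ψ y‖ ^ 2) := by gcongr
    _ = _ := by ring

theorem hasDerivAt_comp_exp_smul {F : Type*} [NormedAddCommGroup F] [NormedSpace ℝ F]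
    {f : EuclideanSpace ℝ (Fin d) → F} (hf : Differentiable ℝ f) (y : EuclideanSpace ℝ (Fin d))
    (s : ℝ) : HasDerivAt (fun s => f (Real.exp s • y)) (eul f (Real.exp s • y)) s := by
  have h1 : HasDerivAt (fun s => Real.exp s • y) (Real.exp s • y) s :=
    (Real.hasDerivAt_exp s).smul_const y
  exact (hf _).hasFDerivAt.comp_hasDerivAt s h1

theorem tendsto_dilKer (l : ℝ) (y : EuclideanSpace ℝ (Fin d)) :
    Tendsto (fun s => (2 * s)⁻¹ * dilKer d l s y) (𝓝[>] 0)
      (𝓝 (((2 * l - d) * wt y - eul wt y) / 2)) := by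
  have hw : Differentiable ℝ (wt : EuclideanSpace ℝ (Fin d) → ℝ) :=
    (contDiff_inv_one_add_height (n := 1)).differentiable (by simp)
  have he : ∀ a : ℝ, HasDerivAt (fun s => Real.exp (a * s)) a 0 := fun a => by
    have := ((hasDerivAt_id (0 : ℝ)).const_mul a).exp
    simpa using! this
  have h := ((he l).mul_const (wt y)).sub ((he (d - l)).mul (hasDerivAt_comp_exp_smul hw y 0))
  have h2 := h.tendsto_slope_zero_right
  have h3 := h2.const_mul (1 / 2)
  refine (h3.congr' ?_).trans (le_of_eq ?_)
  · filter_upwards [self_mem_nhdsWithin] with s hs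
    have : s ≠ 0 := ne_of_gt hs
    simp only [Pi.sub_apply, Pi.mul_apply, dilKer, zero_add, mul_zero, Real.exp_zero, one_smul,
      one_mul, sub_self, sub_zero, smul_eq_mul]
    field_simp
  · congr 1
    simp
    ring

theorem tendsto_integral_dilKer (hψ : Continuous ψ) (hs : HasCompactSupport ψ) {l : ℝ}
    (hl : 0 ≤ l) (hl2 : l + 1 ≤ d) :
    Tendsto (fun s => (2 * s)⁻¹ * ∫ y, dilKer d l s y * (inner ℂ (ψ y) (ψ (Real.exp s • y))).re)
      (𝓝[>] 0) (𝓝 (∫ y, ((2 * l - d) * wt y - eul wt y) / 2 * ‖ψ y‖ ^ 2)) := by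
  obtain ⟨M, hM⟩ := hψ.bounded_above_of_compact_support hs
  simp only [← integral_const_mul]
  refine tendsto_integral_filter_of_dominated_convergence
    (fun y => d * Real.exp d * (wt y * (‖ψ y‖ * M))) ?_ ?_ ?_ ?_
  · exact .of_forall fun s => Continuous.aestronglyMeasurable (by fun_prop)
  · filter_upwards [Ioc_mem_nhdsGT (show (0 : ℝ) < 1 by norm_num)] with s hs'
    refine .of_forall fun y => ?_
    have k1 := abs_dilKer_le hl hl2 hs'.1.le hs'.2 y
    have k2 := (abs_re_inner_le (ψ y) (ψ (Real.exp s • y)))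
    have k3 := hM (Real.exp s • y)
    have k4 := wt_pos y
    have k5 := hs'.1
    rw [Real.norm_eq_abs, abs_mul, abs_mul, abs_of_pos (by positivity : 0 < (2 * s)⁻¹)]
    calc _ ≤ (2 * s)⁻¹ * ((d * Real.exp d * s * wt y) * (‖ψ y‖ * M)) := by
          gcongr
          exact k2.trans (by gcongr)
      _ = (1 / 2) * (d * Real.exp d * (wt y * (‖ψ y‖ * M))) := by field_simp
      _ ≤ 1 * (d * Real.exp d * (wt y * (‖ψ y‖ * M))) := by
          have : 0 ≤ M := (norm_nonneg _).trans k3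
          gcongr
          norm_num
      _ = _ := one_mul _
  · exact integrable_of_off hs (by fun_prop) fun y hy => by
      simp [image_eq_zero_of_notMem_tsupport hy]
  · refine .of_forall fun y => ?_
    have h1 := tendsto_dilKer l y
    have h2 : Tendsto (fun s : ℝ => (inner ℂ (ψ y) (ψ (Real.exp s • y))).re) (𝓝[>] 0)
        (𝓝 (‖ψ y‖ ^ 2)) := by
      have hc : Continuous fun s : ℝ => (inner ℂ (ψ y) (ψ (Real.exp s • y))).re := by fun_prop
      have h3 := hc.tendsto 0
      have h4 := inner_self_eq_norm_sq (𝕜 := ℂ) (ψ y)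
      rw [RCLike.re_to_complex] at h4
      simp only [Real.exp_zero, one_smul, h4] at h3
      exact h3.mono_left nhdsWithin_le_nhds
    refine (h1.mul h2).congr fun s => by ring

end Pair

end Dilation

end HypWave
end

/-! ### Symmetric difference quotients along dilations -/

noncomputable section

namespace HypWave

open Filter Topology

section Quotient

variable {d : ℕ}

theorem sq_intervalIntegral_le {f : ℝ → ℝ} (hf : Continuous f) {a b : ℝ} (hab : a < b) :
    (∫ t in a..b, f t) ^ 2 ≤ (b - a) * ∫ t in a..b, f t ^ 2 := by
  have hba : 0 < b - a := by linarith
  set I := ∫ t in a..b, f t with hI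
  set m := I / (b - a) with hm
  have h : 0 ≤ ∫ t in a..b, (f t - m) ^ 2 :=
    intervalIntegral.integral_nonneg hab.le fun t _ => sq_nonneg _
  have e : (∫ t in a..b, (f t - m) ^ 2) = (∫ t in a..b, f t ^ 2) - 2 * m * I + m ^ 2 * (b - a) := by
    have e1 : ∀ t, (f t - m) ^ 2 = f t ^ 2 - 2 * m * f t + m ^ 2 := fun t => by ring
    simp only [e1]
    rw [intervalIntegral.integral_add, intervalIntegral.integral_sub,
      intervalIntegral.integral_const_mul, intervalIntegral.integral_const, smul_eq_mul]
    · ring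
    all_goals exact Continuous.intervalIntegrable (by fun_prop) _ _
  have e2 : m * (b - a) = I := by rw [hm]; field_simp
  rw [e] at h
  have e3 : m ^ 2 * (b - a) = m * I := by rw [sq, mul_assoc, e2]
  rw [e3] at h
  have : (b - a) * (m * I) = I ^ 2 := by rw [← mul_assoc, mul_comm (b - a), e2, sq]
  nlinarith

/-- The symmetric difference quotient along dilations. -/
def dilQ (s : ℝ) (f : EuclideanSpace ℝ (Fin d) → ℂ) (y : EuclideanSpace ℝ (Fin d)) : ℂ :=
  (((2 * s)⁻¹ : ℝ) : ℂ) * (f (Real.exp s • y) - f (Real.exp (-s) • y))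

variable {f : EuclideanSpace ℝ (Fin d) → ℂ}

theorem dil_sub_eq_integral (hf : ContDiff ℝ 1 f) (s : ℝ) (y : EuclideanSpace ℝ (Fin d)) :
    f (Real.exp s • y) - f (Real.exp (-s) • y) = ∫ t in -s..s, eul f (Real.exp t • y) := by
  have hc := continuous_eul hf
  refine (intervalIntegral.integral_eq_sub_of_hasDerivAt
    (fun t _ => hasDerivAt_comp_exp_smul (hf.differentiable (by simp)) y t) ?_).symm
  exact Continuous.intervalIntegrable (by fun_prop) _ _

theorem norm_dilQ_le (hf : ContDiff ℝ 1 f) {M : ℝ} (hM : ∀ y, ‖eul f y‖ ≤ M) {s : ℝ} (hs : 0 < s)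
    (y : EuclideanSpace ℝ (Fin d)) : ‖dilQ s f y‖ ≤ M := by
  rw [dilQ, dil_sub_eq_integral hf, norm_mul, Complex.norm_real, Real.norm_of_nonneg (by positivity)]
  have h := intervalIntegral.norm_integral_le_of_norm_le_const (a := -s) (b := s)
    (f := fun t => eul f (Real.exp t • y)) (C := M) fun t _ => hM _
  have e : |s - -s| = 2 * s := by rw [abs_of_nonneg] <;> linarith
  rw [e] at h
  rw [inv_mul_le_iff₀ (by positivity)]
  linarith

theorem tendsto_dilQ (hf : ContDiff ℝ 1 f) (y : EuclideanSpace ℝ (Fin d)) :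
    Tendsto (fun s => dilQ s f y) (𝓝[>] 0) (𝓝 (eul f y)) := by
  have h1 := hasDerivAt_comp_exp_smul (hf.differentiable (by simp)) y 0
  have h2 : HasDerivAt (fun s : ℝ => f (Real.exp (-s) • y)) (-eul f (Real.exp 0 • y)) 0 := by
    have h3 := hasDerivAt_comp_exp_smul (hf.differentiable (by simp)) y (-0)
    have h4 := h3.scomp (h := fun s : ℝ => -s) 0 (hasDerivAt_neg 0)
    simpa using! h4
  have h3 := ((h1.sub h2).tendsto_slope_zero_right).const_mul (1 / 2 : ℂ)
  refine (h3.congr' ?_).trans (le_of_eq ?_)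
  · filter_upwards [self_mem_nhdsWithin] with s hs
    have : (s : ℂ) ≠ 0 := by exact_mod_cast (ne_of_gt hs)
    simp only [Pi.sub_apply, dilQ, zero_add, neg_zero, sub_self, sub_zero, Complex.real_smul]
    push_cast
    field_simp
  · congr 1
    simp
    ring

@[fun_prop]
theorem continuous_dilQ (hf : Continuous f) (s : ℝ) : Continuous (dilQ s f) := by
  unfold dilQ; fun_prop

theorem exists_norm_eul_le (hf : ContDiff ℝ 1 f) (hs : HasCompactSupport f) :
    ∃ M, ∀ y, ‖eul f y‖ ≤ M :=
  (continuous_eul hf).bounded_above_of_compact_support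
    (HasCompactSupport.intro hs.isCompact fun _ hy => eul_eq_zero_off hy)

theorem tendsto_integral_conj_mul_dilQ (hf : ContDiff ℝ 1 f) (hs : HasCompactSupport f)
    {χ : EuclideanSpace ℝ (Fin d) → ℂ} (hχ : Continuous χ) (hχs : HasCompactSupport χ) :
    Tendsto (fun s => ∫ y, (conj (χ y) * dilQ s f y).re) (𝓝[>] 0)
      (𝓝 (∫ y, (conj (χ y) * eul f y).re)) := by
  obtain ⟨M, hM⟩ := exists_norm_eul_le hf hs
  have hfc := hf.continuous
  refine tendsto_integral_filter_of_dominated_convergence (fun y => ‖χ y‖ * M) ?_ ?_ ?_ ?_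
  · exact .of_forall fun s => Continuous.aestronglyMeasurable (by fun_prop)
  · filter_upwards [self_mem_nhdsWithin] with s hs'
    refine .of_forall fun y => ?_
    refine (abs_re_conj_mul_le _ _).trans ?_
    gcongr
    exact norm_dilQ_le hf hM hs' y
  · exact integrable_of_off hχs (by fun_prop) fun y hy => by
      simp [image_eq_zero_of_notMem_tsupport hy]
  · refine .of_forall fun y => ?_
    exact (Complex.continuous_re.tendsto _).comp ((tendsto_dilQ hf y).const_mul _)

theorem dens_le_one (y : EuclideanSpace ℝ (Fin d)) : dens y ≤ 1 :=
  inv_le_one_of_one_le₀ (one_le_height y)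

theorem tendsto_integral_norm_dilQ_sub (hf : ContDiff ℝ 1 f) (hs : HasCompactSupport f) :
    Tendsto (fun s => ∫ y, dens y * ‖dilQ s f y - eul f y‖ ^ 2) (𝓝[>] 0) (𝓝 0) := by
  obtain ⟨M, hM⟩ := exists_norm_eul_le hf hs
  have hM0 : 0 ≤ M := (norm_nonneg _).trans (hM 0)
  have hfc := hf.continuous
  have hec := continuous_eul hf
  obtain ⟨r, hr⟩ := hs.isCompact.isBounded.subset_closedBall 0
  have hoff : ∀ y : EuclideanSpace ℝ (Fin d), r < ‖y‖ → y ∉ tsupport f := fun y hy h => by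
    have := hr h
    rw [mem_closedBall_zero_iff] at this
    linarith
  have h0 : (∫ _ : EuclideanSpace ℝ (Fin d), (0 : ℝ)) = 0 := by simp
  suffices h : Tendsto (fun s => ∫ y, dens y * ‖dilQ s f y - eul f y‖ ^ 2) (𝓝[>] 0)
      (𝓝 (∫ _ : EuclideanSpace ℝ (Fin d), (0 : ℝ))) by rwa [h0] at h
  refine tendsto_integral_filter_of_dominated_convergence
    ((Metric.closedBall (0 : EuclideanSpace ℝ (Fin d)) (Real.exp 1 * |r|)).indicator
      fun _ => (2 * M) ^ 2) ?_ ?_ ?_ ?_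
  · exact .of_forall fun s => Continuous.aestronglyMeasurable (by fun_prop)
  · filter_upwards [Ioc_mem_nhdsGT (show (0 : ℝ) < 1 by norm_num)] with s hs'
    refine .of_forall fun y => ?_
    by_cases hy : y ∈ Metric.closedBall (0 : EuclideanSpace ℝ (Fin d)) (Real.exp 1 * |r|)
    · rw [Set.indicator_of_mem hy, norm_mul, Real.norm_of_nonneg (dens_pos y).le,
        Real.norm_of_nonneg (sq_nonneg _)]
      have h1 : ‖dilQ s f y - eul f y‖ ≤ 2 * M :=
        (norm_sub_le _ _).trans (by linarith [norm_dilQ_le hf hM hs'.1 y, hM y])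
      calc _ ≤ 1 * (2 * M) ^ 2 := by
            gcongr
            exact dens_le_one y
        _ = _ := one_mul _
    · rw [Set.indicator_of_notMem hy]
      rw [mem_closedBall_zero_iff, not_le] at hy
      have hz : ∀ t : ℝ, -1 ≤ t → Real.exp t • y ∉ tsupport f := fun t ht => by
        refine hoff _ ?_
        rw [norm_exp_smul]
        have h1 : Real.exp (-1) ≤ Real.exp t := Real.exp_le_exp.2 ht
        have h2 : Real.exp (-1) * Real.exp 1 = 1 := by rw [← Real.exp_add]; simp
        have h3 : Real.exp (-1) * (Real.exp 1 * |r|) < Real.exp (-1) * ‖y‖ := by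
          gcongr
        rw [← mul_assoc, h2, one_mul] at h3
        have h4 : Real.exp (-1) * ‖y‖ ≤ Real.exp t * ‖y‖ := by gcongr
        linarith [le_abs_self r]
      have z1 := image_eq_zero_of_notMem_tsupport (hz s (by linarith [hs'.1]))
      have z2 := image_eq_zero_of_notMem_tsupport (hz (-s) (by linarith [hs'.2]))
      have z3 := hz 0 (by norm_num)
      rw [Real.exp_zero, one_smul] at z3
      simp [dilQ, z1, z2, eul_eq_zero_off z3]
  · exact (integrable_indicator_iff measurableSet_closedBall).2
      (integrableOn_const (hs := measure_closedBall_lt_top.ne))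
  · refine .of_forall fun y => ?_
    have h1 := ((tendsto_dilQ hf y).sub_const (eul f y)).norm.pow 2
    have h2 := h1.const_mul (dens y)
    simpa using h2

theorem integral_norm_dilQ_sq_le (hf : ContDiff ℝ 1 f) (hs : HasCompactSupport f) {s : ℝ}
    (hs0 : 0 < s) (hs1 : s ≤ 1) :
    ∫ y, dens y * ‖dilQ s f y‖ ^ 2 ≤ Real.exp (d + 1) * ∫ y, dens y * ‖eul f y‖ ^ 2 := by
  have hfc := hf.continuous
  have hec := continuous_eul hf
  have hes : HasCompactSupport (eul f) :=
    HasCompactSupport.intro hs.isCompact fun _ hy => eul_eq_zero_off hy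
  have hQs : HasCompactSupport (dilQ s f) :=
    ((hasCompactSupport_comp_exp_smul hs s).sub (hasCompactSupport_comp_exp_smul hs (-s))).mul_left
  set A := ∫ y, dens y * ‖eul f y‖ ^ 2 with hA
  have hA0 : 0 ≤ A := integral_nonneg fun y => mul_nonneg (dens_pos _).le (sq_nonneg _)
  have hpt : ∀ y, dens y * ‖dilQ s f y‖ ^ 2
      ≤ (2 * s)⁻¹ * ∫ t in -s..s, dens y * ‖eul f (Real.exp t • y)‖ ^ 2 := fun y => by
    have h1 : ‖∫ t in -s..s, eul f (Real.exp t • y)‖ ≤ ∫ t in -s..s, ‖eul f (Real.exp t • y)‖ :=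
      intervalIntegral.norm_integral_le_integral_norm (by linarith)
    have h2 := sq_intervalIntegral_le (f := fun t => ‖eul f (Real.exp t • y)‖) (by fun_prop)
      (a := -s) (b := s) (by linarith)
    have h3 : ‖∫ t in -s..s, eul f (Real.exp t • y)‖ ^ 2
        ≤ (s - -s) * ∫ t in -s..s, ‖eul f (Real.exp t • y)‖ ^ 2 :=
      (pow_le_pow_left₀ (norm_nonneg _) h1 2).trans h2
    rw [intervalIntegral.integral_const_mul, dilQ, dil_sub_eq_integral hf, norm_mul,
      Complex.norm_real, Real.norm_of_nonneg (by positivity), mul_pow]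
    calc _ ≤ dens y * ((2 * s)⁻¹ ^ 2 * ((s - -s) * ∫ t in -s..s, ‖eul f (Real.exp t • y)‖ ^ 2)) := by
          have := dens_pos y
          gcongr
      _ = _ := by field_simp; ring
  obtain ⟨r, hr⟩ := hes.isCompact.isBounded.subset_closedBall 0
  have hoff : ∀ y : EuclideanSpace ℝ (Fin d), r < ‖y‖ → eul f y = 0 := fun y hy => by
    by_contra h
    have := hr (subset_tsupport _ h)
    rw [mem_closedBall_zero_iff] at this
    linarith
  have hprod : Integrable (Function.uncurry fun (t : ℝ) (y : EuclideanSpace ℝ (Fin d)) =>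
      dens y * ‖eul f (Real.exp t • y)‖ ^ 2) ((volume.restrict (Set.Ioc (-s) s)).prod volume) := by
    have hc : Continuous (Function.uncurry fun (t : ℝ) (y : EuclideanSpace ℝ (Fin d)) =>
      dens y * ‖eul f (Real.exp t • y)‖ ^ 2) := by
      unfold Function.uncurry
      fun_prop
    have h1 := hc.continuousOn.integrableOn_compact (μ := (volume : Measure ℝ).prod volume)
      ((isCompact_Icc (a := -s) (b := s)).prod
        (isCompact_closedBall (0 : EuclideanSpace ℝ (Fin d)) (Real.exp 1 * |r|)))
    have h2 : IntegrableOn (Function.uncurry fun (t : ℝ) (y : EuclideanSpace ℝ (Fin d)) =>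
      dens y * ‖eul f (Real.exp t • y)‖ ^ 2) (Set.Ioc (-s) s ×ˢ Set.univ)
        ((volume : Measure ℝ).prod volume) := by
      refine h1.of_forall_sdiff_eq_zero (measurableSet_Ioc.prod MeasurableSet.univ) ?_
      rintro ⟨t, y⟩ ⟨⟨ht, -⟩, h3⟩
      have hy : Real.exp 1 * |r| < ‖y‖ := by
        by_contra hy
        exact h3 ⟨⟨ht.1.le, ht.2⟩, mem_closedBall_zero_iff.2 (not_lt.1 hy)⟩
      have h4 : eul f (Real.exp t • y) = 0 := by
        refine hoff _ ?_
        rw [norm_exp_smul]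
        have ht1 : -1 ≤ t := by have := ht.1; simp only at this; linarith
        have h1 : Real.exp (-1) ≤ Real.exp t := Real.exp_le_exp.2 ht1
        have h2 : Real.exp (-1) * Real.exp 1 = 1 := by rw [← Real.exp_add]; simp
        have h3 : Real.exp (-1) * (Real.exp 1 * |r|) < Real.exp (-1) * ‖y‖ := by gcongr
        rw [← mul_assoc, h2, one_mul] at h3
        have h4 : Real.exp (-1) * ‖y‖ ≤ Real.exp t * ‖y‖ := by gcongr
        linarith [le_abs_self r]
      simp [Function.uncurry, h4]
    have h3 := Measure.prod_restrict (μ := (volume : Measure ℝ))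
      (ν := (volume : Measure (EuclideanSpace ℝ (Fin d)))) (Set.Ioc (-s) s) Set.univ
    rw [Measure.restrict_univ] at h3
    rw [h3]
    exact h2
  have hswap := integral_integral_swap hprod
  have iR : Integrable fun y : EuclideanSpace ℝ (Fin d) =>
      (2 * s)⁻¹ * ∫ t in -s..s, dens y * ‖eul f (Real.exp t • y)‖ ^ 2 := by
    have := hprod.integral_prod_right
    simp only [intervalIntegral.integral_of_le (show -s ≤ s by linarith)]
    exact this.const_mul _
  have iL : Integrable fun y => dens y * ‖dilQ s f y‖ ^ 2 :=
    integrable_of_off hQs (by fun_prop) fun y hy => by simp [image_eq_zero_of_notMem_tsupport hy]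
  refine (integral_mono iL iR hpt).trans ?_
  rw [integral_const_mul]
  simp only [intervalIntegral.integral_of_le (show -s ≤ s by linarith)]
  rw [← hswap, ← intervalIntegral.integral_of_le (show -s ≤ s by linarith)]
  have hb := intervalIntegral.norm_integral_le_of_norm_le_const (a := -s) (b := s)
    (f := fun t => ∫ y, dens y * ‖eul f (Real.exp t • y)‖ ^ 2) (C := Real.exp (d + 1) * A) ?_
  · have e : |s - -s| = 2 * s := by rw [abs_of_nonneg] <;> linarith
    rw [e] at hb
    have h5 := (le_abs_self _).trans hb
    rw [inv_mul_le_iff₀ (by positivity)]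
    linarith
  · intro t ht
    rw [Set.uIoc_of_le (by linarith)] at ht
    rw [Real.norm_of_nonneg (integral_nonneg fun y => mul_nonneg (dens_pos _).le (sq_nonneg _))]
    refine (integral_dens_norm_sq_comp_le hec hes t).trans ?_
    gcongr
    have h1 : |t| ≤ 1 := abs_le.2 ⟨by linarith [ht.1], by linarith [ht.2]⟩
    have : (0 : ℝ) ≤ d + 1 := by positivity
    nlinarith

end Quotient

end HypWave
end

/-! ### Limits of operators on a dense set -/

noncomputable section

namespace HypWave

open Filter Topology

section DenseLimits

variable {H E : Type*} [NormedAddCommGroup H] [InnerProductSpace ℂ H]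
  [NormedAddCommGroup E] [InnerProductSpace ℂ E]

theorem tendsto_apply_of_dense {l : Filter ℝ} {T : ℝ → H →L[ℂ] E} {T₀ : H →L[ℂ] E} {C : ℝ}
    (hC : ∀ᶠ s in l, ‖T s‖ ≤ C) {D : Set H} (hD : Dense D)
    (h : ∀ φ ∈ D, Tendsto (fun s => T s φ) l (𝓝 (T₀ φ))) (v : H) :
    Tendsto (fun s => T s v) l (𝓝 (T₀ v)) := by
  rw [Metric.tendsto_nhds]
  intro ε hε
  set K := |C| + ‖T₀‖ + 1 with hK
  have hK0 : 0 < K := by positivity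
  obtain ⟨φ, hφD, hφ⟩ := Metric.dense_iff.1 hD v (ε / (2 * K)) (by positivity)
  rw [Metric.mem_ball, dist_comm, dist_eq_norm] at hφD
  filter_upwards [hC, (Metric.tendsto_nhds.1 (h φ hφ)) (ε / 2) (by positivity)] with s hs1 hs2
  rw [dist_eq_norm] at hs2 ⊢
  have e : T s v - T₀ v = T s (v - φ) + (T s φ - T₀ φ) - T₀ (v - φ) := by
    simp only [map_sub]; abel
  rw [e]
  have n1 : ‖T s (v - φ)‖ ≤ |C| * ‖v - φ‖ :=
    ((T s).le_opNorm _).trans (by gcongr; exact hs1.trans (le_abs_self _))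
  have n2 := T₀.le_opNorm (v - φ)
  have n3 := norm_sub_le (T s (v - φ) + (T s φ - T₀ φ)) (T₀ (v - φ))
  have n4 := norm_add_le (T s (v - φ)) (T s φ - T₀ φ)
  have n5 : K * ‖v - φ‖ < K * (ε / (2 * K)) := by gcongr
  have n6 : K * (ε / (2 * K)) = ε / 2 := by field_simp
  have n7 : K * ‖v - φ‖ = |C| * ‖v - φ‖ + ‖T₀‖ * ‖v - φ‖ + ‖v - φ‖ := by rw [hK]; ring
  linarith [norm_nonneg (v - φ)]

/-- A uniformly bounded family of quadratic forms depends on its argument uniformly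
continuously. -/
theorem abs_quadratic_sub_le {A : H →L[ℂ] H} {C : ℝ} (hc : 0 ≤ C)
    (hC : ∀ v, |(inner ℂ v (A v)).re| ≤ C * ‖v‖ ^ 2) {v φ : H} {δ : ℝ} (hδ : 0 < δ)
    (h : ‖v - φ‖ ≤ δ) :
    |(inner ℂ v (A v)).re - (inner ℂ φ (A φ)).re| ≤ C * (δ ^ 2 + 3 * δ + 3 * δ * ‖φ‖ ^ 2) := by
  set w := v - φ with hw
  have hv : v = w + φ := by rw [hw]; abel
  set q := (inner ℂ w (A φ)).re + (inner ℂ φ (A w)).re with hq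
  have h1 : (inner ℂ v (A v)).re = (inner ℂ w (A w)).re + q + (inner ℂ φ (A φ)).re := by
    rw [hv, hq]
    simp only [map_add, inner_add_left, inner_add_right, Complex.add_re]
    ring
  set m := Real.sqrt δ with hm
  have hm0 : 0 < m := Real.sqrt_pos.2 hδ
  have hm2 : m ^ 2 = δ := Real.sq_sqrt hδ.le
  set u := ((m⁻¹ : ℝ) : ℂ) • w + ((m : ℝ) : ℂ) • φ with hu
  have h2 : (inner ℂ u (A u)).re
      = m⁻¹ ^ 2 * (inner ℂ w (A w)).re + q + m ^ 2 * (inner ℂ φ (A φ)).re := by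
    rw [hu, hq]
    simp only [map_add, map_smul, inner_add_left, inner_add_right, Complex.add_re, inner_smul_left,
      inner_smul_right, Complex.conj_ofReal, Complex.re_ofReal_mul]
    have : m ≠ 0 := hm0.ne'
    field_simp
    ring
  have hwn : ‖w‖ ^ 2 ≤ δ ^ 2 := by gcongr
  have hun : ‖u‖ ^ 2 ≤ 2 * δ + 2 * δ * ‖φ‖ ^ 2 := by
    have n1 : ‖u‖ ≤ m⁻¹ * ‖w‖ + m * ‖φ‖ := by
      refine (norm_add_le _ _).trans ?_
      rw [norm_smul, norm_smul, Complex.norm_real, Complex.norm_real,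
        Real.norm_of_nonneg hm0.le, Real.norm_of_nonneg (inv_pos.2 hm0).le]
    have n2 : ‖u‖ ^ 2 ≤ (m⁻¹ * ‖w‖ + m * ‖φ‖) ^ 2 := pow_le_pow_left₀ (norm_nonneg _) n1 2
    have n3 : (m⁻¹ * ‖w‖) ^ 2 ≤ δ := by
      rw [mul_pow, inv_pow, hm2, inv_mul_le_iff₀ hδ]; nlinarith
    have n4 : (m * ‖φ‖) ^ 2 = δ * ‖φ‖ ^ 2 := by rw [mul_pow, hm2]
    nlinarith [sq_nonneg (m⁻¹ * ‖w‖ - m * ‖φ‖)]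
  have b1 := abs_le.1 (hC w)
  have b2 := abs_le.1 (hC u)
  have b3 := abs_le.1 (hC φ)
  have hmi : m⁻¹ ^ 2 = δ⁻¹ := by rw [inv_pow, hm2]
  rw [hmi, hm2] at h2
  have c1 : C * ‖w‖ ^ 2 ≤ C * δ ^ 2 := by gcongr
  have c2 : C * ‖u‖ ^ 2 ≤ C * (2 * δ + 2 * δ * ‖φ‖ ^ 2) := by gcongr
  have c3 : |δ⁻¹ * (inner ℂ w (A w)).re| ≤ C * δ := by
    rw [abs_mul, abs_of_pos (inv_pos.2 hδ), inv_mul_le_iff₀ hδ]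
    calc _ ≤ C * ‖w‖ ^ 2 := hC w
      _ ≤ C * δ ^ 2 := c1
      _ = _ := by ring
  have c4 : |δ * (inner ℂ φ (A φ)).re| ≤ C * δ * ‖φ‖ ^ 2 := by
    rw [abs_mul, abs_of_pos hδ]
    calc _ ≤ δ * (C * ‖φ‖ ^ 2) := by gcongr; exact hC φ
      _ = _ := by ring
  have c3' := abs_le.1 c3
  have c4' := abs_le.1 c4
  rw [h1, abs_le]
  constructor <;> nlinarith

/-- A limit of uniformly bounded quadratic forms is nonnegative if it is so on a dense set. -/
theorem quadratic_limit_nonneg {l : Filter ℝ} [l.NeBot] {A : ℝ → H →L[ℂ] H} {C : ℝ} (hc : 0 ≤ C)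
    {D : Set H} (hD : Dense D)
    (hC : ∀ᶠ s in l, ∀ φ ∈ D, |(inner ℂ φ (A s φ)).re| ≤ C * ‖φ‖ ^ 2)
    (h : ∀ φ ∈ D, ∃ p, 0 ≤ p ∧ Tendsto (fun s => (inner ℂ φ (A s φ)).re) l (𝓝 p))
    {v : H} {p : ℝ} (hv : Tendsto (fun s => (inner ℂ v (A s v)).re) l (𝓝 p)) : 0 ≤ p := by
  have hC' : ∀ᶠ s in l, ∀ w, |(inner ℂ w (A s w)).re| ≤ C * ‖w‖ ^ 2 := by
    filter_upwards [hC] with s hs w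
    refine hD.induction (P := fun w => |(inner ℂ w (A s w)).re| ≤ C * ‖w‖ ^ 2) hs ?_ w
    exact isClosed_le (by fun_prop) (by fun_prop)
  have key : ∀ δ : ℝ, 0 < δ → δ ≤ 1 → -(C * (δ * (4 + 3 * (‖v‖ + 1) ^ 2))) ≤ p := by
    intro δ hδ hδ1
    obtain ⟨φ, hφv, hφ⟩ := Metric.dense_iff.1 hD v δ hδ
    rw [Metric.mem_ball, dist_comm, dist_eq_norm] at hφv
    obtain ⟨p', hp', hlim⟩ := h φ hφ
    have h1 : ∀ᶠ s in l, (inner ℂ φ (A s φ)).re - C * (δ ^ 2 + 3 * δ + 3 * δ * ‖φ‖ ^ 2)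
        ≤ (inner ℂ v (A s v)).re := by
      filter_upwards [hC'] with s hs
      have := (abs_le.1 (abs_quadratic_sub_le hc hs hδ hφv.le)).1
      linarith
    have h2 := le_of_tendsto_of_tendsto (hlim.sub_const _) hv h1
    have h3 : ‖φ‖ ≤ ‖v‖ + 1 := by
      have := norm_le_norm_add_norm_sub v φ
      linarith
    have h4 : C * (δ ^ 2 + 3 * δ + 3 * δ * ‖φ‖ ^ 2) ≤ C * (δ * (4 + 3 * (‖v‖ + 1) ^ 2)) := by
      have h5 : ‖φ‖ ^ 2 ≤ (‖v‖ + 1) ^ 2 := by gcongr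
      have h6 : δ ^ 2 ≤ δ := by nlinarith
      refine mul_le_mul_of_nonneg_left ?_ hc
      nlinarith
    linarith
  have hlim : Tendsto (fun δ : ℝ => -(C * (δ * (4 + 3 * (‖v‖ + 1) ^ 2)))) (𝓝[>] 0) (𝓝 0) := by
    have hcont : Continuous fun δ : ℝ => -(C * (δ * (4 + 3 * (‖v‖ + 1) ^ 2))) := by fun_prop
    have := hcont.tendsto 0
    simp only [zero_mul, mul_zero, neg_zero] at this
    exact this.mono_left nhdsWithin_le_nhds
  refine le_of_tendsto hlim ?_
  filter_upwards [Ioc_mem_nhdsGT (show (0 : ℝ) < 1 by norm_num)] with δ hδ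
  exact key δ hδ.1 hδ.2

end DenseLimits

end HypWave
end

/-! ### Operators on the form domain -/

noncomputable section

namespace HypWave

open Filter Topology

section Operators

variable {d : ℕ} (V : Hyp d → ℝ) (hV : Continuous V) (hV0 : ∀ x, 0 ≤ V x)

/-- A test function as an element of `L²`. -/
def inclT : TestFn d →ₗ[ℂ] Lp ℂ 2 (vol d) :=
  inclCore V hV hV0 ∘ₗ (toCore V hV hV0).toLinearMap

/-- A test function as an element of the form domain. -/
def coreT : TestFn d →ₗ[ℂ] FormSpace V hV hV0 :=
  (UniformSpace.Completion.toComplL (𝕜 := ℂ) (E := FormCore V hV hV0)).toLinearMap ∘ₗ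
    (toCore V hV hV0).toLinearMap

theorem norm_coreT (φ : TestFn d) : ‖coreT V hV hV0 φ‖ = ‖toCore V hV hV0 φ‖ :=
  UniformSpace.Completion.norm_coe _

theorem incl_coreT (φ : TestFn d) : incl V hV hV0 (coreT V hV hV0 φ) = inclT V hV hV0 φ :=
  incl_coe V hV hV0 _

theorem denseRange_coreT : Dense (Set.range (coreT V hV hV0)) := by
  have h := UniformSpace.Completion.denseRange_coe (α := FormCore V hV hV0)
  have : Set.range (coreT V hV hV0)
      = Set.range ((↑) : FormCore V hV hV0 → FormSpace V hV hV0) := by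
    ext x
    constructor
    · rintro ⟨φ, rfl⟩; exact ⟨toCore V hV hV0 φ, rfl⟩
    · rintro ⟨φ, rfl⟩; exact ⟨(toCore V hV hV0).symm φ, rfl⟩
  rw [this]
  exact h

theorem norm_sq_coreT (φ : TestFn d) : ‖coreT V hV hV0 φ‖ ^ 2 = ∫ y, dens y *
      ((‖grd (chart φ) y‖ ^ 2 + ‖eul (chart φ) y‖ ^ 2) + (V (graph y) + 1) * ‖chart φ y‖ ^ 2) := by
  rw [norm_coreT, norm_sq_core]

theorem norm_sq_inclT (φ : TestFn d) :
    ‖inclT V hV hV0 φ‖ ^ 2 = ∫ y, dens y * ‖chart φ y‖ ^ 2 := norm_sq_inclCore φ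

theorem re_inner_inclT (φ ψ : TestFn d) : (inner ℂ (inclT V hV hV0 φ) (inclT V hV hV0 ψ)).re
      = ∫ y, dens y * (conj (chart φ y) * chart ψ y).re := re_inner_inclCore φ ψ

theorem re_inner_coreT (φ ψ : TestFn d) :
    (inner ℂ (coreT V hV hV0 φ) (coreT V hV hV0 ψ)).re = ∫ y, dens y *
      ((dirD (chart φ) (chart ψ) y).re
        + (V (graph y) + 1) * (conj (chart φ y) * chart ψ y).re) := by
  rw [← re_inner_core (hV := hV) (hV0 := hV0)]
  congr 1
  exact UniformSpace.Completion.inner_coe _ _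

/-- Extension of a form-bounded operator on test functions to the form domain. -/
def extT {F : Type*} [NormedAddCommGroup F] [NormedSpace ℂ F] [CompleteSpace F]
    (T : TestFn d →ₗ[ℂ] F) (C : ℝ) (h : ∀ φ, ‖T φ‖ ≤ C * ‖coreT V hV hV0 φ‖) :
    FormSpace V hV hV0 →L[ℂ] F :=
  ((T ∘ₗ (toCore V hV hV0).symm.toLinearMap).mkContinuous C fun φ => by
    have := h ((toCore V hV hV0).symm φ)
    rw [norm_coreT] at this
    exact this).extend (UniformSpace.Completion.toComplL (𝕜 := ℂ) (E := FormCore V hV hV0))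

variable {V hV hV0}

theorem extT_coreT {F : Type*} [NormedAddCommGroup F] [NormedSpace ℂ F] [CompleteSpace F]
    {T : TestFn d →ₗ[ℂ] F} {C : ℝ} (h : ∀ φ, ‖T φ‖ ≤ C * ‖coreT V hV hV0 φ‖) (φ : TestFn d) :
    extT V hV hV0 T C h (coreT V hV hV0 φ) = T φ :=
  ContinuousLinearMap.extend_eq _ (UniformSpace.Completion.denseRange_coe)
    (UniformSpace.Completion.isUniformInducing_coe _) (toCore V hV hV0 φ)

section TestBounds

theorem integrable_grd (φ : TestFn d) : Integrable fun y => dens y * ‖grd (chart φ) y‖ ^ 2 := by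
  have := continuous_grd_chart φ
  exact integrable_of_off (hasCompactSupport_chart φ) (by fun_prop)
    fun y hy => by simp [grd_eq_zero_off hy]

theorem integrable_eul (φ : TestFn d) : Integrable fun y => dens y * ‖eul (chart φ) y‖ ^ 2 := by
  have := continuous_eul_chart φ
  exact integrable_of_off (hasCompactSupport_chart φ) (by fun_prop)
    fun y hy => by simp [eul_eq_zero_off hy]

theorem integrable_norm_sq (φ : TestFn d) : Integrable fun y => dens y * ‖chart φ y‖ ^ 2 := by
  have := continuous_chart φ
  exact integrable_of_off (hasCompactSupport_chart φ) (by fun_prop)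
    fun y hy => by simp [chart_zero_off hy]

theorem integrable_pot (hV : Continuous V) (φ : TestFn d) :
    Integrable fun y => dens y * (V (graph y) * ‖chart φ y‖ ^ 2) := by
  have := continuous_chart φ
  exact integrable_of_off (hasCompactSupport_chart φ) (by fun_prop)
    fun y hy => by simp [chart_zero_off hy]

theorem norm_sq_coreT_eq_add (φ : TestFn d) : ‖coreT V hV hV0 φ‖ ^ 2
    = (∫ y, dens y * ‖grd (chart φ) y‖ ^ 2) + (∫ y, dens y * ‖eul (chart φ) y‖ ^ 2)
      + (∫ y, dens y * (V (graph y) * ‖chart φ y‖ ^ 2)) + ∫ y, dens y * ‖chart φ y‖ ^ 2 := by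
  have i1 : Integrable fun y => dens y * ‖grd (chart φ) y‖ ^ 2 + dens y * ‖eul (chart φ) y‖ ^ 2 :=
    (integrable_grd φ).add (integrable_eul φ)
  have i2 : Integrable fun y => dens y * ‖grd (chart φ) y‖ ^ 2 + dens y * ‖eul (chart φ) y‖ ^ 2
      + dens y * (V (graph y) * ‖chart φ y‖ ^ 2) := i1.add (integrable_pot hV φ)
  rw [norm_sq_coreT, ← integral_add (integrable_grd φ) (integrable_eul φ),
    ← integral_add i1 (integrable_pot hV φ), ← integral_add i2 (integrable_norm_sq φ)]
  refine integral_congr_ae (.of_forall fun y => ?_)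
  ring

theorem integral_dens_mul_nonneg {g : EuclideanSpace ℝ (Fin d) → ℝ} (hg : ∀ y, 0 ≤ g y) :
    0 ≤ ∫ y, dens y * g y := integral_nonneg fun y => mul_nonneg (dens_pos y).le (hg y)

theorem integral_pot_nonneg (hV0 : ∀ x, 0 ≤ V x) (φ : TestFn d) :
    0 ≤ ∫ y, dens y * (V (graph y) * ‖chart φ y‖ ^ 2) :=
  integral_dens_mul_nonneg fun _ => mul_nonneg (hV0 _) (sq_nonneg _)

theorem norm_inclT_eulT_le (φ : TestFn d) :
    ‖inclT V hV hV0 (eulT φ)‖ ≤ ‖coreT V hV hV0 φ‖ := by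
  refine abs_le_of_sq_le_sq' ?_ (norm_nonneg _) |>.2
  rw [norm_sq_inclT, norm_sq_coreT_eq_add]
  have h1 := integral_dens_mul_nonneg (g := fun y => ‖grd (chart φ) y‖ ^ 2) fun y => sq_nonneg _
  have h2 := integral_dens_mul_nonneg (g := fun y => ‖chart φ y‖ ^ 2) fun y => sq_nonneg _
  have h3 := integral_pot_nonneg hV0 φ
  simp only [eulT_chart]
  linarith

theorem two_mul_norm_sq_inclT_le (hd : 3 ≤ d) (φ : TestFn d) :
    2 * ‖inclT V hV hV0 φ‖ ^ 2 ≤ ‖coreT V hV hV0 φ‖ ^ 2 := by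
  rw [norm_sq_inclT, norm_sq_coreT_eq_add]
  have h1 := integral_dens_mul_nonneg (g := fun y => ‖grd (chart φ) y‖ ^ 2) fun y => sq_nonneg _
  have h3 := integral_pot_nonneg hV0 φ
  have h4 := integral_norm_sq_le_integral_eul hd φ
  linarith

theorem norm_inclT_le (φ : TestFn d) : ‖inclT V hV hV0 φ‖ ≤ ‖coreT V hV hV0 φ‖ := by
  refine abs_le_of_sq_le_sq' ?_ (norm_nonneg _) |>.2
  rw [norm_sq_inclT, norm_sq_coreT_eq_add]
  have h1 := integral_dens_mul_nonneg (g := fun y => ‖grd (chart φ) y‖ ^ 2) fun y => sq_nonneg _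
  have h2 := integral_dens_mul_nonneg (g := fun y => ‖eul (chart φ) y‖ ^ 2) fun y => sq_nonneg _
  have h3 := integral_pot_nonneg hV0 φ
  linarith

theorem norm_inclT_mulT_le {m : EuclideanSpace ℝ (Fin d) → ℝ} (hm : ContDiff ℝ ∞ m) {K : ℝ}
    (hK : ∀ y, |m y| ≤ K) (φ : TestFn d) :
    ‖inclT V hV hV0 (mulT m hm φ)‖ ≤ K * ‖inclT V hV hV0 φ‖ := by
  have hK0 : 0 ≤ K := (abs_nonneg _).trans (hK 0)
  refine abs_le_of_sq_le_sq' ?_ (by positivity) |>.2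
  rw [mul_pow, norm_sq_inclT, norm_sq_inclT, ← integral_const_mul]
  refine integral_mono (integrable_norm_sq _) ((integrable_norm_sq φ).const_mul _) fun y => ?_
  have h1 : ‖chart (mulT m hm φ) y‖ ≤ K * ‖chart φ y‖ := by
    rw [mulT_chart, norm_mul, Complex.norm_real]
    exact mul_le_mul_of_nonneg_right (hK y) (norm_nonneg _)
  have h2 := pow_le_pow_left₀ (norm_nonneg _) h1 2
  have := dens_pos y
  calc _ ≤ dens y * (K * ‖chart φ y‖) ^ 2 := by gcongr
    _ = _ := by ring

/-- The position vector, complexified. -/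
def cvec (y : EuclideanSpace ℝ (Fin d)) : EuclideanSpace ℂ (Fin d) :=
  WithLp.toLp 2 fun i => (y i : ℂ)

theorem norm_cvec (y : EuclideanSpace ℝ (Fin d)) : ‖cvec y‖ = ‖y‖ := by
  rw [EuclideanSpace.norm_eq, EuclideanSpace.norm_eq]
  simp [cvec]

theorem norm_le_height (y : EuclideanSpace ℝ (Fin d)) : ‖y‖ ≤ height y := by
  refine Real.le_sqrt_of_sq_le ?_
  linarith

theorem grd_mulT {F : ℝ → ℝ} (hm : ContDiff ℝ ∞ fun z : EuclideanSpace ℝ (Fin d) =>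
    F (height z)) {F' : ℝ} {y : EuclideanSpace ℝ (Fin d)} (hF : HasDerivAt F F' (height y))
    (φ : TestFn d) :
    grd (chart (mulT _ hm φ)) y = (F (height y) : ℂ) • grd (chart φ) y
      + (((F' / height y : ℝ) : ℂ) * chart φ y) • cvec y := by
  ext i
  have : inner ℝ y (EuclideanSpace.single i (1 : ℝ)) = y i := by
    simp [EuclideanSpace.inner_single_right]
  change fderiv ℝ (chart (mulT _ hm φ)) y _ = (F (height y) : ℂ) * fderiv ℝ (chart φ) y _
    + ((F' / height y : ℝ) : ℂ) * chart φ y * (y i : ℂ)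
  rw [fderiv_mulT, fderiv_comp_height y _ hF, this]
  push_cast
  ring

theorem add_sq_le_two_mul {a b : ℝ} : (a + b) ^ 2 ≤ 2 * a ^ 2 + 2 * b ^ 2 := by
  nlinarith [sq_nonneg (a - b)]

theorem norm_coreT_mulT_le {F F' : ℝ → ℝ} (hF : ∀ c, 0 < c → HasDerivAt F (F' c) c)
    (hm : ContDiff ℝ ∞ fun z : EuclideanSpace ℝ (Fin d) => F (height z)) {K K' : ℝ}
    (hK : ∀ c, 1 ≤ c → |F c| ≤ K) (hK' : ∀ c, 1 ≤ c → |F' c| * c ≤ K') (φ : TestFn d) :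
    ‖coreT V hV hV0 (mulT _ hm φ)‖ ≤ 2 * (K + K') * ‖coreT V hV hV0 φ‖ := by
  have hK0 : 0 ≤ K := (abs_nonneg _).trans (hK 1 le_rfl)
  have hK'0 : 0 ≤ K' := (mul_nonneg (abs_nonneg _) zero_le_one).trans (hK' 1 le_rfl)
  refine abs_le_of_sq_le_sq' ?_ (by positivity) |>.2
  have p1 : ∀ y, ‖grd (chart (mulT _ hm φ)) y‖ ^ 2
      ≤ 2 * K ^ 2 * ‖grd (chart φ) y‖ ^ 2 + 2 * K' ^ 2 * ‖chart φ y‖ ^ 2 := fun y => by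
    have h0 := one_le_height y
    have hp := height_pos y
    have h1 : ‖grd (chart (mulT _ hm φ)) y‖ ≤ K * ‖grd (chart φ) y‖ + K' * ‖chart φ y‖ := by
      rw [grd_mulT hm (hF _ hp)]
      refine (norm_add_le _ _).trans (add_le_add ?_ ?_)
      · rw [norm_smul, Complex.norm_real]
        exact mul_le_mul_of_nonneg_right (hK _ h0) (norm_nonneg _)
      · rw [norm_smul, norm_mul, Complex.norm_real, norm_cvec, Real.norm_eq_abs, abs_div,
          abs_of_pos hp]
        have h2 : |F' (height y)| / height y * ‖y‖ ≤ K' := by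
          refine le_trans ?_ (hK' _ h0)
          rw [div_mul_eq_mul_div, div_le_iff₀ hp]
          have h3 := norm_le_height y
          have h4 : 0 ≤ |F' (height y)| := abs_nonneg _
          nlinarith [mul_nonneg h4 (sub_nonneg.2 h3), mul_nonneg (mul_nonneg h4 hp.le) (sub_nonneg.2 h0)]
        calc _ = (|F' (height y)| / height y * ‖y‖) * ‖chart φ y‖ := by ring
          _ ≤ _ := by gcongr
    have h2 := pow_le_pow_left₀ (norm_nonneg _) h1 2
    refine h2.trans (add_sq_le_two_mul.trans (le_of_eq (by ring)))
  have p2 : ∀ y, ‖eul (chart (mulT _ hm φ)) y‖ ^ 2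
      ≤ 2 * K ^ 2 * ‖eul (chart φ) y‖ ^ 2 + 2 * K' ^ 2 * ‖chart φ y‖ ^ 2 := fun y => by
    have h0 := one_le_height y
    have hp := height_pos y
    have h1 : ‖eul (chart (mulT _ hm φ)) y‖ ≤ K * ‖eul (chart φ) y‖ + K' * ‖chart φ y‖ := by
      rw [eul_mulT, eul_comp_height y (hF _ hp)]
      refine (norm_add_le _ _).trans (add_le_add ?_ ?_)
      · rw [norm_mul, Complex.norm_real]
        exact mul_le_mul_of_nonneg_right (hK _ h0) (norm_nonneg _)
      · rw [norm_mul, Complex.norm_real, Real.norm_eq_abs, abs_div, abs_mul, abs_of_pos hp,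
          abs_of_nonneg (by nlinarith : 0 ≤ height y ^ 2 - 1)]
        have h2 : |F' (height y)| * (height y ^ 2 - 1) / height y ≤ K' := by
          refine le_trans ?_ (hK' _ h0)
          rw [div_le_iff₀ hp]
          have h4 : 0 ≤ |F' (height y)| := abs_nonneg _
          nlinarith
        gcongr
    have h2 := pow_le_pow_left₀ (norm_nonneg _) h1 2
    refine h2.trans (add_sq_le_two_mul.trans (le_of_eq (by ring)))
  have p3 : ∀ y, ‖chart (mulT _ hm φ) y‖ ^ 2 ≤ K ^ 2 * ‖chart φ y‖ ^ 2 := fun y => by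
    rw [mulT_chart, norm_mul, Complex.norm_real, mul_pow]
    gcongr
    exact hK _ (one_le_height y)
  have hcV : Continuous fun y : EuclideanSpace ℝ (Fin d) => V (graph y) := by fun_prop
  have i1 : ∀ φ : TestFn d, Integrable fun y => dens y * ((‖grd (chart φ) y‖ ^ 2
      + ‖eul (chart φ) y‖ ^ 2) + (V (graph y) + 1) * ‖chart φ y‖ ^ 2) := fun φ => by
    have c1 := continuous_grd_chart φ
    have c2 := continuous_eul_chart φ
    have c3 := continuous_chart φ
    exact integrable_of_off (hasCompactSupport_chart φ) (by fun_prop)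
      fun y hy => by simp [chart_zero_off hy, grd_eq_zero_off hy, eul_eq_zero_off hy]
  rw [mul_pow, norm_sq_coreT, norm_sq_coreT, ← integral_const_mul]
  refine integral_mono (i1 _) ((i1 φ).const_mul _) fun y => ?_
  have hv := hV0 (graph y)
  have hd := dens_pos y
  have q1 := p1 y
  have q2 := p2 y
  have q3 : (V (graph y) + 1) * ‖chart (mulT _ hm φ) y‖ ^ 2
      ≤ (V (graph y) + 1) * (K ^ 2 * ‖chart φ y‖ ^ 2) := by gcongr; exact p3 y
  have q4 : K' ^ 2 * ‖chart φ y‖ ^ 2 ≤ K' ^ 2 * ((V (graph y) + 1) * ‖chart φ y‖ ^ 2) := by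
    gcongr
    exact le_mul_of_one_le_left (sq_nonneg _) (by linarith)
  have n1 := sq_nonneg ‖grd (chart φ) y‖
  have n2 := sq_nonneg ‖eul (chart φ) y‖
  have n3 : 0 ≤ (V (graph y) + 1) * ‖chart φ y‖ ^ 2 := by positivity
  set a := ‖grd (chart φ) y‖ ^ 2
  set b := ‖eul (chart φ) y‖ ^ 2
  set e := (V (graph y) + 1) * ‖chart φ y‖ ^ 2 with he
  have e1 : (V (graph y) + 1) * (K ^ 2 * ‖chart φ y‖ ^ 2) = K ^ 2 * e := by rw [he]; ring
  have hs : ‖grd (chart (mulT _ hm φ)) y‖ ^ 2 + ‖eul (chart (mulT _ hm φ)) y‖ ^ 2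
      + (V (graph y) + 1) * ‖chart (mulT _ hm φ) y‖ ^ 2 ≤ (2 * (K + K')) ^ 2 * (a + b + e) := by
    have hKK := mul_nonneg hK0 hK'0
    have t1 : 0 ≤ K ^ 2 * a := by positivity
    have t2 : 0 ≤ K ^ 2 * b := by positivity
    have t3 : 0 ≤ K ^ 2 * e := by positivity
    have t4 : 0 ≤ K' ^ 2 * (a + b) := by positivity
    have t5 : 0 ≤ K * K' * (a + b + e) := by positivity
    nlinarith
  calc _ ≤ dens y * ((2 * (K + K')) ^ 2 * (a + b + e)) := by gcongr
    _ = _ := by ring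

theorem norm_coreT_dilT_le {M : ℝ} (hM : ∀ x, V x ≤ M) (s : ℝ) (φ : TestFn d) :
    ‖coreT V hV hV0 (dilT s φ)‖ ≤
      √((Real.exp s ^ 2 + 1 + (M + 1)) * Real.exp ((d + 1) * |s|)) * ‖coreT V hV hV0 φ‖ := by
  have hM0 : 0 ≤ M := (hV0 (origin d)).trans (hM _)
  refine abs_le_of_sq_le_sq' ?_ (by positivity) |>.2
  rw [mul_pow, Real.sq_sqrt (by positivity), norm_sq_coreT_eq_add, norm_sq_coreT_eq_add]
  have c1 := continuous_grd_chart φ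
  have c2 := continuous_eul_chart φ
  have c3 := continuous_chart φ
  have g1 := integral_dens_norm_sq_comp_le c1
    ((hasCompactSupport_chart φ).mono' fun y hy => by_contra fun h => hy (grd_eq_zero_off h)) s
  have g2 := integral_dens_norm_sq_comp_le c2
    ((hasCompactSupport_chart φ).mono' fun y hy => by_contra fun h => hy (eul_eq_zero_off h)) s
  have g3 := integral_dens_norm_sq_comp_le c3 (hasCompactSupport_chart φ) s
  have e1 : ∫ y, dens y * ‖grd (chart (dilT s φ)) y‖ ^ 2
      = Real.exp s ^ 2 * ∫ y, dens y * ‖grd (chart φ) (Real.exp s • y)‖ ^ 2 := by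
    rw [← integral_const_mul]
    refine integral_congr_ae (.of_forall fun y => ?_)
    simp only [grd_dilT, norm_smul, Complex.norm_real, Real.norm_eq_abs, Real.abs_exp]
    ring
  have e4 : ∫ y, dens y * (V (graph y) * ‖chart (dilT s φ) y‖ ^ 2)
      ≤ M * ∫ y, dens y * ‖chart (dilT s φ) y‖ ^ 2 := by
    rw [← integral_const_mul]
    refine integral_mono (integrable_pot hV _) ((integrable_norm_sq _).const_mul _) fun y => ?_
    have := mul_le_mul_of_nonneg_right (hM (graph y))
      (mul_nonneg (dens_pos y).le (sq_nonneg ‖chart (dilT s φ) y‖))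
    linarith
  have n1 := integral_dens_mul_nonneg (g := fun y => ‖grd (chart φ) y‖ ^ 2) fun y => sq_nonneg _
  have n2 := integral_dens_mul_nonneg (g := fun y => ‖eul (chart φ) y‖ ^ 2) fun y => sq_nonneg _
  have n3 := integral_dens_mul_nonneg (g := fun y => ‖chart φ y‖ ^ 2) fun y => sq_nonneg _
  have n4 := integral_pot_nonneg hV0 φ
  rw [e1]
  simp only [eul_dilT, dilT_chart] at e4 ⊢
  set E := Real.exp ((d + 1) * |s|)
  have hE : 0 ≤ E := (Real.exp_pos _).le
  set X := Real.exp s ^ 2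
  have hX : 0 ≤ X := sq_nonneg _
  set a := ∫ y, dens y * ‖grd (chart φ) y‖ ^ 2
  set b := ∫ y, dens y * ‖eul (chart φ) y‖ ^ 2
  set e := ∫ y, dens y * ‖chart φ y‖ ^ 2
  set p := ∫ y, dens y * (V (graph y) * ‖chart φ y‖ ^ 2)
  have t1 := mul_le_mul_of_nonneg_left g1 hX
  have t3 := mul_le_mul_of_nonneg_left g3 hM0
  have u1 := mul_nonneg hE n1
  have u2 := mul_nonneg hE n2
  have u3 := mul_nonneg hE n3
  have u4 := mul_nonneg hE n4
  nlinarith [mul_nonneg hX u2, mul_nonneg hX u3, mul_nonneg hX u4, mul_nonneg hM0 u1,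
    mul_nonneg hM0 u2, mul_nonneg hM0 u4]

end TestBounds

end Operators

end HypWave
end

/-! ### The regularized multiplier -/

noncomputable section

namespace HypWave

open Filter Topology

section Regularized

variable {d : ℕ}

/-- The symmetric dilation quotient of a test function. -/
def dilQT (s : ℝ) : TestFn d →ₗ[ℂ] TestFn d :=
  (((2 * s)⁻¹ : ℝ) : ℂ) • (dilT s - dilT (-s))

theorem dilQT_chart (s : ℝ) (φ : TestFn d) (y : EuclideanSpace ℝ (Fin d)) :
    chart (dilQT s φ) y = dilQ s (chart φ) y := rfl

theorem fderiv_dilQT (s : ℝ) (φ : TestFn d) (y v : EuclideanSpace ℝ (Fin d)) :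
    fderiv ℝ (chart (dilQT s φ)) y v = (((2 * s)⁻¹ : ℝ) : ℂ) *
      (fderiv ℝ (chart (dilT s φ)) y v - fderiv ℝ (chart (dilT (-s) φ)) y v) := by
  change fderiv ℝ ((((2 * s)⁻¹ : ℝ) : ℂ) • (chart (dilT s φ) - chart (dilT (-s) φ))) y v = _
  rw [fderiv_const_smul ((differentiableAt_chart _ _).sub (differentiableAt_chart _ _)),
    fderiv_sub (differentiableAt_chart _ _) (differentiableAt_chart _ _)]
  rfl

theorem eul_dilQT (s : ℝ) (φ : TestFn d) (y : EuclideanSpace ℝ (Fin d)) :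
    eul (chart (dilQT s φ)) y = (((2 * s)⁻¹ : ℝ) : ℂ) *
      (eul (chart φ) (Real.exp s • y) - eul (chart φ) (Real.exp (-s) • y)) := by
  have := fderiv_dilQT s φ y y
  rw [← eul_dilT, ← eul_dilT]
  exact this

theorem grd_dilQT (s : ℝ) (φ : TestFn d) (y : EuclideanSpace ℝ (Fin d)) :
    grd (chart (dilQT s φ)) y = (((2 * s)⁻¹ : ℝ) : ℂ) •
      ((Real.exp s : ℂ) • grd (chart φ) (Real.exp s • y)
        - (Real.exp (-s) : ℂ) • grd (chart φ) (Real.exp (-s) • y)) := by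
  rw [← grd_dilT, ← grd_dilT]
  ext i
  exact fderiv_dilQT s φ y _

/-- The multiplier with the Euler derivative replaced by the dilation quotient. -/
def quotT (d : ℕ) (ε s : ℝ) : TestFn d →ₗ[ℂ] TestFn d :=
  mulT _ contDiff_mulA ∘ₗ dilQT s + mulT _ (contDiff_mulB ε)

variable {V : Hyp d → ℝ} {hV : Continuous V} {hV0 : ∀ x, 0 ≤ V x}

theorem re_inner_coreT_sub (φ ψ : TestFn d) :
    (inner ℂ (coreT V hV hV0 φ) (coreT V hV hV0 ψ)).re
      - (inner ℂ (inclT V hV hV0 φ) (inclT V hV hV0 ψ)).re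
      = ∫ y, dens y * ((dirD (chart φ) (chart ψ) y).re
        + V (graph y) * (conj (chart φ y) * chart ψ y).re) := by
  have c1 : Continuous fun y => (dirD (chart φ) (chart ψ) y).re :=
    Complex.continuous_re.comp (continuous_dirD φ ψ)
  have c2 := continuous_chart φ
  have c3 := continuous_chart ψ
  rw [re_inner_coreT, re_inner_inclT, ← integral_sub]
  · refine integral_congr_ae (.of_forall fun y => ?_)
    ring
  · exact integrable_of_off (hasCompactSupport_chart φ) (by fun_prop) fun y hy => by
      simp [dirD, chart_zero_off hy, eul_eq_zero_off hy, grd_eq_zero_off hy]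
  · exact integrable_of_off (hasCompactSupport_chart φ) (by fun_prop) fun y hy => by
      simp [chart_zero_off hy]

/-- The Dirichlet form against a radial multiple. -/
theorem re_dirD_mulT {F F' : ℝ → ℝ} (hF : ∀ c, 0 < c → HasDerivAt F (F' c) c)
    (hm : ContDiff ℝ ∞ fun z : EuclideanSpace ℝ (Fin d) => F (height z)) (φ ψ : TestFn d)
    (y : EuclideanSpace ℝ (Fin d)) :
    (dirD (chart φ) (chart (mulT _ hm ψ)) y).re = F (height y) * (dirD (chart φ) (chart ψ) y).re
      + height y * F' (height y) * (conj (eul (chart φ) y) * chart ψ y).re := by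
  have hp := (height_pos y).ne'
  have h := hF _ (height_pos y)
  have e : dirD (chart φ) (chart (mulT _ hm ψ)) y = (F (height y) : ℂ) * dirD (chart φ) (chart ψ) y
      + ((height y * F' (height y) : ℝ) : ℂ) * (conj (eul (chart φ) y) * chart ψ y) := by
    have e1 : height y * F' (height y)
        = F' (height y) / height y + F' (height y) * (height y ^ 2 - 1) / height y := by
      field_simp
      ring
    rw [dirD, inner_grd_mulT hm h, eul_mulT, eul_comp_height y h, dirD, e1]
    push_cast
    ring
  rw [e, Complex.add_re, Complex.re_ofReal_mul, Complex.re_ofReal_mul]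

theorem re_form_mulB (ε : ℝ) (φ : TestFn d) :
    (inner ℂ (coreT V hV hV0 φ) (coreT V hV hV0 (mulT _ (contDiff_mulB ε) φ))).re
      - (inner ℂ (inclT V hV hV0 φ) (inclT V hV hV0 (mulT _ (contDiff_mulB ε) φ))).re
      = ∫ y, dens y * (mulB d ε (height y) * (‖grd (chart φ) y‖ ^ 2 + ‖eul (chart φ) y‖ ^ 2)
        + height y * mulB' d ε (height y) * (conj (eul (chart φ) y) * chart φ y).re
        + V (graph y) * (mulB d ε (height y) * ‖chart φ y‖ ^ 2)) := by
  rw [re_inner_coreT_sub]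
  refine integral_congr_ae (.of_forall fun y => ?_)
  simp only
  rw [re_dirD_mulT (fun c => hasDerivAt_mulB ε), re_dirD_self, mulT_chart, mul_left_comm,
    Complex.re_ofReal_mul, re_conj_mul_self]

/-- The function that is paired with the dilation quotient. -/
def pairT (V : Hyp d → ℝ) (φ : TestFn d) (y : EuclideanSpace ℝ (Fin d)) : ℂ :=
  (dens y : ℂ) * (((mulA (height y) * wt y : ℝ) : ℂ) * eul (chart φ) y
    + ((V (graph y) * mulA (height y) : ℝ) : ℂ) * chart φ y)

theorem continuous_pairT (hV : Continuous V) (φ : TestFn d) : Continuous (pairT V φ) := by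
  have c1 := continuous_eul_chart φ
  have c2 := continuous_chart φ
  unfold pairT
  fun_prop

theorem pairT_zero_off {φ : TestFn d} {y : EuclideanSpace ℝ (Fin d)} (hy : y ∉ tsupport (chart φ)) :
    pairT V φ y = 0 := by
  simp [pairT, chart_zero_off hy, eul_eq_zero_off hy]

theorem dens_mul_mulA (y : EuclideanSpace ℝ (Fin d)) : dens y * mulA (height y) = wt y := by
  have := (height_pos y).ne'
  have := (one_add_height_pos y).ne'
  unfold dens mulA wt
  field_simp

theorem re_form_dilQT (s : ℝ) (φ : TestFn d) :
    (inner ℂ (coreT V hV hV0 φ) (coreT V hV hV0 (mulT _ contDiff_mulA (dilQT s φ)))).re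
      - (inner ℂ (inclT V hV hV0 φ) (inclT V hV hV0 (mulT _ contDiff_mulA (dilQT s φ)))).re
      = (2 * s)⁻¹ * (∫ y, dilKer d 1 s y *
          (inner ℂ (grd (chart φ) y) (grd (chart φ) (Real.exp s • y))).re)
        + (2 * s)⁻¹ * (∫ y, dilKer d 0 s y *
          (inner ℂ (eul (chart φ) y) (eul (chart φ) (Real.exp s • y))).re)
        + ∫ y, (conj (pairT V φ y) * dilQ s (chart φ) y).re := by
  have c0 := continuous_chart φ
  have c1 := continuous_eul_chart φ
  have c2 := continuous_grd_chart φ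
  have c3 := continuous_pairT hV φ
  have hs := hasCompactSupport_chart φ
  have he : HasCompactSupport (eul (chart φ)) :=
    HasCompactSupport.intro hs.isCompact fun _ hy => eul_eq_zero_off hy
  have hg : HasCompactSupport (grd (chart φ)) :=
    HasCompactSupport.intro hs.isCompact fun _ hy => grd_eq_zero_off hy
  have ig : ∀ l t : ℝ, Integrable fun y => wt y * (Real.exp (l * t) *
      (inner ℂ (grd (chart φ) y) (grd (chart φ) (Real.exp t • y))).re) := fun l t =>
    integrable_of_off hs (by fun_prop) fun y hy => by simp [grd_eq_zero_off hy]
  have ie : ∀ l t : ℝ, Integrable fun y => wt y * (Real.exp (l * t) *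
      (inner ℂ (eul (chart φ) y) (eul (chart φ) (Real.exp t • y))).re) := fun l t =>
    integrable_of_off hs (by fun_prop) fun y hy => by simp [eul_eq_zero_off hy]
  have ip : Integrable fun y => (conj (pairT V φ y) * dilQ s (chart φ) y).re :=
    integrable_of_off hs (by fun_prop) fun y hy => by simp [pairT_zero_off hy]
  have j1 : Integrable fun y => (2 * s)⁻¹ * (wt y * (Real.exp (1 * s) *
      (inner ℂ (grd (chart φ) y) (grd (chart φ) (Real.exp s • y))).re) - wt y * (Real.exp (1 * -s) *
      (inner ℂ (grd (chart φ) y) (grd (chart φ) (Real.exp (-s) • y))).re)) :=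
    ((ig 1 s).sub (ig 1 (-s))).const_mul _
  have j2 : Integrable fun y => (2 * s)⁻¹ * (wt y * (Real.exp (0 * s) *
      (inner ℂ (eul (chart φ) y) (eul (chart φ) (Real.exp s • y))).re) - wt y * (Real.exp (0 * -s) *
      (inner ℂ (eul (chart φ) y) (eul (chart φ) (Real.exp (-s) • y))).re)) :=
    ((ie 0 s).sub (ie 0 (-s))).const_mul _
  rw [re_inner_coreT_sub, ← integral_pair_sub c2 hg, ← integral_pair_sub c1 he,
    ← integral_sub (ig 1 s) (ig 1 (-s)), ← integral_sub (ie 0 s) (ie 0 (-s)),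
    ← integral_const_mul, ← integral_const_mul, ← integral_add j1 j2]
  refine Eq.trans ?_ (integral_add (j1.add j2) ip)
  refine integral_congr_ae (.of_forall fun y => ?_)
  have hw := dens_mul_mulA y
  simp only
  rw [re_dirD_mulT (fun c => hasDerivAt_mulA), mulT_chart, mul_left_comm, Complex.re_ofReal_mul,
    dilQT_chart]
  have e1 : (dirD (chart φ) (chart (dilQT s φ)) y).re = (2 * s)⁻¹ *
      (Real.exp s * (inner ℂ (grd (chart φ) y) (grd (chart φ) (Real.exp s • y))).re
        - Real.exp (-s) * (inner ℂ (grd (chart φ) y) (grd (chart φ) (Real.exp (-s) • y))).re)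
      + (2 * s)⁻¹ * ((inner ℂ (eul (chart φ) y) (eul (chart φ) (Real.exp s • y))).re
        - (inner ℂ (eul (chart φ) y) (eul (chart φ) (Real.exp (-s) • y))).re) := by
    rw [dirD, grd_dilQT, eul_dilQT, inner_smul_right, inner_sub_right, inner_smul_right,
      inner_smul_right, Complex.add_re, Complex.re_ofReal_mul, Complex.sub_re,
      Complex.re_ofReal_mul, Complex.re_ofReal_mul, mul_left_comm, Complex.re_ofReal_mul]
    simp only [RCLike.inner_apply', mul_sub, Complex.sub_re]
  have e2 : (conj (pairT V φ y) * dilQ s (chart φ) y).re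
      = dens y * (mulA (height y) * wt y * (conj (eul (chart φ) y) * dilQ s (chart φ) y).re
        + V (graph y) * mulA (height y) * (conj (chart φ y) * dilQ s (chart φ) y).re) := by
    rw [← Complex.re_ofReal_mul, ← Complex.re_ofReal_mul, ← Complex.add_re, ← Complex.re_ofReal_mul]
    simp only [pairT, map_mul, map_add, Complex.conj_ofReal]
    congr 1
    ring
  rw [e1, e2, one_mul, one_mul, zero_mul, zero_mul, Real.exp_zero]
  have e3 : height y * (1 / (1 + height y) ^ 2) = mulA (height y) * wt y := by
    unfold mulA wt
    have := (one_add_height_pos y).ne'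
    field_simp
  rw [e3]
  linear_combination ((2 * s)⁻¹ *
      (Real.exp s * (inner ℂ (grd (chart φ) y) (grd (chart φ) (Real.exp s • y))).re
        - Real.exp (-s) * (inner ℂ (grd (chart φ) y) (grd (chart φ) (Real.exp (-s) • y))).re)
      + (2 * s)⁻¹ * ((inner ℂ (eul (chart φ) y) (eul (chart φ) (Real.exp s • y))).re
        - (inner ℂ (eul (chart φ) y) (eul (chart φ) (Real.exp (-s) • y))).re)) * hw

end Regularized

end HypWave
end

/-! ### Bounds and limits for the regularized multiplier -/

noncomputable section

namespace HypWave

open Filter Topology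

section Regularized

variable {d : ℕ}

theorem abs_mulA_le {c : ℝ} (hc : 1 ≤ c) : |mulA c| ≤ 1 := by
  have : 0 < 1 + c := by linarith
  rw [mulA, abs_of_nonneg (by positivity), div_le_one this]
  linarith

theorem abs_deriv_mulA_mul_le {c : ℝ} (hc : 1 ≤ c) : |1 / (1 + c) ^ 2| * c ≤ 1 := by
  have : 0 < 1 + c := by linarith
  rw [abs_of_nonneg (by positivity), div_mul_eq_mul_div, div_le_one (by positivity)]
  nlinarith

theorem abs_mulB_le (hd : 3 ≤ d) {ε : ℝ} (hε0 : 0 ≤ ε) (hε1 : ε ≤ 1) {c : ℝ} (hc : 1 ≤ c) :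
    |mulB d ε c| ≤ d := by
  have hd' : (3 : ℝ) ≤ d := by exact_mod_cast hd
  have h1 : (1 + c)⁻¹ ≤ 1 := inv_le_one_of_one_le₀ (by linarith)
  have h0 : 0 < (1 + c)⁻¹ := inv_pos.2 (by linarith)
  set w := (1 + c)⁻¹ with hw
  have h2 : w ^ 2 ≤ 1 := pow_le_one₀ h0.le h1
  have h3 : 0 ≤ ε * w ^ 2 := by positivity
  have h4 : ε * w ^ 2 ≤ 1 := by nlinarith [sq_nonneg w]
  rw [mulB, ← hw, abs_le]
  constructor <;> nlinarith

theorem abs_mulB'_mul_le (hd : 3 ≤ d) {ε : ℝ} (hε0 : 0 ≤ ε) (hε1 : ε ≤ 1) {c : ℝ} (hc : 1 ≤ c) :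
    |mulB' d ε c| * c ≤ d := by
  have hd' : (3 : ℝ) ≤ d := by exact_mod_cast hd
  have hp : 0 < 1 + c := by linarith
  have h0 : 0 ≤ mulB' d ε c :=
    add_nonneg (div_nonneg (by linarith) (by positivity)) (by positivity)
  have e : mulB' d ε c * c = (d - 2) / 2 * (c / (1 + c) ^ 2) + 2 * ε * (c / (1 + c) ^ 3) := by
    rw [mulB']
    field_simp
  have h1 : c / (1 + c) ^ 2 ≤ 1 := (div_le_one (by positivity)).2 (by nlinarith)
  have h2 : c / (1 + c) ^ 3 ≤ 1 := (div_le_one (by positivity)).2 (by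
    nlinarith [sq_nonneg (1 + c), pow_pos hp 2])
  have h3 : 0 ≤ c / (1 + c) ^ 3 := by positivity
  rw [abs_of_nonneg h0, e]
  nlinarith

variable {V : Hyp d → ℝ} {hV : Continuous V} {hV0 : ∀ x, 0 ≤ V x}

theorem norm_inclT_dilQT_le {s : ℝ} (hs0 : 0 < s) (hs1 : s ≤ 1) (φ : TestFn d) :
    ‖inclT V hV hV0 (dilQT s φ)‖ ≤ √(Real.exp (d + 1)) * ‖coreT V hV hV0 φ‖ := by
  have h : ‖inclT V hV hV0 (dilQT s φ)‖ ≤ √(Real.exp (d + 1)) * ‖inclT V hV hV0 (eulT φ)‖ := by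
    refine abs_le_of_sq_le_sq' ?_ (by positivity) |>.2
    rw [mul_pow, Real.sq_sqrt (Real.exp_pos _).le, norm_sq_inclT, norm_sq_inclT]
    exact integral_norm_dilQ_sq_le (contDiff_one_chart φ) (hasCompactSupport_chart φ) hs0 hs1
  refine h.trans ?_
  gcongr
  exact norm_inclT_eulT_le φ

theorem norm_inclT_mulB_le (hd : 3 ≤ d) {ε : ℝ} (hε0 : 0 ≤ ε) (hε1 : ε ≤ 1) (φ : TestFn d) :
    ‖inclT V hV hV0 (mulT _ (contDiff_mulB ε) φ)‖ ≤ d * ‖coreT V hV hV0 φ‖ := by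
  refine (norm_inclT_mulT_le _ (K := d)
    (fun y => abs_mulB_le hd hε0 hε1 (one_le_height y)) φ).trans ?_
  gcongr
  exact norm_inclT_le φ

theorem norm_inclT_mulA_le (φ : TestFn d) :
    ‖inclT V hV hV0 (mulT _ contDiff_mulA φ)‖ ≤ ‖inclT V hV hV0 φ‖ := by
  have := norm_inclT_mulT_le (hV := hV) (hV0 := hV0) contDiff_mulA (K := 1)
    (fun y => abs_mulA_le (one_le_height y)) φ
  rwa [one_mul] at this

theorem norm_inclT_quotT_le (hd : 3 ≤ d) {ε : ℝ} (hε0 : 0 ≤ ε) (hε1 : ε ≤ 1) {s : ℝ} (hs0 : 0 < s)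
    (hs1 : s ≤ 1) (φ : TestFn d) :
    ‖inclT V hV hV0 (quotT d ε s φ)‖ ≤ (√(Real.exp (d + 1)) + d) * ‖coreT V hV hV0 φ‖ := by
  rw [quotT, LinearMap.add_apply, map_add, add_mul]
  refine (norm_add_le _ _).trans (add_le_add ?_ (norm_inclT_mulB_le hd hε0 hε1 φ))
  exact (norm_inclT_mulA_le _).trans (norm_inclT_dilQT_le hs0 hs1 φ)

theorem norm_inclT_multT_le (hd : 3 ≤ d) {ε : ℝ} (hε0 : 0 ≤ ε) (hε1 : ε ≤ 1) (φ : TestFn d) :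
    ‖inclT V hV hV0 (multT d ε φ)‖ ≤ (1 + d) * ‖coreT V hV hV0 φ‖ := by
  rw [multT, LinearMap.add_apply, map_add, add_mul, one_mul]
  refine (norm_add_le _ _).trans (add_le_add ?_ (norm_inclT_mulB_le hd hε0 hε1 φ))
  exact (norm_inclT_mulA_le _).trans (norm_inclT_eulT_le φ)

theorem norm_coreT_mulB_le (hd : 3 ≤ d) {ε : ℝ} (hε0 : 0 ≤ ε) (hε1 : ε ≤ 1) (φ : TestFn d) :
    ‖coreT V hV hV0 (mulT _ (contDiff_mulB ε) φ)‖ ≤ 2 * (d + d) * ‖coreT V hV hV0 φ‖ :=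
  norm_coreT_mulT_le (fun _ => hasDerivAt_mulB ε) (contDiff_mulB ε)
    (fun _ => abs_mulB_le hd hε0 hε1) (fun _ => abs_mulB'_mul_le hd hε0 hε1) φ

theorem exists_norm_coreT_quotT_le (hd : 3 ≤ d) {ε : ℝ} (hε0 : 0 ≤ ε) (hε1 : ε ≤ 1) {M : ℝ}
    (hM : ∀ x, V x ≤ M) (s : ℝ) :
    ∃ C, ∀ φ, ‖coreT V hV hV0 (quotT d ε s φ)‖ ≤ C * ‖coreT V hV hV0 φ‖ := by
  obtain ⟨C₁, h₁⟩ : ∃ C, ∀ φ, ‖coreT V hV hV0 (dilT s φ)‖ ≤ C * ‖coreT V hV hV0 φ‖ :=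
    ⟨_, norm_coreT_dilT_le hM s⟩
  obtain ⟨C₂, h₂⟩ : ∃ C, ∀ φ, ‖coreT V hV hV0 (dilT (-s) φ)‖ ≤ C * ‖coreT V hV hV0 φ‖ :=
    ⟨_, norm_coreT_dilT_le hM (-s)⟩
  refine ⟨2 * (1 + 1) * (|(2 * s)⁻¹| * (C₁ + C₂)) + 2 * (d + d), fun φ => ?_⟩
  rw [quotT, LinearMap.add_apply, map_add, add_mul]
  refine (norm_add_le _ _).trans (add_le_add ?_ (norm_coreT_mulB_le hd hε0 hε1 φ))
  refine (norm_coreT_mulT_le (fun _ => hasDerivAt_mulA) contDiff_mulA (fun _ => abs_mulA_le)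
    (fun _ => abs_deriv_mulA_mul_le) (dilQT s φ)).trans
    (le_of_le_of_eq (mul_le_mul_of_nonneg_left ?_ (by norm_num)) (mul_assoc _ _ _).symm)
  have e : dilQT s φ = (((2 * s)⁻¹ : ℝ) : ℂ) • (dilT s φ - dilT (-s) φ) := rfl
  rw [e, map_smul, map_sub, norm_smul, Complex.norm_real, Real.norm_eq_abs, mul_assoc, add_mul]
  gcongr
  exact (norm_sub_le _ _).trans (add_le_add (h₁ φ) (h₂ φ))

theorem tendsto_inclT_quotT (ε : ℝ) (φ : TestFn d) :
    Tendsto (fun s => inclT V hV hV0 (quotT d ε s φ)) (𝓝[>] 0)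
      (𝓝 (inclT V hV hV0 (multT d ε φ))) := by
  rw [tendsto_iff_norm_sub_tendsto_zero]
  have h1 := (tendsto_integral_norm_dilQ_sub (contDiff_one_chart φ)
    (hasCompactSupport_chart φ)).sqrt
  rw [Real.sqrt_zero] at h1
  refine squeeze_zero (fun s => norm_nonneg _) (fun s => ?_) h1
  have e : inclT V hV hV0 (quotT d ε s φ) - inclT V hV hV0 (multT d ε φ)
      = inclT V hV hV0 (mulT _ contDiff_mulA (dilQT s φ - eulT φ)) := by
    simp only [quotT, multT, LinearMap.add_apply, LinearMap.comp_apply, map_add, map_sub]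
    abel
  rw [e]
  refine (norm_inclT_mulA_le _).trans (Real.le_sqrt_of_sq_le ?_)
  rw [norm_sq_inclT]
  rfl

theorem abs_integral_conj_pairT_le (hV : Continuous V) (hV0 : ∀ x, 0 ≤ V x) {M : ℝ}
    (hM : ∀ x, V x ≤ M) {s : ℝ} (hs0 : 0 < s) (hs1 : s ≤ 1) (φ : TestFn d) :
    |∫ y, (conj (pairT V φ y) * dilQ s (chart φ) y).re|
      ≤ (2 + 2 * M ^ 2 + Real.exp (d + 1)) * ‖coreT V hV hV0 φ‖ ^ 2 := by
  have c0 := continuous_chart φ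
  have c1 := continuous_eul_chart φ
  have hs := hasCompactSupport_chart φ
  have hM0 : 0 ≤ M := (hV0 (origin d)).trans (hM _)
  have hQ := integral_norm_dilQ_sq_le (contDiff_one_chart φ) hs hs0 hs1
  have iQ : Integrable fun y => dens y * ‖dilQ s (chart φ) y‖ ^ 2 := integrable_norm_sq (dilQT s φ)
  have i1 := integrable_eul φ
  have i2 := integrable_norm_sq φ
  have hpt : ∀ y, ‖(conj (pairT V φ y) * dilQ s (chart φ) y).re‖
      ≤ 2 * (dens y * ‖eul (chart φ) y‖ ^ 2) + 2 * M ^ 2 * (dens y * ‖chart φ y‖ ^ 2)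
        + dens y * ‖dilQ s (chart φ) y‖ ^ 2 := fun y => by
    refine (abs_re_conj_mul_le _ _).trans ?_
    have hd := dens_pos y
    have ha := abs_mulA_le (one_le_height y)
    have hw : |wt y| ≤ 1 := by
      rw [abs_of_pos (wt_pos y)]
      exact (wt_le_dens y).trans (dens_le_one y)
    have h1 : ‖pairT V φ y‖ ≤ dens y * (‖eul (chart φ) y‖ + M * ‖chart φ y‖) := by
      rw [pairT, norm_mul, Complex.norm_real, Real.norm_of_nonneg hd.le]
      gcongr
      refine (norm_add_le _ _).trans (add_le_add ?_ ?_)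
      · rw [norm_mul, Complex.norm_real, Real.norm_eq_abs, abs_mul]
        refine mul_le_of_le_one_left (norm_nonneg _) ?_
        exact mul_le_one₀ ha (abs_nonneg _) hw
      · rw [norm_mul, Complex.norm_real, Real.norm_eq_abs, abs_mul, abs_of_nonneg (hV0 _)]
        gcongr
        calc V (graph y) * |mulA (height y)| ≤ M * 1 :=
              mul_le_mul (hM _) ha (abs_nonneg _) hM0
          _ = M := mul_one M
    set a := ‖eul (chart φ) y‖
    set b := M * ‖chart φ y‖ with hb
    set q := ‖dilQ s (chart φ) y‖ with hq
    have hb2 : M ^ 2 * ‖chart φ y‖ ^ 2 = b ^ 2 := by rw [hb]; ring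
    calc _ ≤ dens y * (a + b) * q := by gcongr
      _ = dens y * ((a + b) * q) := by ring
      _ ≤ dens y * (2 * a ^ 2 + 2 * b ^ 2 + q ^ 2) := by
          gcongr
          nlinarith [sq_nonneg (a + b - q), sq_nonneg (a - b), sq_nonneg (a + b), sq_nonneg q]
      _ = _ := by rw [← hb2]; ring
  have j1 : Integrable fun y => 2 * (dens y * ‖eul (chart φ) y‖ ^ 2)
      + 2 * M ^ 2 * (dens y * ‖chart φ y‖ ^ 2) := (i1.const_mul _).add (i2.const_mul _)
  have h := norm_integral_le_of_norm_le (j1.add iQ) (.of_forall hpt)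
  have e := integral_add j1 iQ
  simp only [Pi.add_apply] at h
  rw [e, integral_add (i1.const_mul _) (i2.const_mul _), integral_const_mul,
    integral_const_mul] at h
  have hn := norm_sq_coreT_eq_add (hV := hV) (hV0 := hV0) φ
  have n1 := integral_dens_mul_nonneg (g := fun y => ‖grd (chart φ) y‖ ^ 2) fun y => sq_nonneg _
  have n2 := integral_dens_mul_nonneg (g := fun y => ‖eul (chart φ) y‖ ^ 2) fun y => sq_nonneg _
  have n3 := integral_dens_mul_nonneg (g := fun y => ‖chart φ y‖ ^ 2) fun y => sq_nonneg _
  have n4 := integral_pot_nonneg hV0 φ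
  have b1 : ∫ y, dens y * ‖eul (chart φ) y‖ ^ 2 ≤ ‖coreT V hV hV0 φ‖ ^ 2 := by linarith
  have b2 : ∫ y, dens y * ‖chart φ y‖ ^ 2 ≤ ‖coreT V hV hV0 φ‖ ^ 2 := by linarith
  have b3 := mul_le_mul_of_nonneg_left b2 (by positivity : 0 ≤ 2 * M ^ 2)
  have b4 := mul_le_mul_of_nonneg_left b1 (Real.exp_pos ((d : ℝ) + 1)).le
  rw [Real.norm_eq_abs] at h
  linarith

/-- The form of the regularized multiplier is bounded uniformly in the step. -/
theorem abs_re_form_quotT_le (hd : 3 ≤ d) {ε : ℝ} (hε0 : 0 ≤ ε) (hε1 : ε ≤ 1) {M : ℝ}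
    (hM : ∀ x, V x ≤ M) {s : ℝ} (hs0 : 0 < s) (hs1 : s ≤ 1) (φ : TestFn d) :
    |(inner ℂ (coreT V hV hV0 φ) (coreT V hV hV0 (quotT d ε s φ))).re
      - (inner ℂ (inclT V hV hV0 φ) (inclT V hV hV0 (quotT d ε s φ))).re|
      ≤ (d * Real.exp d * (1 + Real.exp (d + 1)) + (2 + 2 * M ^ 2 + Real.exp (d + 1)) + 5 * d)
        * ‖coreT V hV hV0 φ‖ ^ 2 := by
  have hd' : (3 : ℝ) ≤ d := by exact_mod_cast hd
  have hs := hasCompactSupport_chart φ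
  have he : HasCompactSupport (eul (chart φ)) :=
    HasCompactSupport.intro hs.isCompact fun _ hy => eul_eq_zero_off hy
  have hg : HasCompactSupport (grd (chart φ)) :=
    HasCompactSupport.intro hs.isCompact fun _ hy => grd_eq_zero_off hy
  have hA := re_form_dilQT (hV := hV) (hV0 := hV0) s φ
  have k1 := abs_integral_dilKer_le (continuous_grd_chart φ) hg (l := 1) zero_le_one
    (by linarith) hs0.le hs1
  have k2 := abs_integral_dilKer_le (continuous_eul_chart φ) he (l := 0) le_rfl
    (by linarith) hs0.le hs1
  have k3 := abs_integral_conj_pairT_le hV hV0 hM hs0 hs1 φ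
  have k4 : |(inner ℂ (coreT V hV hV0 φ) (coreT V hV hV0 (mulT _ (contDiff_mulB ε) φ))).re|
      ≤ 4 * d * ‖coreT V hV hV0 φ‖ ^ 2 := by
    refine (abs_re_inner_le _ _).trans ?_
    have := mul_le_mul_of_nonneg_left (norm_coreT_mulB_le (hV := hV) (hV0 := hV0) hd hε0 hε1 φ)
      (norm_nonneg (coreT V hV hV0 φ))
    linarith
  have k5 : |(inner ℂ (inclT V hV hV0 φ) (inclT V hV hV0 (mulT _ (contDiff_mulB ε) φ))).re|
      ≤ d * ‖coreT V hV hV0 φ‖ ^ 2 := by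
    refine (abs_re_inner_le _ _).trans ?_
    have := mul_le_mul (norm_inclT_le (hV := hV) (hV0 := hV0) φ)
      (norm_inclT_mulB_le (hV := hV) (hV0 := hV0) hd hε0 hε1 φ) (norm_nonneg _) (norm_nonneg _)
    linarith
  have scale : ∀ {x K N : ℝ}, |x| ≤ K * s * N → |(2 * s)⁻¹ * x| ≤ K * N / 2 := fun {x K N} h => by
    rw [abs_mul, abs_of_pos (by positivity), inv_mul_le_iff₀ (by positivity)]
    linarith
  have l1 := abs_le.1 (scale k1)
  have l2 := abs_le.1 (scale k2)
  have l3 := abs_le.1 k3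
  have l4 := abs_le.1 k4
  have l5 := abs_le.1 k5
  have hn := norm_sq_coreT_eq_add (hV := hV) (hV0 := hV0) φ
  have n1 := integral_dens_mul_nonneg (g := fun y => ‖grd (chart φ) y‖ ^ 2) fun y => sq_nonneg _
  have n2 := integral_dens_mul_nonneg (g := fun y => ‖eul (chart φ) y‖ ^ 2) fun y => sq_nonneg _
  have n3 := integral_dens_mul_nonneg (g := fun y => ‖chart φ y‖ ^ 2) fun y => sq_nonneg _
  have n4 := integral_pot_nonneg hV0 φ
  have b : (∫ y, dens y * ‖grd (chart φ) y‖ ^ 2) + (∫ y, dens y * ‖eul (chart φ) y‖ ^ 2)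
      ≤ ‖coreT V hV hV0 φ‖ ^ 2 := by linarith
  have hK : 0 ≤ d * Real.exp d * (1 + Real.exp (d + 1)) := by positivity
  have b' := mul_le_mul_of_nonneg_left b hK
  have b2 := mul_nonneg hK (sq_nonneg ‖coreT V hV hV0 φ‖)
  have e : quotT d ε s φ = mulT _ contDiff_mulA (dilQT s φ) + mulT _ (contDiff_mulB ε) φ := rfl
  rw [e, map_add, map_add, inner_add_right, inner_add_right, Complex.add_re, Complex.add_re, abs_le]
  constructor <;> linarith

/-- The form of the regularized multiplier converges to the commutator form. -/
theorem tendsto_re_form_quotT (hd : 3 ≤ d) (ε : ℝ) (φ : TestFn d) :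
    Tendsto (fun s => (inner ℂ (coreT V hV hV0 φ) (coreT V hV hV0 (quotT d ε s φ))).re
      - (inner ℂ (inclT V hV hV0 φ) (inclT V hV hV0 (quotT d ε s φ))).re) (𝓝[>] 0)
      (𝓝 (∫ y, commD V ε φ y)) := by
  have hd' : (3 : ℝ) ≤ d := by exact_mod_cast hd
  have c0 := continuous_chart φ
  have c1 := continuous_eul_chart φ
  have c2 := continuous_grd_chart φ
  have c3 := continuous_pairT hV φ
  have hs := hasCompactSupport_chart φ
  have he : HasCompactSupport (eul (chart φ)) :=
    HasCompactSupport.intro hs.isCompact fun _ hy => eul_eq_zero_off hy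
  have hg : HasCompactSupport (grd (chart φ)) :=
    HasCompactSupport.intro hs.isCompact fun _ hy => grd_eq_zero_off hy
  have hp : HasCompactSupport (pairT V φ) :=
    HasCompactSupport.intro hs.isCompact fun _ hy => pairT_zero_off hy
  have t1 := tendsto_integral_dilKer c2 hg (l := 1) zero_le_one (by linarith)
  have t2 := tendsto_integral_dilKer c1 he (l := 0) le_rfl (by linarith)
  have t3 := tendsto_integral_conj_mul_dilQ (contDiff_one_chart φ) hs c3 hp
  have t := ((t1.add t2).add t3).add_const
    ((inner ℂ (coreT V hV hV0 φ) (coreT V hV hV0 (mulT _ (contDiff_mulB ε) φ))).re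
      - (inner ℂ (inclT V hV hV0 φ) (inclT V hV hV0 (mulT _ (contDiff_mulB ε) φ))).re)
  have e : ∀ s, quotT d ε s φ = mulT _ contDiff_mulA (dilQT s φ) + mulT _ (contDiff_mulB ε) φ :=
    fun s => rfl
  refine (t.congr fun s => ?_).trans (le_of_eq (congrArg 𝓝 ?_))
  · rw [e, map_add, map_add, inner_add_right, inner_add_right, Complex.add_re, Complex.add_re,
      ← re_form_dilQT (hV := hV) (hV0 := hV0)]
    ring
  have hwe : Continuous (eul (wt : EuclideanSpace ℝ (Fin d) → ℝ)) :=
    continuous_eul (contDiff_inv_one_add_height (n := 1))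
  have cB' : Continuous fun y : EuclideanSpace ℝ (Fin d) => mulB' d ε (height y) := by
    unfold mulB'
    fun_prop (disch := exact fun y => by have := one_add_height_pos y; positivity)
  have i1 : Integrable fun y => ((2 * 1 - d) * wt y - eul wt y) / 2 * ‖grd (chart φ) y‖ ^ 2 :=
    integrable_of_off hs (by fun_prop) fun y hy => by simp [grd_eq_zero_off hy]
  have i2 : Integrable fun y => ((2 * 0 - d) * wt y - eul wt y) / 2 * ‖eul (chart φ) y‖ ^ 2 :=
    integrable_of_off hs (by fun_prop) fun y hy => by simp [eul_eq_zero_off hy]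
  have i3 : Integrable fun y => (conj (pairT V φ y) * eul (chart φ) y).re :=
    integrable_of_off hs (by fun_prop) fun y hy => by simp [eul_eq_zero_off hy]
  have i4 : Integrable fun y => dens y *
      (mulB d ε (height y) * (‖grd (chart φ) y‖ ^ 2 + ‖eul (chart φ) y‖ ^ 2)
        + height y * mulB' d ε (height y) * (conj (eul (chart φ) y) * chart φ y).re
        + V (graph y) * (mulB d ε (height y) * ‖chart φ y‖ ^ 2)) :=
    integrable_of_off hs (by fun_prop) fun y hy => by
      simp [chart_zero_off hy, eul_eq_zero_off hy, grd_eq_zero_off hy]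
  rw [re_form_mulB]
  rw [← integral_add i1 i2]
  refine (congrArg (· + _) (integral_add (i1.add i2) i3)).symm.trans ?_
  refine (integral_add ((i1.add i2).add i3) i4).symm.trans ?_
  refine integral_congr_ae (.of_forall fun y => ?_)
  simp only [Pi.add_apply]
  have e1 : (conj (pairT V φ y) * eul (chart φ) y).re
      = dens y * (mulA (height y) * wt y * ‖eul (chart φ) y‖ ^ 2
        + V (graph y) * mulA (height y) * (conj (chart φ y) * eul (chart φ) y).re) := by
    rw [← re_conj_mul_self, ← Complex.re_ofReal_mul, ← Complex.re_ofReal_mul, ← Complex.add_re,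
      ← Complex.re_ofReal_mul]
    simp only [pairT, map_mul, map_add, Complex.conj_ofReal]
    congr 1
    ring
  have e2 : (conj (eul (chart φ) y) * chart φ y).re = (conj (chart φ y) * eul (chart φ) y).re := by
    rw [← Complex.conj_re, map_mul, Complex.conj_conj, mul_comm]
  have e3 : eul wt y = -1 / (1 + height y) ^ 2 * (height y ^ 2 - 1) / height y :=
    eul_comp_height (F := fun c => (1 + c)⁻¹) y (hasDerivAt_inv_one_add (height_pos y))
  have hp1 := (height_pos y).ne'
  have hp2 := (one_add_height_pos y).ne'
  have hd1 : dens y = (height y)⁻¹ := rfl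
  have hw1 : wt y = (1 + height y)⁻¹ := rfl
  rw [e1, e2, e3, commD, re_conj_mul_multT, hd1, hw1]
  simp only [mulA, mulB]
  field_simp
  ring

end Regularized

end HypWave
end

/-! ### The multiplier on the form domain, and the estimate -/

noncomputable section

namespace HypWave

open Filter Topology

section Weight

variable {d : ℕ}

/-- The weight `1 / (1 + cosh r)` on hyperbolic space. -/
def wtHyp (x : Hyp d) : ℝ := wt x.1.1

theorem continuous_wtHyp : Continuous (wtHyp : Hyp d → ℝ) := by unfold wtHyp; fun_prop

theorem memLp_wtHyp_mul (f : Lp ℂ 2 (vol d)) :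
    MemLp (fun x => (wtHyp x : ℂ) * f x) 2 (vol d) := by
  refine (Lp.memLp f).of_le ?_ (.of_forall fun x => ?_)
  · have := continuous_wtHyp (d := d)
    exact (Continuous.aestronglyMeasurable (by fun_prop)).mul (Lp.memLp f).1
  · rw [norm_mul, Complex.norm_real, wtHyp, Real.norm_of_nonneg (wt_pos _).le]
    exact mul_le_of_le_one_left (norm_nonneg _) ((wt_le_dens _).trans (dens_le_one _))

/-- Multiplication by the weight. -/
def wtOp (d : ℕ) : Lp ℂ 2 (vol d) →L[ℂ] Lp ℂ 2 (vol d) :=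
  LinearMap.mkContinuous
    { toFun := fun f => (memLp_wtHyp_mul f).toLp _
      map_add' := fun f g => by
        ext1
        filter_upwards [(memLp_wtHyp_mul (f + g)).coeFn_toLp, (memLp_wtHyp_mul f).coeFn_toLp,
          (memLp_wtHyp_mul g).coeFn_toLp, Lp.coeFn_add f g,
          Lp.coeFn_add ((memLp_wtHyp_mul f).toLp _) ((memLp_wtHyp_mul g).toLp _)]
          with x h1 h2 h3 h4 h5
        rw [h1, h5, Pi.add_apply, h2, h3, h4, Pi.add_apply, mul_add]
      map_smul' := fun c f => by
        ext1
        filter_upwards [(memLp_wtHyp_mul (c • f)).coeFn_toLp, (memLp_wtHyp_mul f).coeFn_toLp,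
          Lp.coeFn_smul c f, Lp.coeFn_smul c ((memLp_wtHyp_mul f).toLp _)] with x h1 h2 h3 h4
        rw [h1, RingHom.id_apply, h4, Pi.smul_apply, h2, h3, Pi.smul_apply, smul_eq_mul,
          smul_eq_mul, mul_left_comm] } 1 fun f => by
    rw [one_mul]
    refine Lp.norm_le_norm_of_ae_le ?_
    filter_upwards [(memLp_wtHyp_mul f).coeFn_toLp] with x hx
    change ‖(memLp_wtHyp_mul f).toLp _ x‖ ≤ _
    rw [hx, norm_mul, Complex.norm_real, wtHyp, Real.norm_of_nonneg (wt_pos _).le]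
    exact mul_le_of_le_one_left (norm_nonneg _) ((wt_le_dens _).trans (dens_le_one _))

theorem coeFn_wtOp (f : Lp ℂ 2 (vol d)) : wtOp d f =ᵐ[vol d] fun x => (wtHyp x : ℂ) * f x :=
  (memLp_wtHyp_mul f).coeFn_toLp

variable {V : Hyp d → ℝ} {hV : Continuous V} {hV0 : ∀ x, 0 ≤ V x}

theorem coeFn_inclT (φ : TestFn d) : inclT V hV hV0 φ =ᵐ[vol d] (φ : Hyp d → ℂ) :=
  (FormCore.memLp V hV hV0 (toCore V hV hV0 φ)).coeFn_toLp

theorem wtOp_inclT (φ : TestFn d) :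
    wtOp d (inclT V hV hV0 φ) = inclT V hV hV0 (mulT wt contDiff_inv_one_add_height φ) := by
  ext1
  filter_upwards [coeFn_wtOp (inclT V hV hV0 φ), coeFn_inclT (hV := hV) (hV0 := hV0) φ,
    coeFn_inclT (hV := hV) (hV0 := hV0) (mulT wt contDiff_inv_one_add_height φ)] with x h1 h2 h3
  rw [h1, h2, h3]
  change _ = (wt x.1.1 : ℂ) * (φ : Hyp d → ℂ) (graph x.1.1)
  rw [graph_fst]
  rfl

theorem norm_sq_wtOp_inclT (φ : TestFn d) : ‖wtOp d (inclT V hV hV0 φ)‖ ^ 2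
    = ∫ y, dens y * ((1 + height y)⁻¹ ^ 2 * ‖chart φ y‖ ^ 2) := by
  rw [wtOp_inclT, norm_sq_inclT]
  refine integral_congr_ae (.of_forall fun y => ?_)
  change dens y * ‖(wt y : ℂ) * chart φ y‖ ^ 2 = dens y * (wt y ^ 2 * ‖chart φ y‖ ^ 2)
  rw [norm_mul, Complex.norm_real, Real.norm_of_nonneg (wt_pos y).le, mul_pow]

end Weight

section Multiplier

variable {d : ℕ} {V : Hyp d → ℝ} {hV : Continuous V} {hV0 : ∀ x, 0 ≤ V x}

theorem norm_incl_apply_le (hd : 3 ≤ d) (v : FormSpace V hV hV0) :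
    2 * ‖incl V hV hV0 v‖ ^ 2 ≤ ‖v‖ ^ 2 := by
  refine (denseRange_coreT V hV hV0).induction
    (P := fun v => 2 * ‖incl V hV hV0 v‖ ^ 2 ≤ ‖v‖ ^ 2) ?_ ?_ v
  · rintro _ ⟨φ, rfl⟩
    rw [incl_coreT]
    exact two_mul_norm_sq_inclT_le hd φ
  · exact isClosed_le (by fun_prop) (by fun_prop)

/-- The multiplier on the form domain. -/
def multOp (V : Hyp d → ℝ) (hV : Continuous V) (hV0 : ∀ x, 0 ≤ V x) (hd : 3 ≤ d) {ε : ℝ}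
    (hε0 : 0 ≤ ε) (hε1 : ε ≤ 1) : FormSpace V hV hV0 →L[ℂ] Lp ℂ 2 (vol d) :=
  extT V hV hV0 (inclT V hV hV0 ∘ₗ multT d ε) (1 + d) (norm_inclT_multT_le hd hε0 hε1)

theorem multOp_coreT (hd : 3 ≤ d) {ε : ℝ} (hε0 : 0 ≤ ε) (hε1 : ε ≤ 1) (φ : TestFn d) :
    multOp V hV hV0 hd hε0 hε1 (coreT V hV hV0 φ) = inclT V hV hV0 (multT d ε φ) :=
  extT_coreT _ φ

theorem re_inner_incl_multOp_le (hd : 3 ≤ d) {ε : ℝ} (hε0 : 0 ≤ ε) (hε1 : ε ≤ 1)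
    (v : FormSpace V hV hV0) :
    (inner ℂ (incl V hV hV0 v) (multOp V hV hV0 hd hε0 hε1 v)).re
      ≤ -ε * ‖wtOp d (incl V hV hV0 v)‖ ^ 2 := by
  refine (denseRange_coreT V hV hV0).induction
    (P := fun v => (inner ℂ (incl V hV hV0 v) (multOp V hV hV0 hd hε0 hε1 v)).re
      ≤ -ε * ‖wtOp d (incl V hV hV0 v)‖ ^ 2) ?_ ?_ v
  · rintro _ ⟨φ, rfl⟩
    rw [incl_coreT, multOp_coreT, re_inner_inclT, norm_sq_wtOp_inclT, integral_conj_mul_multT]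
  · exact isClosed_le (by fun_prop) (by fun_prop)

theorem re_inner_sub_multOp_nonneg (hd : 3 ≤ d) {hV1 : HypContDiff 1 V} {M ε : ℝ}
    (hM : ∀ x, V x ≤ M) (hrep : ∀ y : EuclideanSpace ℝ (Fin d), eul (V ∘ graph) y ≤ 0)
    (hε0 : 0 ≤ ε) (hε1 : ε ≤ 1) (hε : ε * (d / 2 * d + M) ≤ d * (d - 2) / 4)
    (x : Lp ℂ 2 (vol d)) :
    0 ≤ (inner ℂ (x - incl V hV hV0 ((incl V hV hV0).adjoint x))
      (multOp V hV hV0 hd hε0 hε1 ((incl V hV hV0).adjoint x))).re := by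
  set ι := incl V hV hV0 with hι
  set v := ι.adjoint x with hv
  choose K hK using exists_norm_coreT_quotT_le (hV := hV) (hV0 := hV0) hd hε0 hε1 hM
  set T : ℝ → FormSpace V hV hV0 →L[ℂ] FormSpace V hV hV0 := fun s =>
    extT V hV hV0 (coreT V hV hV0 ∘ₗ quotT d ε s) (K s) (hK s) with hT
  have hTφ : ∀ s φ, T s (coreT V hV hV0 φ) = coreT V hV hV0 (quotT d ε s φ) :=
    fun s φ => extT_coreT _ φ
  have hιT : ∀ s φ, (ι ∘L T s) (coreT V hV hV0 φ) = inclT V hV hV0 (quotT d ε s φ) := fun s φ => by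
    rw [ContinuousLinearMap.comp_apply, hTφ, hι, incl_coreT]
  have hI : ∀ᶠ s : ℝ in 𝓝[>] 0, s ∈ Set.Ioc (0 : ℝ) 1 :=
    Ioc_mem_nhdsGT (show (0 : ℝ) < 1 by norm_num)
  have hbound : ∀ᶠ s in 𝓝[>] 0, ‖ι ∘L T s‖ ≤ √(Real.exp (d + 1)) + d := by
    filter_upwards [hI] with s hs
    refine ContinuousLinearMap.opNorm_le_bound _ (by positivity) fun w => ?_
    refine (denseRange_coreT V hV hV0).induction
      (P := fun w => ‖(ι ∘L T s) w‖ ≤ (√(Real.exp (d + 1)) + d) * ‖w‖) ?_ ?_ w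
    · rintro _ ⟨φ, rfl⟩
      rw [hιT]
      exact norm_inclT_quotT_le hd hε0 hε1 hs.1 hs.2 φ
    · exact isClosed_le (by fun_prop) (by fun_prop)
  have hlim : ∀ w, Tendsto (fun s => (ι ∘L T s) w) (𝓝[>] 0)
      (𝓝 (multOp V hV hV0 hd hε0 hε1 w)) := by
    refine tendsto_apply_of_dense hbound (denseRange_coreT V hV hV0) ?_
    rintro _ ⟨φ, rfl⟩
    simp only [hιT, multOp_coreT]
    exact tendsto_inclT_quotT ε φ
  have hform : ∀ s w, (inner ℂ w ((T s - ι.adjoint ∘L ι ∘L T s) w)).re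
      = (inner ℂ w (T s w)).re - (inner ℂ (ι w) (ι (T s w))).re := fun s w => by
    rw [sub_apply, inner_sub_right, Complex.sub_re,
      ContinuousLinearMap.comp_apply, ContinuousLinearMap.adjoint_inner_right,
      ContinuousLinearMap.comp_apply]
  refine quadratic_limit_nonneg (l := 𝓝[>] 0) (A := fun s => T s - ι.adjoint ∘L ι ∘L T s)
    (C := d * Real.exp d * (1 + Real.exp (d + 1)) + (2 + 2 * M ^ 2 + Real.exp (d + 1)) + 5 * d)
    (by positivity) (denseRange_coreT V hV hV0) ?_ ?_ (v := v) ?_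
  · filter_upwards [hI] with s hs
    rintro _ ⟨φ, rfl⟩
    rw [hform, hTφ, hι, incl_coreT, incl_coreT]
    exact abs_re_form_quotT_le hd hε0 hε1 hM hs.1 hs.2 φ
  · rintro _ ⟨φ, rfl⟩
    refine ⟨_, integral_commD_nonneg hd hV1 hV0 hM hrep hε0 hε1 hε φ, ?_⟩
    refine (tendsto_re_form_quotT (hV := hV) (hV0 := hV0) hd ε φ).congr fun s => ?_
    rw [hform, hTφ, hι, incl_coreT, incl_coreT]
  · have h' := (Complex.continuous_re.tendsto _).comp
      ((tendsto_const_nhds (x := x - ι v)).inner (𝕜 := ℂ) (hlim v))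
    refine h'.congr fun s => ?_
    rw [hform, Function.comp_apply, inner_sub_left, Complex.sub_re, hv,
      ContinuousLinearMap.adjoint_inner_left]
    rfl

end Multiplier

section Potential

variable {d : ℕ} {V : Hyp d → ℝ}

theorem eul_nonpos_of_repulsive (hV : HypContDiff 1 V) (hrep : Repulsive V)
    (y : EuclideanSpace ℝ (Fin d)) : eul (V ∘ graph) y ≤ 0 := by
  by_cases hy : y = 0
  · simp [eul, hy]
  have hn : 0 < ‖y‖ := norm_pos_iff.2 hy
  set r := Real.arsinh ‖y‖ with hr
  have hr0 : 0 < r := Real.arsinh_pos_iff.2 hn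
  have hsr : Real.sinh r = ‖y‖ := Real.sinh_arsinh _
  set θ : Metric.sphere (0 : EuclideanSpace ℝ (Fin d)) 1 :=
    ⟨‖y‖⁻¹ • y, by simp [norm_smul, hn.ne']⟩ with hθ
  have hp : ∀ s, V (polar s θ) = (V ∘ graph) (Real.sinh s • (θ : EuclideanSpace ℝ (Fin d))) :=
    fun s => congrArg V (graph_fst (polar s θ)).symm
  have e : Real.sinh r • (θ : EuclideanSpace ℝ (Fin d)) = y := by
    rw [hsr, hθ, smul_smul, mul_inv_cancel₀ hn.ne', one_smul]
  have h1 : HasDerivAt (fun s => Real.sinh s • (θ : EuclideanSpace ℝ (Fin d)))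
      (Real.cosh r • (θ : EuclideanSpace ℝ (Fin d))) r := (Real.hasDerivAt_sinh r).smul_const _
  have hVd : DifferentiableAt ℝ (V ∘ graph) (Real.sinh r • (θ : EuclideanSpace ℝ (Fin d))) :=
    (ContDiff.differentiable hV (by simp)).differentiableAt
  have h2 := (hVd.hasFDerivAt.comp_hasDerivAt r h1).deriv
  have h3 := hrep θ r hr0
  simp only [hp] at h3
  have h4 : deriv (fun s => (V ∘ graph) (Real.sinh s • (θ : EuclideanSpace ℝ (Fin d)))) r
      = Real.cosh r * ‖y‖⁻¹ * eul (V ∘ graph) y := by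
    refine h2.trans ?_
    rw [e, hθ, map_smul, map_smul, smul_eq_mul, smul_eq_mul, mul_assoc]
    rfl
  rw [h4] at h3
  have h5 : 0 < Real.cosh r * ‖y‖⁻¹ := mul_pos (Real.cosh_pos r) (inv_pos.2 hn)
  by_contra h6
  have := mul_pos h5 (not_le.1 h6)
  linarith

theorem le_origin_of_repulsive (hV : HypContDiff 1 V) (hrep : Repulsive V) (x : Hyp d) :
    V x ≤ V (graph 0) := by
  have hd : ∀ t : ℝ, HasDerivAt (fun t : ℝ => (V ∘ graph) (t • x.1.1))
      (fderiv ℝ (V ∘ graph) (t • x.1.1) x.1.1) t := fun t => by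
    have h1 : HasDerivAt (fun t : ℝ => t • x.1.1) x.1.1 t := by
      simpa using (hasDerivAt_id t).smul_const x.1.1
    exact ((ContDiff.differentiable hV (by simp)).differentiableAt.hasFDerivAt).comp_hasDerivAt t h1
  have h := antitoneOn_of_deriv_nonpos (convex_Icc (0 : ℝ) 1)
    (f := fun t : ℝ => (V ∘ graph) (t • x.1.1))
    (fun t _ => (hd t).continuousAt.continuousWithinAt)
    (fun t _ => (hd t).differentiableAt.differentiableWithinAt) fun t ht => by
      rw [interior_Icc] at ht
      rw [(hd t).deriv]
      have h1 := eul_nonpos_of_repulsive hV hrep (t • x.1.1)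
      rw [eul, map_smul, smul_eq_mul] at h1
      by_contra h2
      have := mul_pos ht.1 (not_le.1 h2)
      linarith
  have h2 := h (Set.left_mem_Icc.2 zero_le_one) (Set.right_mem_Icc.2 zero_le_one) zero_le_one
  simp only [one_smul, zero_smul, Function.comp_apply, graph_fst] at h2
  exact h2

end Potential

section Estimate

variable {d : ℕ}

theorem cosh_radius (x : Hyp d) : Real.cosh (radius x) = height x.1.1 := by
  have h1 : lorentz x.1 (origin d).1 = height x.1.1 := by
    have h2 : (graph x.1.1).1.2 = x.1.2 := by rw [graph_fst]
    have h3 : lorentz x.1 (origin d).1 = x.1.2 := by simp [lorentz, origin]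
    rw [h3, ← h2]
    rfl
  rw [radius, h1, Real.cosh_arcosh (one_le_height _)]

theorem dens_le_two_mul_wt (y : EuclideanSpace ℝ (Fin d)) : dens y ≤ 2 * wt y := by
  have h := one_le_height y
  rw [dens, wt, inv_eq_one_div, ← div_eq_mul_inv, div_le_div_iff₀ (height_pos y)
    (one_add_height_pos y)]
  linarith

theorem eLpNorm_inv_cosh_mul_le (g : Lp ℂ 2 (vol d)) :
    eLpNorm (fun x => (((Real.cosh (radius x))⁻¹ : ℝ) : ℂ) * g x) 2 (vol d)
      ≤ 2 * ‖wtOp d g‖ₑ := by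
  have h : eLpNorm (fun x => (((Real.cosh (radius x))⁻¹ : ℝ) : ℂ) * g x) 2 (vol d)
      ≤ ENNReal.ofReal 2 * eLpNorm (wtOp d g) 2 (vol d) := by
    refine eLpNorm_le_mul_eLpNorm_of_ae_le_mul ?_ 2
    filter_upwards [coeFn_wtOp g] with x hx
    rw [hx, norm_mul, norm_mul, Complex.norm_real, Complex.norm_real, cosh_radius, ← mul_assoc,
      wtHyp, Real.norm_of_nonneg (wt_pos _).le, Real.norm_of_nonneg (inv_pos.2 (height_pos _)).le]
    exact mul_le_mul_of_nonneg_right (dens_le_two_mul_wt _) (norm_nonneg _)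
  simpa [Lp.enorm_def] using h

/-- Local smoothing for the half-wave propagator, with an explicit weight. -/
theorem exists_lintegral_wtOp_halfWave_le (hd : 3 ≤ d) {V : Hyp d → ℝ} (hV : HypContDiff 1 V)
    (hV0 : ∀ x, 0 ≤ V x) (hrep : Repulsive V) :
    ∃ K : ℝ, 0 ≤ K ∧ ∀ f : Lp ℂ 2 (vol d),
      ∫⁻ t : ℝ, ‖wtOp d (halfWave V hV.continuous hV0 t f)‖ₑ ^ 2
        ≤ ENNReal.ofReal (K * ‖f‖ ^ 2) := by
  have hd' : (3 : ℝ) ≤ d := by exact_mod_cast hd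
  set M := V (graph 0) with hMdef
  have hM0 : 0 ≤ M := hV0 _
  set ε : ℝ := d * (d - 2) / 4 / (d / 2 * d + M) with hεdef
  have hden : 0 < (d : ℝ) / 2 * d + M := by positivity
  have hnum : 0 < (d : ℝ) * (d - 2) / 4 := by
    have : (0 : ℝ) < d - 2 := by linarith
    positivity
  have hε0 : 0 < ε := div_pos hnum hden
  have hε1 : ε ≤ 1 := by
    rw [hεdef, div_le_one hden]
    nlinarith
  have hε : ε * (d / 2 * d + M) ≤ d * (d - 2) / 4 := (div_mul_cancel₀ _ hden.ne').le
  refine ⟨4 * ‖multOp V hV.continuous hV0 hd hε0.le hε1‖ / ε, by positivity, fun f => ?_⟩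
  exact lintegral_funCalc_le_of_commutator hε0 (norm_incl_apply_le hd)
    (resolvent_isSelfAdjoint V hV.continuous hV0) (denseRange_resolvent V hV.continuous hV0)
    (re_inner_incl_multOp_le hd hε0.le hε1)
    (re_inner_sub_multOp_nonneg (hV1 := hV) hd (le_origin_of_repulsive hV hrep)
      (eul_nonpos_of_repulsive hV hrep) hε0.le hε1 hε) f

theorem spacetimeNorm_le_of_lintegral_le {U : ℝ → Lp ℂ 2 (vol d)} {K : ℝ} (hK : 0 ≤ K)
    {f : Lp ℂ 2 (vol d)}
    (h : ∫⁻ t : ℝ, ‖wtOp d (U t)‖ₑ ^ 2 ≤ ENNReal.ofReal (K * ‖f‖ ^ 2)) :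
    spacetimeNorm (fun t x => (((Real.cosh (radius x))⁻¹ : ℝ) : ℂ) * U t x)
      ≤ (2 * NNReal.sqrt K.toNNReal : NNReal) * eLpNorm f 2 (vol d) := by
  have h1 : ∫⁻ t : ℝ, eLpNorm (fun x => (((Real.cosh (radius x))⁻¹ : ℝ) : ℂ) * U t x) 2 (vol d) ^ 2
      ≤ ((2 * NNReal.sqrt K.toNNReal : NNReal) * eLpNorm f 2 (vol d)) ^ 2 := by
    calc _ ≤ ∫⁻ t : ℝ, 2 ^ 2 * ‖wtOp d (U t)‖ₑ ^ 2 := by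
          refine lintegral_mono fun t => ?_
          rw [← mul_pow]
          exact pow_le_pow_left₀ zero_le (eLpNorm_inv_cosh_mul_le (U t)) 2
      _ = 2 ^ 2 * ∫⁻ t : ℝ, ‖wtOp d (U t)‖ₑ ^ 2 := lintegral_const_mul' _ _ (by simp)
      _ ≤ 2 ^ 2 * ENNReal.ofReal (K * ‖f‖ ^ 2) := by gcongr
      _ = _ := by
          have e1 : ((NNReal.sqrt K.toNNReal : NNReal) : ℝ≥0∞) ^ 2 = ENNReal.ofReal K := by
            rw [← ENNReal.coe_pow, NNReal.sq_sqrt]; rfl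
          rw [← Lp.enorm_def, ENNReal.ofReal_mul hK, ← e1, ENNReal.ofReal_pow (norm_nonneg _),
            ofReal_norm]
          push_cast
          ring
  have h2 := ENNReal.rpow_le_rpow h1 (by norm_num : (0 : ℝ) ≤ 1 / 2)
  refine h2.trans (le_of_eq ?_)
  rw [← ENNReal.rpow_natCast, ← ENNReal.rpow_mul]
  norm_num

end Estimate

end HypWave
end


theorem lemma10p2 (d : ℕ) (hd : 3 ≤ d) (V : Hyp d → ℝ) (hV : HypContDiff 1 V)
    (hV0 : ∀ x, 0 ≤ V x) (hrep : Repulsive V) :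
    ∃ C : NNReal, ∀ f : Lp ℂ 2 (vol d),
      spacetimeNorm (fun t x =>
          (((Real.cosh (radius x))⁻¹ : ℝ) : ℂ) * halfWave V hV.continuous hV0 t f x)
        ≤ C * eLpNorm f 2 (vol d) ∧
      spacetimeNorm (fun t x =>
          (((Real.cosh (radius x))⁻¹ : ℝ) : ℂ) * halfWave V hV.continuous hV0 (-t) f x)
        ≤ C * eLpNorm f 2 (vol d) := by
  obtain ⟨K, hK, h⟩ := exists_lintegral_wtOp_halfWave_le hd hV hV0 hrep
  refine ⟨_, fun f => ⟨spacetimeNorm_le_of_lintegral_le hK (h f),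
    spacetimeNorm_le_of_lintegral_le (U := fun t => halfWave V hV.continuous hV0 (-t) f) hK ?_⟩⟩
  have e := (Measure.measurePreserving_neg (volume : Measure ℝ)).lintegral_comp_emb
    (MeasurableEquiv.neg ℝ).measurableEmbedding
    fun t => ‖wtOp d (halfWave V hV.continuous hV0 t f)‖ₑ ^ 2
  exact e.le.trans (h f)
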